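/- Let $M$ be a compact $C^\infty$ manifold without boundary (Hausdorff, not necessarily connected) of dimension $n\ge 2$, equipped with a $C^\infty$ Riemannian metric. Let $SM=\{v\in TM : \|v\|=1\}$ be its unit tangent bundle, with the subspace topology of $TM$, and let $\Phi:\mathbb R\times SM\to SM$, $\Phi_t(v)=\dot\gamma_v(t)$, be its geodesic flow, where $\gamma_v:\mathbb R\to M$ is the geodesic with $\dot\gamma_v(0)=v$. Suppose that $\Phi$ is equicontinuous with respect to some metric $d$ on $SM$ that induces the topology of $SM$ (for instance the distance of the Sasaki metric, if $M$ is connected): for every $\varepsilon>0$ there is a $\delta>0$ such that for all $v,w\in SM$ with $d(v,w)<\delta$ one has $d(\Phi_t(v),\Phi_t(w))<\varepsilon$ for all $t\in\mathbb R$. Then the fundamental group $\pi_1(M,p)$ is finite for every $p\in M$. -/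

import Mathlib

open scoped Manifold ContDiff Bundle

noncomputable section

namespace Riem

section Charts

variable {n : ℕ} {M : Type*} [TopologicalSpace M] [ChartedSpace (EuclideanSpace ℝ (Fin n)) M]
  [Bundle.RiemannianBundle (fun x : M ↦ TangentSpace (𝓡 n) x)]

/-- The Riemannian metric in the chart `φ` at `x`: the number `g(dφ⁻¹ a, dφ⁻¹ b)` at the point of
`M` with coordinates `u`. In terms of the components of the metric this is `∑ gᵢⱼ(u) aᵢ bⱼ`. -/
def chartMetric (x : M) (u a b : EuclideanSpace ℝ (Fin n)) : ℝ :=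
  inner ℝ
    (mfderiv 𝓘(ℝ, EuclideanSpace ℝ (Fin n)) (𝓡 n) (extChartAt (𝓡 n) x).symm u a)
    (mfderiv 𝓘(ℝ, EuclideanSpace ℝ (Fin n)) (𝓡 n) (extChartAt (𝓡 n) x).symm u b)

/-- The Christoffel symbols of the first kind of the Riemannian metric in the chart at `x`, at the
coordinates `u`, contracted with three vectors: with `a = eᵢ`, `b = eⱼ`, `w = eₖ` this is
`(∂ᵢ gⱼₖ + ∂ⱼ gᵢₖ - ∂ₖ gᵢⱼ) / 2`, i.e. `g(∇_{∂ᵢ} ∂ⱼ, ∂ₖ)` for the Levi-Civita connection `∇`. -/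
def christoffel (x : M) (u a b w : EuclideanSpace ℝ (Fin n)) : ℝ :=
  (fderiv ℝ (fun z ↦ chartMetric x z b w) u a + fderiv ℝ (fun z ↦ chartMetric x z a w) u b
    - fderiv ℝ (fun z ↦ chartMetric x z a b) u w) / 2

variable (n) in
/-- A curve `γ : ℝ → M` is a (complete) geodesic if it is of class `C²` and satisfies the geodesic
equation `∇_{γ'} γ' = 0`. In each chart of `M`, the coordinate expression `c` of `γ` has to satisfy
`g(c'', w) + Γ(c', c'; w) = 0` for all `w`, which is `c''ᵏ + Γᵏᵢⱼ c'ⁱ c'ʲ = 0` with the index `k`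
lowered by means of the metric. -/
structure IsGeodesic (γ : ℝ → M) : Prop where
  contMDiff : ContMDiff 𝓘(ℝ, ℝ) (𝓡 n) 2 γ
  geodesic_equation : ∀ (x : M) (t : ℝ), γ t ∈ (extChartAt (𝓡 n) x).source →
    ∀ w : EuclideanSpace ℝ (Fin n),
      let c : ℝ → EuclideanSpace ℝ (Fin n) := fun s ↦ extChartAt (𝓡 n) x (γ s)
      chartMetric x (c t) (deriv (deriv c) t) w
        + christoffel x (c t) (deriv c t) (deriv c t) w = 0

end Charts

section Flow

variable (n : ℕ) (M : Type*) [TopologicalSpace M] [ChartedSpace (EuclideanSpace ℝ (Fin n)) M]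
  [Bundle.RiemannianBundle (fun x : M ↦ TangentSpace (𝓡 n) x)]

/-- The unit tangent bundle `SM`. Its topology is the subspace topology of the tangent bundle. -/
abbrev UnitTangentBundle : Type _ := {v : TangentBundle (𝓡 n) M // ‖v.2‖ = 1}

variable {M} in
/-- The velocity `γ'(t)` of a curve, as a point of the tangent bundle. -/
def velocity (γ : ℝ → M) (t : ℝ) : TangentBundle (𝓡 n) M :=
  ⟨γ t, mfderiv 𝓘(ℝ, ℝ) (𝓡 n) γ t (1 : ℝ)⟩

variable {n M} in
/-- The orbits of the geodesic flow: the curves `w` in `SM` of the form `w = γ'`, where `γ` is a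
geodesic (which then has unit speed). -/
def IsGeodesicOrbit (w : ℝ → UnitTangentBundle n M) : Prop :=
  ∃ γ : ℝ → M, IsGeodesic n γ ∧ ∀ t, (w t : TangentBundle (𝓡 n) M) = velocity n γ t

open Classical in
/-- The geodesic flow `Φ : ℝ × SM → SM`, `Φ t v = γ_v'(t)`, where `γ_v` is the geodesic with initial
velocity `v`. This geodesic is unique if it exists; it exists for every `v` whenever the manifold is
complete, in particular if it is compact. (A vector `v` whose geodesic is not defined on all of `ℝ`
is given the value `v`.) -/
def geodesicFlow (t : ℝ) (v : UnitTangentBundle n M) : UnitTangentBundle n M :=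
  if h : ∃ w : ℝ → UnitTangentBundle n M, IsGeodesicOrbit w ∧ w 0 = v then h.choose t else v

end Flow

/-- A flow `Φ` on a metric space with distance `d` is equicontinuous if for every `ε > 0` there is
`δ > 0` such that `d(x, y) < δ` implies `d(Φ t x, Φ t y) < ε` for all times `t`. -/
def IsEquicontinuousFlow {X : Type*} (d : MetricSpace X) (Φ : ℝ → X → X) : Prop :=
  ∀ ε > 0, ∃ δ > 0, ∀ x y : X, d.dist x y < δ → ∀ t : ℝ, d.dist (Φ t x) (Φ t y) < ε

end Riem

end

section

open Filter Topology
open scoped ContDiff Manifold Bundle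

set_option maxSynthPendingDepth 3

namespace Riem

/-! ### Local cocycles and lifts of Lipschitz curves -/

section

/-! Equicontinuity of the geodesic flow and compactness of `SM` give, by a pigeonhole argument, a
time `T ≥ 1` at which `Φ_T` is uniformly close to the identity (`exists_almost_period`). Each
geodesic arc of length `T`, closed up by a short path, then has a class `A v` in the fundamental
group. By equicontinuity `A` is locally constant on the fibres of `SM`. These are spheres of
dimension `n - 1 ≥ 1`, hence connected, so `A (-v) = A v`. Running the arc backwards inverts the
class, so `A v` has square `1` and the arc of length `2T` closes up with trivial holonomy
(`exists_trivial_holonomy`). In the universal covering, every geodesic arc of length `2T` thus has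
its endpoints at distance less than `1` and is not minimising. Minimisers in the covering are
therefore no longer than `2T + 2`, and only finitely many points of a fibre lie within that distance
of a given one (`finite_of_equicontinuous_flow`).

The covering itself is not constructed. It is replaced by pairs `(x, g)` in `X × G` together with a
local cocycle `u`, the holonomy of short paths; a curve in the covering is a curve `c` in `X` with a
companion `a` in `G` such that `a t = a s * u (c s) (c t)` at close times. Minimisers exist by the
direct method (`exists_reach_sInf`), and the same compactness yields finiteness
(`finite_setOf_reach`). `exists_isLocalCocycle` provides `u` with values in the fundamental group.

The geometric input is that locally distance-realising curves are orbits of the flow. Neither an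
exponential map nor the Gauss lemma is needed: in a chart the squared distance agrees with the
metric tensor up to a cubic error (`exists_chart_estimate`), so by the parallelogram law such curves
have second differences of order `h^(3/2)` and are `C¹`. The first variation of the energy and the
lemma of du Bois-Reymond then give the geodesic equation (`isGeodesicAt_of_isometric`). -/

/-- A function `u` on pairs of points of a metric space with values in a group which is a cocycle
for triples of points at mutual distances less than `r`. -/
structure IsLocalCocycle {X G : Type*} [PseudoMetricSpace X] [Group G] (r : ℝ) (u : X → X → G) :
    Prop where
  pos : 0 < r
  mul : ∀ x y z, dist x y < r → dist y z < r → dist x z < r → u x y * u y z = u x z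

/-- A pair of curves `c` in `X` and `a` in `G` such that `c` is `1`-Lipschitz and `a` is its
horizontal lift with respect to the local cocycle `u`. -/
structure IsLift {X G : Type*} [PseudoMetricSpace X] [Group G] (r : ℝ) (u : X → X → G)
    (c : ℝ → X) (a : ℝ → G) : Prop where
  lip : ∀ s t, dist (c s) (c t) ≤ |s - t|
  lift : ∀ s t, |s - t| < r → a t = a s * u (c s) (c t)

/-- There is a lift which leads from `(x, g)` to `(y, h)` in time `L`. -/
def Reach {X G : Type*} [PseudoMetricSpace X] [Group G] (r : ℝ) (u : X → X → G)
    (x : X) (g : G) (y : X) (h : G) (L : ℝ) : Prop :=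
  0 ≤ L ∧ ∃ c a, IsLift r u c a ∧ c 0 = x ∧ a 0 = g ∧ c L = y ∧ a L = h

section Cocycle

variable {X G : Type*} [MetricSpace X] [Group G] {r : ℝ} {u : X → X → G}

lemma IsLocalCocycle.self (hu : IsLocalCocycle r u) (x : X) : u x x = 1 := by
  have := hu.mul x x x (by simpa using hu.pos) (by simpa using hu.pos) (by simpa using hu.pos)
  simpa using this

lemma IsLocalCocycle.symm (hu : IsLocalCocycle r u) {x y : X} (h : dist x y < r) :
    u x y * u y x = 1 := by
  rw [hu.mul x y x h (by rwa [dist_comm]) (by simpa using hu.pos), hu.self]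

lemma IsLift.const (hu : IsLocalCocycle r u) (x : X) (g : G) :
    IsLift r u (fun _ ↦ x) (fun _ ↦ g) :=
  ⟨fun s t ↦ by simp, fun s t _ ↦ by simp [hu.self]⟩

lemma IsLift.shift {c : ℝ → X} {a : ℝ → G} (h : IsLift r u c a) (σ : ℝ) :
    IsLift r u (fun t ↦ c (t + σ)) (fun t ↦ a (t + σ)) :=
  ⟨fun s t ↦ by simpa using h.lip (s + σ) (t + σ),
    fun s t hst ↦ h.lift _ _ (by simpa using hst)⟩

/-- Across the time `τ`, the two lifts compose by the cocycle identity at the common point `c τ`. -/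
lemma IsLift.glue (hu : IsLocalCocycle r u) {c c' : ℝ → X} {a a' : ℝ → G} (h : IsLift r u c a)
    (h' : IsLift r u c' a') {τ : ℝ} (hc : c τ = c' τ) (ha : a τ = a' τ) :
    IsLift r u (fun t ↦ if t ≤ τ then c t else c' t) (fun t ↦ if t ≤ τ then a t else a' t) := by
  have key : ∀ s t, s ≤ τ → τ < t → dist (c s) (c' t) ≤ |s - t| := by
    intro s t hs ht
    have h1 := h.lip s τ
    have h2 := h'.lip τ t
    rw [← hc] at h2
    rw [abs_of_nonpos (by linarith)] at h1 h2 ⊢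
    linarith [dist_triangle (c s) (c τ) (c' t)]
  have key2 : ∀ s t, s ≤ τ → τ < t → |s - t| < r → a' t = a s * u (c s) (c' t) := by
    intro s t hs ht hst
    have h0 : |s - τ| < r := by
      rw [abs_of_nonpos (by linarith)] at hst ⊢; linarith
    have h1 : |τ - t| < r := by
      rw [abs_of_nonpos (by linarith)] at hst ⊢; linarith
    rw [h'.lift τ t h1, ← ha, ← hc, h.lift s τ h0, mul_assoc, hu.mul]
    · exact (h.lip _ _).trans_lt h0
    · rw [hc]; exact (h'.lip _ _).trans_lt h1
    · exact (key s t hs ht).trans_lt hst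
  constructor
  · intro s t
    by_cases hs : s ≤ τ <;> by_cases ht : t ≤ τ <;> simp only [hs, ht, if_true, if_false]
    · exact h.lip s t
    · exact key s t hs (not_le.1 ht)
    · rw [dist_comm, abs_sub_comm]; exact key t s ht (not_le.1 hs)
    · exact h'.lip s t
  · intro s t hst
    by_cases hs : s ≤ τ <;> by_cases ht : t ≤ τ <;> simp only [hs, ht, if_true, if_false]
    · exact h.lift s t hst
    · exact key2 s t hs (not_le.1 ht) hst
    · have h3 := key t s ht (not_le.1 hs)
      rw [abs_sub_comm] at hst
      rw [key2 t s ht (not_le.1 hs) hst, mul_assoc, hu.symm (h3.trans_lt hst), mul_one]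
    · exact h'.lift s t hst

lemma Reach.refl (hu : IsLocalCocycle r u) (x : X) (g : G) {L : ℝ} (hL : 0 ≤ L) :
    Reach r u x g x g L :=
  ⟨hL, _, _, IsLift.const hu x g, rfl, rfl, rfl, rfl⟩

lemma IsLift.reach {c : ℝ → X} {a : ℝ → G} (h : IsLift r u c a) {s t : ℝ} (hst : s ≤ t) :
    Reach r u (c s) (a s) (c t) (a t) (t - s) :=
  ⟨by linarith, _, _, h.shift s, by simp, by simp, by simp, by simp⟩

lemma Reach.trans (hu : IsLocalCocycle r u) {x y z : X} {g h k : G} {L L' : ℝ}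
    (h1 : Reach r u x g y h L) (h2 : Reach r u y h z k L') : Reach r u x g z k (L + L') := by
  obtain ⟨hL, c, a, hl, hc0, ha0, hcL, haL⟩ := h1
  obtain ⟨hL', c', a', hl', hc0', ha0', hcL', haL'⟩ := h2
  refine ⟨by linarith, _, _, hl.glue hu (hl'.shift (-L)) (τ := L) (by simp [hcL, hc0'])
    (by simp [haL, ha0']), by simp [hL, hc0], by simp [hL, ha0], ?_, ?_⟩
  · rcases hL'.eq_or_lt with h | h
    · subst h; simp_all
    · simp [h, hcL']
  · rcases hL'.eq_or_lt with h | h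
    · subst h; simp_all
    · simp [h, haL']

lemma Reach.mono (hu : IsLocalCocycle r u) {x y : X} {g h : G} {L L' : ℝ}
    (h1 : Reach r u x g y h L) (hL : L ≤ L') : Reach r u x g y h L' := by
  have := h1.trans hu (Reach.refl hu y h (sub_nonneg.2 hL))
  simpa using this

/-- A curve of duration less than `r` has all its points within `r` of each other, so `g * u (c 0)
(c ·)` is a lift. -/
lemma Reach.of_dist_lt (hu : IsLocalCocycle r u) {c : ℝ → X}
    (hc : ∀ s t, dist (c s) (c t) ≤ |s - t|) (g : G) {δ : ℝ} (h0 : 0 ≤ δ) (hδ : δ < r) :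
    Reach r u (c 0) g (c δ) (g * u (c 0) (c δ)) δ := by
  -- Clamping the time to `[0, δ]` keeps the curve at rest outside, since a lift has to be defined
  -- on all of `ℝ`.
  let P : ℝ → ℝ := fun t ↦ max 0 (min t δ)
  have hP : ∀ s t, |P s - P t| ≤ |s - t| := by
    intro s t
    have h1 := abs_max_sub_max_le_abs (min s δ) (min t δ) 0
    have h2 := abs_min_sub_min_le_max s δ t δ
    simp only [sub_self, abs_zero, abs_nonneg, sup_of_le_left] at h2
    simp only [P]
    rw [max_comm 0, max_comm 0]
    exact h1.trans h2
  have hP2 : ∀ s t, |P s - P t| < r := by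
    intro s t
    have hs : 0 ≤ P s ∧ P s ≤ δ := ⟨le_max_left _ _, max_le h0 (min_le_right _ _)⟩
    have ht : 0 ≤ P t ∧ P t ≤ δ := ⟨le_max_left _ _, max_le h0 (min_le_right _ _)⟩
    rw [abs_lt]; constructor <;> linarith
  have hd : ∀ s t, dist (c (P s)) (c (P t)) < r := fun s t ↦ (hc _ _).trans_lt (hP2 s t)
  have hP0 : P 0 = 0 := by simp [P, h0]
  have hPδ : P δ = δ := by simp [P, h0]
  refine ⟨h0, fun t ↦ c (P t), fun t ↦ g * u (c 0) (c (P t)), ⟨fun s t ↦ (hc _ _).trans (hP s t),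
    fun s t _ ↦ ?_⟩, by simp [hP0], by simp [hP0, hu.self], by simp [hPδ], by simp [hPδ]⟩
  have h0 : ∀ t, dist (c 0) (c (P t)) < r := fun t ↦ by simpa [hP0] using hd 0 t
  rw [mul_assoc, hu.mul _ _ _ (h0 s) (hd s t) (h0 t)]

/-- An Arzelà–Ascoli theorem with pointwise limits along an ultrafilter. As `G` has no topology, `a
k t` is first transported to the fibre over the limit point `c' t`. The result is eventually
constant: this holds at time `0` and propagates in steps shorter than `r`. -/
lemma exists_limit_lift [CompactSpace X] (hu : IsLocalCocycle r u) {ι : Type*} (U : Ultrafilter ι)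
    {c : ι → ℝ → X} {a : ι → ℝ → G} (h : ∀ k, IsLift r u (c k) (a k)) {x : X} {g : G}
    (hx : ∀ k, c k 0 = x) (hg : ∀ k, a k 0 = g) :
    ∃ c' a', IsLift r u c' a' ∧ ∀ t, Tendsto (fun k ↦ c k t) U (𝓝 (c' t)) ∧
      ∀ᶠ k in (U : Filter ι), a k t * u (c k t) (c' t) = a' t := by
  have hr := hu.pos
  have hlim : ∀ t, ∃ y, Tendsto (fun k ↦ c k t) U (𝓝 y) ∧ (t = 0 → y = x) := by
    intro t
    by_cases ht : t = 0
    · exact ⟨x, by simp [ht, hx], fun _ ↦ rfl⟩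
    obtain ⟨y, -, hy⟩ := (isCompact_univ (X := X)).ultrafilter_le_nhds (U.map fun k ↦ c k t)
      (by simp)
    exact ⟨y, hy, fun h ↦ absurd h ht⟩
  choose c' hc' hc'0 using hlim
  have hlip : ∀ s t, dist (c' s) (c' t) ≤ |s - t| := fun s t ↦
    le_of_tendsto ((hc' s).dist (hc' t)) (Eventually.of_forall fun k ↦ (h k).lip s t)
  have hnear : ∀ t, ∀ ε > 0, ∀ᶠ k in (U : Filter ι), dist (c k t) (c' t) < ε := fun t ε hε ↦
    (tendsto_iff_dist_tendsto_zero.1 (hc' t)).eventually (gt_mem_nhds hε)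
  have hstep : ∀ s t : ℝ, |s - t| < r → ∀ᶠ k in (U : Filter ι),
      a k t * u (c k t) (c' t) = a k s * u (c k s) (c' s) * u (c' s) (c' t) := by
    intro s t hst
    -- The margin `r - |s - t|` keeps the diagonal from `c k s` to `c' t` shorter than `r`.
    filter_upwards [hnear s (r - |s - t|) (by linarith), hnear t r hr,
      hnear s r hr] with k hs ht hs'
    have h1 := (h k).lip s t
    have h2 := hlip s t
    have h3 := dist_triangle (c k s) (c' s) (c' t)
    rw [(h k).lift s t (by linarith), mul_assoc, mul_assoc, hu.mul, hu.mul] <;> linarith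
  have hfin : ∀ n : ℕ, ∀ t : ℝ, |t| ≤ n * (r / 2) → ∃ g', ∀ᶠ k in (U : Filter ι),
      a k t * u (c k t) (c' t) = g' := by
    intro n
    induction n with
    | zero =>
      intro t ht
      have : t = 0 := by simpa using ht
      subst this
      exact ⟨g, Eventually.of_forall fun k ↦ by simp [hg, hx, hc'0, hu.self]⟩
    | succ n ih =>
      intro t ht
      have hn : (0 : ℝ) < n + 1 := by positivity
      -- Scaling by `n / (n + 1)` moves `t` towards `0` by at most `r / 2`, whatever its sign, and
      -- into the range of the induction hypothesis.
      obtain ⟨g', hg'⟩ := ih (t * (n / (n + 1))) (by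
        rw [abs_mul, abs_of_nonneg (by positivity : (0 : ℝ) ≤ n / (n + 1))]
        push_cast at ht
        calc |t| * (n / (n + 1)) ≤ ((n + 1) * (r / 2)) * (n / (n + 1)) := by gcongr
          _ = n * (r / 2) := by field_simp)
      refine ⟨g' * u (c' (t * (n / (n + 1)))) (c' t), ?_⟩
      filter_upwards [hg', hstep (t * (n / (n + 1))) t (by
        have : t * (n / (n + 1)) - t = - (t / (n + 1)) := by field_simp; ring
        rw [this, abs_neg, abs_div, abs_of_pos hn, div_lt_iff₀ hn]
        push_cast at ht
        nlinarith)] with k h1 h2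
      rw [h2, h1]
  have hfin' : ∀ t : ℝ, ∃ g', ∀ᶠ k in (U : Filter ι), a k t * u (c k t) (c' t) = g' := by
    intro t
    obtain ⟨n, hn⟩ := exists_nat_ge (|t| / (r / 2))
    exact hfin n t (by rwa [div_le_iff₀ (by linarith)] at hn)
  choose a' ha' using hfin'
  refine ⟨c', a', ⟨hlip, fun s t hst ↦ ?_⟩, fun t ↦ ⟨hc' t, ha' t⟩⟩
  obtain ⟨k, h1, h2, h3⟩ := ((ha' s).and ((ha' t).and (hstep s t hst))).exists
  rw [← h2, h3, h1]

/-- The direct method: lifts whose durations tend to the infimum have a limit lift with the same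
ends. It plays the role of a minimising geodesic of the covering. -/
lemma exists_reach_sInf [CompactSpace X] (hu : IsLocalCocycle r u) {x y : X} {g h : G}
    {L₀ : ℝ} (hL₀ : Reach r u x g y h L₀) :
    ∃ L, Reach r u x g y h L ∧ ∀ L', Reach r u x g y h L' → L ≤ L' := by
  set S : Set ℝ := {L | Reach r u x g y h L} with hS
  have hbdd : BddBelow S := ⟨0, fun L hL ↦ hL.1⟩
  have hne : S.Nonempty := ⟨L₀, hL₀⟩
  refine ⟨sInf S, ?_, fun L' hL' ↦ csInf_le hbdd hL'⟩
  have h0 : 0 ≤ sInf S := le_csInf hne fun L hL ↦ hL.1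
  obtain ⟨L, -, hLt, hLS⟩ := exists_seq_tendsto_sInf hne hbdd
  choose hL0 c a hl hc0 ha0 hcL haL using hLS
  let U := hyperfilter ℕ
  have hU : (U : Filter ℕ) ≤ atTop := by
    rw [← Nat.cofinite_eq_atTop]; exact hyperfilter_le_cofinite
  have hLU := hLt.mono_left hU
  obtain ⟨c', a', hl', hlim⟩ := exists_limit_lift hu U hl hc0 ha0
  have hd : ∀ k, dist (c k (sInf S)) y ≤ |sInf S - L k| := fun k ↦ by
    rw [← hcL k]; exact (hl k).lip _ _
  have hLU0 : Tendsto (fun k ↦ |sInf S - L k|) U (𝓝 0) := by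
    simpa using (hLU.const_sub (sInf S)).abs
  have hcy : c' (sInf S) = y := by
    refine eq_of_dist_eq_zero ?_
    have := (hlim (sInf S)).1.dist (tendsto_const_nhds (x := y))
    exact le_antisymm (le_of_tendsto_of_tendsto' this hLU0 hd) dist_nonneg
  have hc0' : c' 0 = x := by
    have := (hlim 0).1
    simp only [hc0] at this
    refine eq_of_dist_eq_zero ?_
    have := this.dist (tendsto_const_nhds (x := x))
    exact (tendsto_nhds_unique this (by simp)) 
  refine ⟨h0, c', a', hl', hc0', ?_, hcy, ?_⟩
  · obtain ⟨k, hk⟩ := (hlim 0).2.exists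
    rw [← hk, hc0', hc0, ha0, hu.self, mul_one]
  · obtain ⟨k, hk, hk'⟩ := ((hlim (sInf S)).2.and (hLU0.eventually (gt_mem_nhds hu.pos))).exists
    have h1 := (hl k).lift (sInf S) (L k) hk'
    rw [hcL, haL] at h1
    rw [← hk, hcy, h1]

/-- Bounded sets of the covering are relatively compact and its fibres are discrete. Along a free
ultrafilter on infinitely many distinct endpoints, the limit lift would make the endpoints
eventually equal. -/
lemma finite_setOf_reach [CompactSpace X] (hu : IsLocalCocycle r u) (x y : X) (g : G)
    (L : ℝ) : {h | Reach r u x g y h L}.Finite := by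
  by_contra hinf
  let e := Set.Infinite.natEmbedding _ hinf
  have he := fun k ↦ (e k).2.2
  choose c a hl hc0 ha0 hcL haL using he
  obtain ⟨c', a', hl', hlim⟩ := exists_limit_lift hu (hyperfilter ℕ) hl hc0 ha0
  have h1 := (hlim L).2
  simp only [hcL, haL] at h1
  obtain ⟨k, hk⟩ := h1.exists
  have h2 : ∀ᶠ j in (hyperfilter ℕ : Filter ℕ), j = k := by
    filter_upwards [h1] with j hj
    exact e.injective (Subtype.ext (mul_right_cancel (hj.trans hk.symm)))
  have h3 : ({k} : Set ℕ) ∉ hyperfilter ℕ := (Set.finite_singleton k).notMem_hyperfilter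
  exact h3 h2

end Cocycle

end

/-! ### Holonomy along the trajectories of an equicontinuous flow -/

section

section Holonomy

/-- The product of the values of `u` along the first `n` steps of a chain of points. -/
def chainHolonomy {X G : Type*} [Group G] (u : X → X → G) (c : ℕ → X) : ℕ → G
  | 0 => 1
  | n + 1 => chainHolonomy u c n * u (c n) (c (n + 1))

lemma chainHolonomy_add {X G : Type*} [Group G] (u : X → X → G) (c : ℕ → X) (m n : ℕ) :
    chainHolonomy u c (m + n) =
    chainHolonomy u c m * chainHolonomy u (fun i ↦ c (m + i)) n := by
  induction n with
  | zero => simp [chainHolonomy]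
  | succ n ih => rw [← add_assoc, chainHolonomy, ih, mul_assoc]; rfl

variable {X G : Type*} [MetricSpace X] [Group G] {r : ℝ} {u : X → X → G}

lemma chainHolonomy_reverse (hu : IsLocalCocycle r u) (c : ℕ → X) (n : ℕ)
    (hc : ∀ i < n, dist (c i) (c (i + 1)) < r) :
    chainHolonomy u (fun i ↦ c (n - i)) n = (chainHolonomy u c n)⁻¹ := by
  have key : ∀ m ≤ n, chainHolonomy u c n * chainHolonomy u (fun i ↦ c (n - i)) m
      = chainHolonomy u c (n - m) := by
    intro m
    induction m with
    | zero => simp [chainHolonomy]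
    | succ m ih =>
      intro hm
      have h1 := ih (by omega)
      obtain ⟨k, hk⟩ : ∃ k, n - m = k + 1 := ⟨n - m - 1, by omega⟩
      have hk' : n - (m + 1) = k := by omega
      rw [chainHolonomy, ← mul_assoc, h1, hk', hk, chainHolonomy, mul_assoc,
        hu.symm (hc k (by omega)), mul_one]
  have := key n le_rfl
  simp only [Nat.sub_self] at this
  exact eq_inv_of_mul_eq_one_right this

/-- The strip between the two chains is cut into squares, and each square into two triangles by the
diagonal from `c n` to `c' (n + 1)`. The bounds `r / 2` make this diagonal shorter than `r`. -/
lemma chainHolonomy_close (hu : IsLocalCocycle r u) (c c' : ℕ → X) (n : ℕ)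
    (h : ∀ i ≤ n, dist (c i) (c' i) < r / 2) (hc : ∀ i < n, dist (c i) (c (i + 1)) < r / 2)
    (hc' : ∀ i < n, dist (c' i) (c' (i + 1)) < r / 2) :
    u (c 0) (c' 0) * chainHolonomy u c' n = chainHolonomy u c n * u (c n) (c' n) := by
  have hr := hu.pos
  induction n with
  | zero => simp [chainHolonomy]
  | succ n ih =>
    have h1 := h n (by omega)
    have h2 := h (n + 1) le_rfl
    have h3 := hc n (by omega)
    have h4 := hc' n (by omega)
    have h5 := dist_triangle (c n) (c' n) (c' (n + 1))
    rw [chainHolonomy, chainHolonomy, ← mul_assoc, ih (fun i hi ↦ h i (by omega))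
      (fun i hi ↦ hc i (by omega)) (fun i hi ↦ hc' i (by omega)), mul_assoc, mul_assoc,
      hu.mul, hu.mul] <;> linarith

lemma IsLift.eq_mul_chainHolonomy {c : ℝ → X} {a : ℝ → G} (hl : IsLift r u c a) (s h : ℝ)
    (h0 : 0 ≤ h) (hr : h < r) (n : ℕ) :
    a (s + n * h) = a s * chainHolonomy u (fun i ↦ c (s + i * h)) n := by
  induction n with
  | zero => simp [chainHolonomy]
  | succ n ih =>
    rw [chainHolonomy, ← mul_assoc, ← ih]
    refine hl.lift _ _ ?_
    push_cast
    rw [abs_sub_comm, show s + (n + 1) * h - (s + n * h) = h by ring, abs_of_nonneg h0]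
    exact hr

end Holonomy

section Flow

/-- Pigeonhole on the integer times: there are only finitely many maps from a finite `δ`-net `A` to
a finite `ε / 4`-net `B`. Two times with the same map move each point of `A` to nearly the same
place, hence by equicontinuity each point of `S`; their difference is the almost period. -/
lemma exists_almost_period {S : Type*} [PseudoMetricSpace S] [CompactSpace S] {Φ : ℝ → S → S}
    (h0 : ∀ v, Φ 0 v = v) (hadd : ∀ s t v, Φ (s + t) v = Φ s (Φ t v))
    (hΦ : ∀ ε > 0, ∃ δ > 0, ∀ x y, dist x y < δ → ∀ t, dist (Φ t x) (Φ t y) < ε)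
    {ε : ℝ} (hε : 0 < ε) : ∃ T : ℝ, 1 ≤ T ∧ ∀ v, dist (Φ T v) v < ε := by
  obtain ⟨δ, hδ, hδΦ⟩ := hΦ (ε / 4) (by positivity)
  obtain ⟨A, -, hAfin, hA⟩ := finite_cover_balls_of_compact (isCompact_univ (X := S)) hδ
  obtain ⟨B, -, hBfin, hB⟩ := finite_cover_balls_of_compact (isCompact_univ (X := S))
    (show 0 < ε / 4 by positivity)
  have hA' : ∀ v : S, ∃ x : A, dist v (x : S) < δ := fun v ↦ by
    simpa [Subtype.exists] using hA (Set.mem_univ v)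
  have hB' : ∀ v : S, ∃ x : B, dist v (x : S) < ε / 4 := fun v ↦ by
    simpa [Subtype.exists] using hB (Set.mem_univ v)
  choose α hα using hA'
  choose β hβ using hB'
  have := hAfin.to_subtype
  have := hBfin.to_subtype
  obtain ⟨i, j, hij, hF⟩ := Finite.exists_ne_map_eq_of_infinite
    (fun (n : ℕ) (x : A) ↦ β (Φ n x))
  wlog hlt : i < j generalizing i j
  · exact this j i hij.symm hF.symm (by omega)
  have hclose : ∀ v, dist (Φ j v) (Φ i v) < ε := by
    intro v
    have h1 := hδΦ _ _ (hα v) j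
    have h2 := hδΦ _ _ (hα v) i
    have h3 := hβ (Φ i (α v))
    have h4 := hβ (Φ j (α v))
    have h5 := congrFun hF (α v)
    rw [h5] at h3
    rw [dist_comm] at h2 h3
    have := dist_triangle4 (Φ j v) (Φ j (α v)) (β (Φ j (α v)) : S) (Φ i (α v))
    have := dist_triangle (Φ j v) (Φ i (α v)) (Φ i v)
    linarith
  refine ⟨j - i, ?_, fun v ↦ ?_⟩
  · have : (i : ℝ) + 1 ≤ j := by exact_mod_cast hlt
    linarith
  · have := hclose (Φ (-i) v)
    rwa [← hadd, ← hadd, ← sub_eq_add_neg, add_neg_cancel, h0] at this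

/-- The holonomy of an almost closed trajectory over twice an almost period is trivial. -/
lemma exists_trivial_holonomy {X G S : Type*} [MetricSpace X] [Group G] [PseudoMetricSpace S]
    [CompactSpace S] {r : ℝ} {u : X → X → G} (hu : IsLocalCocycle r u) {Φ : ℝ → S → S}
    (h0 : ∀ v, Φ 0 v = v) (hadd : ∀ s t v, Φ (s + t) v = Φ s (Φ t v))
    (hΦ : ∀ ε > 0, ∃ δ > 0, ∀ x y, dist x y < δ → ∀ t, dist (Φ t x) (Φ t y) < ε)
    {pr : S → X} (hπ : Continuous pr) (hlip : ∀ v s t, dist (pr (Φ s v)) (pr (Φ t v)) ≤ |s - t|)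
    {J : S → S} (hJ : Continuous J) (hJΦ : ∀ t v, Φ t (J (Φ t v)) = J v)
    (hJπ : ∀ v, pr (J v) = pr v)
    (hfib : ∀ v, ∃ C : Set S, IsPreconnected C ∧ v ∈ C ∧ J v ∈ C ∧ ∀ w ∈ C, pr w = pr v)
    {η : ℝ} (hη : 0 < η) :
    ∃ T h : ℝ, ∃ m : ℕ, 1 ≤ T ∧ T = m * h ∧ 0 < h ∧ h < r ∧ ∀ v,
      dist (pr v) (pr (Φ (2 * T) v)) < min η r ∧
      chainHolonomy u (fun i ↦ pr (Φ (i * h) v)) (2 * m) = u (pr v) (pr (Φ (2 * T) v)) := by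
  have hr := hu.pos
  -- The gap after one period is less than `r'`; after two periods it is less than `2 * r'`, which
  -- has to be at most `η` and `r`.
  set r' := min (η / 2) (r / 4) with hr'
  have hr'0 : 0 < r' := by positivity
  have hr'1 : r' ≤ η / 2 := min_le_left _ _
  have hr'2 : r' ≤ r / 4 := min_le_right _ _
  obtain ⟨ε, hε, hεπ⟩ := Metric.uniformContinuous_iff.1
    (CompactSpace.uniformContinuous_of_continuous hπ) r' hr'0
  obtain ⟨δ, hδ, hδΦ⟩ := hΦ ε hε
  obtain ⟨δ', hδ', hδJ⟩ := Metric.uniformContinuous_iff.1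
    (CompactSpace.uniformContinuous_of_continuous hJ) δ hδ
  obtain ⟨T, hT1, hT⟩ := exists_almost_period h0 hadd hΦ (lt_min hδ hδ')
  obtain ⟨m, hm⟩ := exists_nat_gt (T / r')
  have hm0 : (0 : ℝ) < m := lt_of_le_of_lt (by positivity) hm
  set h := T / m with hh
  have hmT : T = m * h := by rw [hh]; field_simp
  have hhpos : 0 < h := by positivity
  have hhr : h < r' := by rw [hh, div_lt_iff₀ hm0]; rwa [div_lt_iff₀ hr'0, mul_comm] at hm
  -- trajectories through nearby points stay close
  have hclose : ∀ v w, dist v w < δ → ∀ t, dist (pr (Φ t v)) (pr (Φ t w)) < r' := fun v w hvw t ↦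
    hεπ (hδΦ v w hvw t)
  have hTδ : ∀ v, dist v (Φ T v) < δ := fun v ↦ by
    rw [dist_comm]; exact (hT v).trans_le (min_le_left _ _)
  have hTδJ : ∀ v, dist (J v) (J (Φ T v)) < δ := fun v ↦ hδJ (by
    rw [dist_comm]; exact (hT v).trans_le (min_le_right _ _))
  have hTπ : ∀ v, dist (pr v) (pr (Φ T v)) < r' := fun v ↦ by
    simpa [h0] using hclose _ _ (hTδ v) 0
  let c : S → ℕ → X := fun v i ↦ pr (Φ (i * h) v)
  have hc0 : ∀ v, c v 0 = pr v := fun v ↦ by simp [c, h0]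
  have hcm : ∀ v, c v m = pr (Φ T v) := fun v ↦ by simp [c, hmT]
  have hcstep : ∀ v i, dist (c v i) (c v (i + 1)) < r / 2 := by
    intro v i
    refine (hlip v _ _).trans_lt ?_
    push_cast
    rw [abs_sub_comm, show ((i : ℝ) + 1) * h - i * h = h by ring, abs_of_pos hhpos]
    linarith
  have hcclose : ∀ v w, dist v w < δ → u (pr v) (pr w) * chainHolonomy u (c w) m =
      chainHolonomy u (c v) m * u (pr (Φ T v)) (pr (Φ T w)) := by
    intro v w hvw
    have := chainHolonomy_close hu (c v) (c w) m
      (fun i _ ↦ (hclose v w hvw _).trans_le (by linarith)) (fun i _ ↦ hcstep v i)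
      (fun i _ ↦ hcstep w i)
    rwa [hc0, hc0, hcm, hcm] at this
  -- The class of the arc of duration `T`, closed up by the jump back to its starting point.
  let A : S → G := fun v ↦ chainHolonomy u (c v) m * u (pr (Φ T v)) (pr v)
  have hAloc : ∀ v w, dist v w < δ → pr v = pr w → A v = A w := by
    intro v w hvw hπvw
    have h1 := hcclose v w hvw
    rw [hπvw, hu.self, one_mul] at h1
    have h2 := hclose v w hvw T
    have h3 := hTπ v
    have h4 := hTπ w
    rw [dist_comm] at h3 h4
    rw [← hπvw] at h4
    simp only [A]
    rw [h1, mul_assoc, ← hπvw, hu.mul] <;> linarith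
  -- Locally constant means continuous for the discrete topology on `G`, so `A` is constant on the
  -- connected set joining `v` to `J v` in the fibre.
  have hAJ : ∀ v, A (J v) = A v := by
    intro v
    obtain ⟨C, hC, hvC, hJC, hCπ⟩ := hfib v
    let _ : TopologicalSpace G := ⊥
    have : DiscreteTopology G := ⟨rfl⟩
    refine hC.constant (f := A) ?_ hJC hvC
    intro w hw
    refine tendsto_nhds_of_eventually_eq ?_ |>.congr' EventuallyEq.rfl
    filter_upwards [self_mem_nhdsWithin, mem_nhdsWithin_of_mem_nhds (Metric.ball_mem_nhds w hδ)]
      with w' hw' hball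
    exact hAloc w' w hball (by rw [hCπ w hw, hCπ w' hw'])
  refine ⟨T, h, m, hT1, hmT, hhpos, by linarith, fun v ↦ ?_⟩
  set x := pr v
  set y := pr (Φ T v)
  set z := pr (Φ (2 * T) v)
  set H := chainHolonomy u (c v) m
  have hz : pr (Φ T (Φ T v)) = z := by rw [← hadd, ← two_mul]
  have hxy : dist x y < r' := hTπ v
  have hyz : dist y z < r' := by rw [← hz]; exact hTπ _
  have hxz : dist x z < 2 * r' := (dist_triangle x y z).trans_lt (by linarith)
  have hk : u x y * u y x = 1 := hu.symm (by linarith)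
  -- the reversed trajectory
  have hrev : chainHolonomy u (c (J (Φ T v))) m = H⁻¹ := by
    rw [← chainHolonomy_reverse hu (c v) m fun i _ ↦ (hcstep v i).trans (by linarith)]
    have : ∀ i ≤ m, c (J (Φ T v)) i = c v (m - i) := by
      intro i hi
      simp only [c]
      have : Φ T v = Φ (i * h) (Φ ((m - i : ℕ) * h) v) := by
        rw [← hadd, Nat.cast_sub hi, hmT]; congr 1; ring
      rw [this, hJΦ, hJπ]
    have key : ∀ n ≤ m, chainHolonomy u (c (J (Φ T v))) n
        = chainHolonomy u (fun i ↦ c v (m - i)) n := by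
      intro n
      induction n with
      | zero => simp [chainHolonomy]
      | succ n ih =>
        intro hn
        rw [chainHolonomy, chainHolonomy, ih (by omega), this n (by omega), this (n + 1) hn]
    exact key m le_rfl
  -- The arc from `J v` is compared with the nearby arc from `J (Φ T v)`, which is the original arc
  -- run backwards. The right side becomes `A (J v)`.
  have h1 := hcclose (J v) (J (Φ T v)) (hTδJ v)
  rw [hJπ, hJπ, hrev, hJΦ, hJπ] at h1
  have h2 : A (J v) = A v := hAJ v
  simp only [A, hJπ] at h2
  -- Since `u y x` is inverse to `u x y`, this says that `A v = H * u y x` has square `1`.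
  have h3 : u x y * H⁻¹ = H * u y x := h1.trans h2
  have h4 := hcclose v (Φ T v) (hTδ v)
  rw [hz] at h4
  have hsum : chainHolonomy u (c v) (2 * m) = u x z := by
    have h5 : (fun i ↦ c v (m + i)) = c (Φ T v) := by
      funext i
      simp only [c]
      rw [← hadd, hmT]
      push_cast
      congr 2; ring
    rw [two_mul, chainHolonomy_add, h5]
    have hkk : u y x = (u x y)⁻¹ := eq_inv_of_mul_eq_one_right hk
    have h6 : chainHolonomy u (c (Φ T v)) m = (u x y)⁻¹ * (H * u y z) := by
      rw [eq_inv_mul_iff_mul_eq]; exact h4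
    have h7 : H * (u x y)⁻¹ * H = u x y := by
      rw [← hkk, ← h3]; group
    have h8 : H * ((u x y)⁻¹ * (H * u y z)) = (H * (u x y)⁻¹ * H) * u y z := by group
    rw [h6]
    change H * _ = _
    rw [h8, h7, hu.mul] <;> linarith
  refine ⟨hxz.trans_le ?_, hsum⟩
  refine le_min ?_ ?_ <;> linarith

/-- If locally isometric curves are trajectories of an equicontinuous reversible flow with connected
fibres, then only finitely many holonomies are reached from a given point. -/
theorem finite_of_equicontinuous_flow {X G S : Type*} [MetricSpace X] [CompactSpace X] [Group G]
    [PseudoMetricSpace S] [CompactSpace S] {r ρ : ℝ} {u : X → X → G} (hu : IsLocalCocycle r u)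
    (hρ : 0 < ρ)
    (hseg : ∀ x y : X, dist x y < ρ → ∀ δ > dist x y, ∃ c : ℝ → X,
      (∀ s t, dist (c s) (c t) ≤ |s - t|) ∧ c 0 = x ∧ c δ = y)
    (x₀ : X) (hsurj : ∀ g, ∃ L, Reach r u x₀ 1 x₀ g L)
    {Φ : ℝ → S → S}
    (h0 : ∀ v, Φ 0 v = v) (hadd : ∀ s t v, Φ (s + t) v = Φ s (Φ t v))
    (hΦ : ∀ ε > 0, ∃ δ > 0, ∀ x y, dist x y < δ → ∀ t, dist (Φ t x) (Φ t y) < ε)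
    {pr : S → X} (hπ : Continuous pr) (hlip : ∀ v s t, dist (pr (Φ s v)) (pr (Φ t v)) ≤ |s - t|)
    {J : S → S} (hJ : Continuous J) (hJΦ : ∀ t v, Φ t (J (Φ t v)) = J v)
    (hJπ : ∀ v, pr (J v) = pr v)
    (hfib : ∀ v, ∃ C : Set S, IsPreconnected C ∧ v ∈ C ∧ J v ∈ C ∧ ∀ w ∈ C, pr w = pr v)
    (hgeod : ∀ (c : ℝ → X) (L : ℝ) (σ : ℝ), 0 < L → 0 < σ →
      (∀ s ∈ Set.Icc 0 L, ∀ t ∈ Set.Icc 0 L, |s - t| < σ → dist (c s) (c t) = |s - t|) →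
      ∃ v, ∀ t ∈ Set.Ioo 0 L, c t = pr (Φ t v)) : Finite G := by
  have hr := hu.pos
  obtain ⟨T, h, m, hT1, hTm, hh0, hhr, hT⟩ :=
    exists_trivial_holonomy hu h0 hadd hΦ hπ hlip hJ hJΦ hJπ hfib (lt_min one_pos hρ)
  -- paths which are not locally minimising can be shortened
  have hreach : ∀ x y : X, ∀ g : G, dist x y < min ρ r → ∀ δ, dist x y < δ → δ < r →
      Reach r u x g y (g * u x y) δ := by
    intro x y g hxy δ hδ hδr
    obtain ⟨c, hc, hc0, hcδ⟩ := hseg x y (hxy.trans_le (min_le_left _ _)) δ hδ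
    have := Reach.of_dist_lt hu hc g (dist_nonneg.trans hδ.le) hδr
    rwa [hc0, hcδ] at this
  suffices hB : ∀ g, Reach r u x₀ 1 x₀ g (2 * T + 2) by
    have := finite_setOf_reach hu x₀ x₀ 1 (2 * T + 2)
    rw [← Set.finite_univ_iff]
    exact this.subset fun g _ ↦ hB g
  intro g
  obtain ⟨L₀, hL₀⟩ := hsurj g
  obtain ⟨L, ⟨hL0, c, a, hl, hc0, ha0, hcL, haL⟩, hmin⟩ := exists_reach_sInf hu hL₀
  -- Minimality passes to subarcs: a shorter lift between two points of the minimiser could be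
  -- spliced in.
  have hshort : ∀ s t δ, 0 ≤ s → s ≤ t → t ≤ L → Reach r u (c s) (a s) (c t) (a t) δ →
      t - s ≤ δ := by
    intro s t δ hs hst htL hR
    have h1 := hl.reach hs
    have h2 := hl.reach htL
    rw [hc0, ha0] at h1
    rw [hcL, haL] at h2
    have := hmin _ ((h1.trans hu hR).trans hu h2)
    linarith
  -- At distances below `r` the holonomy depends on the endpoints only, so a shorter curve in `X`
  -- would also shorten the lift.
  have hlocal : ∀ s t, 0 ≤ s → s ≤ t → t ≤ L → t - s < min ρ r → dist (c s) (c t) = t - s := by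
    intro s t hs hst htL hd
    have h1 := hl.lip s t
    rw [abs_sub_comm, abs_of_nonneg (by linarith)] at h1
    refine le_antisymm h1 (le_of_not_gt fun hlt ↦ ?_)
    obtain ⟨δ, hδ1, hδ2⟩ := exists_between hlt
    have h2 := hreach (c s) (c t) (a s) (h1.trans_lt hd) δ hδ1
      (hδ2.trans (hd.trans_le (min_le_right _ _)))
    rw [← hl.lift s t (by
      rw [abs_sub_comm, abs_of_nonneg (by linarith)]; exact hd.trans_le (min_le_right _ _))] at h2
    have := hshort s t δ hs hst htL h2
    linarith
  refine Reach.mono hu ⟨hL0, c, a, hl, hc0, ha0, hcL, haL⟩ (le_of_not_gt fun hlt ↦ ?_)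
  obtain ⟨v, hv⟩ := hgeod c L (min ρ r) (by linarith) (lt_min hρ hr) (by
    intro s hs t ht hst
    rcases le_total s t with h | h
    · rw [abs_sub_comm, abs_of_nonneg (by linarith)] at hst ⊢
      exact hlocal s t hs.1 h ht.2 hst
    · rw [abs_of_nonneg (by linarith)] at hst ⊢
      rw [dist_comm]
      exact hlocal t s ht.1 h hs.2 hst)
  -- The minimiser is known to be a trajectory on the open interval only. Starting at time `1` keeps
  -- the arc of duration `2 * T` inside it, as `L > 2 * T + 2`.
  set w := Φ 1 v
  have hcw : ∀ t ∈ Set.Icc 0 (2 * T), c (1 + t) = pr (Φ t w) := by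
    intro t ht
    rw [hv _ ⟨by linarith [ht.1], by linarith [ht.2]⟩, ← hadd, add_comm]
  obtain ⟨hd, hhol⟩ := hT w
  have h1 : c 1 = pr w := by simpa [h0] using hcw 0 ⟨le_rfl, by linarith⟩
  have h2 : c (1 + 2 * T) = pr (Φ (2 * T) w) := hcw _ ⟨by linarith, le_rfl⟩
  have h3 : a (1 + 2 * T) = a 1 * u (c 1) (c (1 + 2 * T)) := by
    have h4 := hl.eq_mul_chainHolonomy 1 h hh0.le hhr (2 * m)
    have h5 : ((2 * m : ℕ) : ℝ) * h = 2 * T := by push_cast; rw [hTm]; ring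
    rw [h5] at h4
    rw [h4, h1, h2, ← hhol]
    congr 1
    have key : ∀ n ≤ 2 * m, chainHolonomy u (fun i : ℕ ↦ c (1 + i * h)) n =
        chainHolonomy u (fun i : ℕ ↦ pr (Φ (i * h) w)) n := by
      have hi : ∀ i : ℕ, i ≤ 2 * m → c (1 + i * h) = pr (Φ (i * h) w) := by
        intro i hi
        refine hcw _ ⟨by positivity, ?_⟩
        rw [← h5]
        gcongr
      intro n
      induction n with
      | zero => simp [chainHolonomy]
      | succ n ih =>
        intro hn
        rw [chainHolonomy, chainHolonomy, ih (by omega), hi n (by omega), hi (n + 1) hn]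
    exact key _ le_rfl
  rw [← h1, ← h2] at hd
  obtain ⟨δ, hδ1, hδ2⟩ := exists_between hd
  -- By the trivial holonomy the short cut in `X` has the right lift, so an arc of duration `2 * T ≥
  -- 2` could be replaced by one of duration `δ < 1`.
  have h6 := hreach (c 1) (c (1 + 2 * T)) (a 1)
    (hd.trans_le (min_le_min_right _ (min_le_right _ _))) δ hδ1 (hδ2.trans_le (min_le_right _ _))
  rw [← h3] at h6
  have h7 := hshort 1 (1 + 2 * T) δ zero_le_one (by linarith) (by linarith) h6
  have h8 : δ < 1 := hδ2.trans_le ((min_le_left _ _).trans (min_le_left _ _))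
  linarith

end Flow

end

/-! ### Regularity from second differences, du Bois-Reymond, first variation -/

section

section Calculus

variable {E : Type*} [NormedAddCommGroup E] [NormedSpace ℝ E]

/-- A curve whose second differences with step `h` are of order `h^(3/2)` is continuously
differentiable. -/
lemma exists_hasDerivAt_of_second_difference [CompleteSpace E] {c : ℝ → E}
    (hc : Continuous c) {t₀ ρ C : ℝ}
    (hρ : 0 < ρ)
    (h2 : ∀ t h, |t - t₀| < 2 * ρ → 0 < h → h < ρ →
      ‖c (t + h) - (2 : ℝ) • c t + c (t - h)‖ ≤ C * (h * √h)) :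
    ∃ v : ℝ → E, ContinuousOn v (Metric.ball t₀ ρ) ∧
      ∀ t ∈ Metric.ball t₀ ρ, HasDerivAt c (v t) t := by
  let h : ℕ → ℝ := fun k ↦ ρ / 2 * (1 / 2) ^ k
  have hpos : ∀ k, 0 < h k := fun k ↦ by positivity
  have hle : ∀ k, h k ≤ ρ / 2 := fun k ↦
    mul_le_of_le_one_right (by positivity) (pow_le_one₀ (by norm_num) (by norm_num))
  have hsucc : ∀ k, h k = 2 * h (k + 1) := fun k ↦ by simp only [h, pow_succ]; ring
  have hlim : Tendsto h atTop (𝓝 0) := by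
    have := (tendsto_pow_atTop_nhds_zero_of_lt_one (by norm_num : (0 : ℝ) ≤ 1 / 2)
      (by norm_num)).const_mul (ρ / 2)
    rwa [mul_zero] at this
  -- Difference quotients at dyadic steps. Two successive ones differ by a second difference divided
  -- by `2 * η`, which is of order `√η`; this gives a geometric series of ratio `θ = √(1 / 2)`,
  -- uniformly in `t`.
  let q : ℕ → ℝ → E := fun k t ↦ (h k)⁻¹ • (c (t + h k) - c t)
  let θ : ℝ := √(1 / 2)
  have hθ : θ < 1 := by
    rw [Real.sqrt_lt' one_pos]; norm_num
  have hC : 0 ≤ C := by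
    have := (norm_nonneg _).trans (h2 t₀ (ρ / 2) (by simpa using hρ) (by positivity) (by linarith))
    exact nonneg_of_mul_nonneg_left this (by positivity)
  have hq : ∀ t ∈ Metric.ball t₀ ρ, ∀ k, dist (q k t) (q (k + 1) t) ≤ C * √ρ * θ ^ k := by
    intro t ht k
    have ht' : |t - t₀| < ρ := by simpa [Real.dist_eq] using ht
    set η := h (k + 1) with hη
    have hη0 : 0 < η := hpos _
    have hηρ : η ≤ ρ / 2 := hle _
    have e1 : q k t - q (k + 1) t = (2 * η)⁻¹ •
        (c (t + η + η) - (2 : ℝ) • c (t + η) + c (t + η - η)) := by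
      simp only [q, hsucc k]
      rw [← hη, show t + 2 * η = t + η + η by ring, show t + η - η = t by ring, mul_inv]
      have : η⁻¹ = 2⁻¹ * η⁻¹ * 2 := by ring
      module
    have h3 := h2 (t + η) η (by
      rw [abs_lt] at ht' ⊢; constructor <;> linarith) hη0 (by linarith)
    rw [dist_eq_norm, e1, norm_smul, norm_inv, Real.norm_of_nonneg (by positivity)]
    calc (2 * η)⁻¹ * ‖c (t + η + η) - (2 : ℝ) • c (t + η) + c (t + η - η)‖
        ≤ (2 * η)⁻¹ * (C * (η * √η)) := by gcongr
      _ = C * √η / 2 := by field_simp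
      _ ≤ C * √η := by
          have : 0 ≤ C * √η := by positivity
          linarith
      _ ≤ C * (√ρ * θ ^ k) := by
          gcongr
          have e2 : (√(1 / 2 : ℝ)) ^ k = √((1 / 2) ^ k) :=
            (Real.sqrt_eq_iff_mul_self_eq (by positivity) (by positivity)).2 (by
              rw [← mul_pow, Real.mul_self_sqrt (by norm_num)]) |>.symm
          rw [e2, ← Real.sqrt_mul hρ.le]
          refine Real.sqrt_le_sqrt ?_
          rw [hη]
          simp only [h, pow_succ]
          have : 0 < ρ * (1 / 2) ^ k := by positivity
          nlinarith
      _ = C * √ρ * θ ^ k := by ring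
  have hcau : ∀ t, ∃ v, t ∈ Metric.ball t₀ ρ → Tendsto (fun k ↦ q k t) atTop (𝓝 v) := by
    intro t
    by_cases ht : t ∈ Metric.ball t₀ ρ
    · obtain ⟨v, hv⟩ := cauchySeq_tendsto_of_complete (cauchySeq_of_le_geometric _ _ hθ (hq t ht))
      exact ⟨v, fun _ ↦ hv⟩
    · exact ⟨0, fun h ↦ absurd h ht⟩
  choose v hv using hcau
  have hunif : TendstoUniformlyOn q v atTop (Metric.ball t₀ ρ) := by
    rw [Metric.tendstoUniformlyOn_iff]
    intro ε hε
    have hgeo : Tendsto (fun k ↦ C * √ρ * θ ^ k / (1 - θ)) atTop (𝓝 0) := by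
      have := ((tendsto_pow_atTop_nhds_zero_of_lt_one (Real.sqrt_nonneg _) hθ).const_mul
        (C * √ρ)).div_const (1 - θ)
      rwa [mul_zero, zero_div] at this
    filter_upwards [hgeo.eventually (gt_mem_nhds hε)] with k hk t ht
    rw [dist_comm]
    exact (dist_le_of_le_geometric_of_tendsto _ _ hθ (hq t ht) (hv t ht) k).trans_lt hk
  have hqc : ∀ k, Continuous (q k) := fun k ↦ by fun_prop
  refine ⟨v, hunif.continuousOn (Frequently.of_forall fun k ↦ (hqc k).continuousOn), ?_⟩
  -- the means of `c` over intervals of length `h k` have derivative `q k`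
  let F : ℝ → E := fun t ↦ ∫ s in (0 : ℝ)..t, c s
  have hF : ∀ t, HasDerivAt F (c t) t := fun t ↦ (hc.integral_hasStrictDerivAt 0 t).hasDerivAt
  have hf : ∀ k t, HasDerivAt (fun t ↦ (h k)⁻¹ • (F (t + h k) - F t)) (q k t) t := fun k t ↦
    (((hF (t + h k)).comp_add_const t (h k)).sub (hF t)).const_smul _
  intro t ht
  refine hasDerivAt_of_tendstoUniformlyOn Metric.isOpen_ball hunif
    (Eventually.of_forall fun k t _ ↦ hf k t) (fun t _ ↦ ?_) ht
  have hslope := (hF t).tendsto_slope_zero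
  refine hslope.comp (tendsto_nhdsWithin_iff.2 ⟨hlim, Eventually.of_forall fun k ↦ ?_⟩)
  exact (hpos k).ne'

/-- The lemma of du Bois-Reymond. -/
lemma eq_add_integral_of_forall_integral_eq_zero {p q : ℝ → ℝ} {α β : ℝ} (hαβ : α < β)
    (hp : ContinuousOn p (Set.Icc α β)) (hq : ContinuousOn q (Set.Icc α β))
    (h : ∀ ψ ψ' : ℝ → ℝ, Continuous ψ' → (∀ t, HasDerivAt ψ (ψ' t) t) → ψ α = 0 → ψ β = 0 →
      ∫ t in α..β, (p t * ψ' t + q t * ψ t) = 0) :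
    ∀ t ∈ Set.Icc α β, p t = p α + ∫ s in α..t, q s := by
  wlog hpq : Continuous p ∧ Continuous q generalizing p q
  · let P := Set.IccExtend hαβ.le (fun t : Set.Icc α β ↦ p t)
    let Q := Set.IccExtend hαβ.le (fun t : Set.Icc α β ↦ q t)
    have hP : ∀ t ∈ Set.Icc α β, P t = p t := fun t ht ↦ by
      simp [P, Set.IccExtend_of_mem _ _ ht]
    have hQ : ∀ t ∈ Set.Icc α β, Q t = q t := fun t ht ↦ by
      simp [Q, Set.IccExtend_of_mem _ _ ht]
    have hPc : Continuous P := (continuousOn_iff_continuous_domRestrict.1 hp).Icc_extend'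
    have hQc : Continuous Q := (continuousOn_iff_continuous_domRestrict.1 hq).Icc_extend'
    have := this hPc.continuousOn hQc.continuousOn (fun ψ ψ' h1 h2 h3 h4 ↦ by
      rw [← h ψ ψ' h1 h2 h3 h4]
      refine intervalIntegral.integral_congr fun t ht ↦ ?_
      rw [Set.uIcc_of_le hαβ.le] at ht
      simp only [hP t ht, hQ t ht]) ⟨hPc, hQc⟩
    intro t ht
    rw [← hP t ht, ← hP α (by simp [hαβ.le]), this t ht]
    congr 1
    refine intervalIntegral.integral_congr fun s hs ↦ ?_
    rw [Set.uIcc_of_le ht.1] at hs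
    exact hQ s ⟨hs.1, hs.2.trans ht.2⟩
  obtain ⟨hp, hq⟩ := hpq
  let Q : ℝ → ℝ := fun t ↦ ∫ s in α..t, q s
  have hQ : ∀ t, HasDerivAt Q (q t) t := fun t ↦ (hq.integral_hasStrictDerivAt α t).hasDerivAt
  have hQc : Continuous Q := continuous_iff_continuousAt.2 fun t ↦ (hQ t).continuousAt
  let R : ℝ → ℝ := fun t ↦ p t - Q t
  have hR : Continuous R := hp.sub hQc
  -- Subtracting the mean makes the primitive `ψ` of `R - m` vanish at `β`, so it is an admissible
  -- test function.
  let m : ℝ := (∫ t in α..β, R t) / (β - α)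
  have hβα : β - α ≠ 0 := by linarith
  let ψ : ℝ → ℝ := fun t ↦ ∫ s in α..t, (R s - m)
  have hRm : Continuous fun s ↦ R s - m := hR.sub continuous_const
  have hψ : ∀ t, HasDerivAt ψ (R t - m) t := fun t ↦
    (hRm.integral_hasStrictDerivAt α t).hasDerivAt
  have hψc : Continuous ψ := continuous_iff_continuousAt.2 fun t ↦ (hψ t).continuousAt
  have hψα : ψ α = 0 := by simp [ψ]
  have hψβ : ψ β = 0 := by
    simp only [ψ]
    rw [intervalIntegral.integral_sub (hR.intervalIntegrable _ _) (by simp)]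
    simp only [intervalIntegral.integral_const, smul_eq_mul, m]
    field_simp
    ring
  have h1 := h ψ _ hRm hψ hψα hψβ
  have h2 : ∫ t in α..β, (q t * ψ t + Q t * (R t - m)) = 0 := by
    rw [intervalIntegral.integral_deriv_mul_eq_sub (fun t _ ↦ hQ t) (fun t _ ↦ hψ t)
      (hq.intervalIntegrable _ _) (hRm.intervalIntegrable _ _), hψα, hψβ]
    simp
  -- The hypothesis for `ψ`, minus the integration by parts of `Q * ψ`, minus the constant `m` times
  -- a vanishing integral.
  have h3 : ∫ t in α..β, (R t - m) * (R t - m) = 0 := by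
    have e : ∀ t, (R t - m) * (R t - m) = (p t * (R t - m) + q t * ψ t) -
        (q t * ψ t + Q t * (R t - m)) - m * (R t - m) := fun t ↦ by simp only [R]; ring
    simp only [e]
    rw [intervalIntegral.integral_sub, intervalIntegral.integral_sub, h1, h2,
      intervalIntegral.integral_const_mul]
    · have : ∫ t in α..β, (R t - m) = 0 := hψβ
      rw [this]; simp
    all_goals exact Continuous.intervalIntegrable (by fun_prop) _ _
  have h4 : ∀ t ∈ Set.Icc α β, R t - m = 0 := by
    by_contra! hne
    obtain ⟨t, ht, htne⟩ := hne
    have := intervalIntegral.integral_pos hαβ (f := fun t ↦ (R t - m) * (R t - m))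
      (by fun_prop) (fun t _ ↦ mul_self_nonneg _) ⟨t, ht, mul_self_pos.2 htne⟩
    linarith
  intro t ht
  have h5 := h4 t ht
  have h6 := h4 α (by simp [hαβ.le])
  simp only [R, Q, intervalIntegral.integral_same] at h5 h6
  linarith


/-- The first variation of the energy `∫ G_c(c', c')` in the direction `ψ w`. -/
lemma hasDerivAt_energy {G : E → E →L[ℝ] E →L[ℝ] ℝ} {O : Set E} (hO : IsOpen O)
    (hG : ContDiffOn ℝ 1 G O) {c c' : ℝ → E} (hc : Continuous c) (hc' : Continuous c') {α β : ℝ}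
    (hαβ : α ≤ β) (hcO : ∀ t ∈ Set.Icc α β, c t ∈ O) {ψ ψ' : ℝ → ℝ} (hψ : Continuous ψ)
    (hψ' : Continuous ψ') (w : E) :
    HasDerivAt (fun ε : ℝ ↦ ∫ t in α..β,
        G (c t + ε • ψ t • w) (c' t + ε • ψ' t • w) (c' t + ε • ψ' t • w))
      (∫ t in α..β, (fderiv ℝ G (c t) (ψ t • w) (c' t) (c' t) + G (c t) (ψ' t • w) (c' t) +
        G (c t) (c' t) (ψ' t • w))) 0 := by
  -- a neighbourhood of `0` in which the varied curve stays in `O`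
  have hcurve : Continuous fun z : ℝ × ℝ ↦ c z.2 + z.1 • ψ z.2 • w := by fun_prop
  obtain ⟨δ, hδ, hδO⟩ : ∃ δ > 0, ∀ ε ∈ Metric.closedBall (0 : ℝ) δ, ∀ t ∈ Set.Icc α β,
      c t + ε • ψ t • w ∈ O := by
    have hK : IsCompact (Set.Icc α β) := isCompact_Icc
    have h1 : ∀ᶠ ε in 𝓝 (0 : ℝ), ∀ t ∈ Set.Icc α β, c t + ε • ψ t • w ∈ O := by
      refine hK.eventually_forall_of_forall_eventually fun t ht ↦ ?_
      have := hcurve.continuousAt (x := ((0 : ℝ), t))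
      exact this (hO.mem_nhds (by simpa using hcO t ht))
    obtain ⟨δ, hδ, h2⟩ := Metric.eventually_nhds_iff_ball.1 h1
    exact ⟨δ / 2, by positivity, fun ε hε t ht ↦
      h2 ε (Metric.closedBall_subset_ball (by linarith) hε) t ht⟩
  let D : ℝ → ℝ → ℝ := fun ε t ↦
    fderiv ℝ G (c t + ε • ψ t • w) (ψ t • w) (c' t + ε • ψ' t • w) (c' t + ε • ψ' t • w) +
      G (c t + ε • ψ t • w) (ψ' t • w) (c' t + ε • ψ' t • w) +
      G (c t + ε • ψ t • w) (c' t + ε • ψ' t • w) (ψ' t • w)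
  set K : Set (ℝ × ℝ) := Metric.closedBall (0 : ℝ) δ ×ˢ Set.Icc α β with hKdef
  have hK : IsCompact K := (isCompact_closedBall _ _).prod isCompact_Icc
  have hmaps : Set.MapsTo (fun z : ℝ × ℝ ↦ c z.2 + z.1 • ψ z.2 • w) K O := fun z hz ↦
    hδO _ hz.1 _ hz.2
  have hGc : ContinuousOn (fun z : ℝ × ℝ ↦ G (c z.2 + z.1 • ψ z.2 • w)) K :=
    hG.continuousOn.comp hcurve.continuousOn hmaps
  have hdGc : ContinuousOn (fun z : ℝ × ℝ ↦ fderiv ℝ G (c z.2 + z.1 • ψ z.2 • w)) K :=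
    (hG.continuousOn_fderiv_of_isOpen hO le_rfl).comp hcurve.continuousOn hmaps
  have hDc : ContinuousOn (fun z : ℝ × ℝ ↦ D z.1 z.2) K := by
    have h1 : Continuous fun z : ℝ × ℝ ↦ c' z.2 + z.1 • ψ' z.2 • w := by fun_prop
    have h2 : Continuous fun z : ℝ × ℝ ↦ ψ z.2 • w := by fun_prop
    have h3 : Continuous fun z : ℝ × ℝ ↦ ψ' z.2 • w := by fun_prop
    have h4 : ContinuousOn (fun z : ℝ × ℝ ↦
        fderiv ℝ G (c z.2 + z.1 • ψ z.2 • w) (ψ z.2 • w)) K := hdGc.clm_apply h2.continuousOn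
    exact (((h4.clm_apply h1.continuousOn).clm_apply
      h1.continuousOn).add ((hGc.clm_apply h3.continuousOn).clm_apply h1.continuousOn)).add
      ((hGc.clm_apply h1.continuousOn).clm_apply h3.continuousOn)
  obtain ⟨B, hB⟩ := hK.exists_bound_of_continuousOn hDc
  have hball : Metric.ball (0 : ℝ) δ ∈ 𝓝 (0 : ℝ) := Metric.ball_mem_nhds _ hδ
  have hLc : ∀ ε ∈ Metric.ball (0 : ℝ) δ, ContinuousOn (fun t ↦
      G (c t + ε • ψ t • w) (c' t + ε • ψ' t • w) (c' t + ε • ψ' t • w)) (Set.Icc α β) := by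
    intro ε hε
    have h1 : ContinuousOn (fun t ↦ G (c t + ε • ψ t • w)) (Set.Icc α β) :=
      hGc.comp (f := fun t ↦ (ε, t)) (by fun_prop) fun t ht ↦ ⟨Metric.ball_subset_closedBall hε, ht⟩
    have h2 : Continuous fun t ↦ c' t + ε • ψ' t • w := by fun_prop
    exact (h1.clm_apply h2.continuousOn).clm_apply h2.continuousOn
  have hIoc : Set.uIoc α β = Set.Ioc α β := Set.uIoc_of_le hαβ
  have hD0c : ContinuousOn (D 0) (Set.Icc α β) :=
    hDc.comp (f := fun t ↦ ((0 : ℝ), t)) (by fun_prop) fun t ht ↦ ⟨by simp [hδ.le], ht⟩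
  have key := (intervalIntegral.hasDerivAt_integral_of_dominated_loc_of_deriv_le
    (μ := MeasureTheory.volume)
    (F := fun ε t ↦ G (c t + ε • ψ t • w) (c' t + ε • ψ' t • w) (c' t + ε • ψ' t • w))
    (F' := D) (x₀ := 0) (a := α) (b := β) (bound := fun _ ↦ B) hball ?_ ?_ ?_ ?_ ?_ ?_).2
  · simpa [D] using key
  · filter_upwards [hball] with ε hε
    rw [hIoc]
    exact ((hLc ε hε).mono Set.Ioc_subset_Icc_self).aestronglyMeasurable measurableSet_Ioc
  · refine ContinuousOn.intervalIntegrable ?_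
    rw [Set.uIcc_of_le hαβ]
    exact hLc 0 (Metric.mem_ball_self hδ)
  · rw [hIoc]
    exact (hD0c.mono Set.Ioc_subset_Icc_self).aestronglyMeasurable measurableSet_Ioc
  · refine Eventually.of_forall fun t ht ε hε ↦ ?_
    rw [hIoc] at ht
    exact hB (ε, t) ⟨Metric.ball_subset_closedBall hε, Set.Ioc_subset_Icc_self ht⟩
  · exact intervalIntegrable_const
  · refine Eventually.of_forall fun t ht ε hε ↦ ?_
    rw [hIoc] at ht
    have hmem := hδO ε (Metric.ball_subset_closedBall hε) t (Set.Ioc_subset_Icc_self ht)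
    have h1 : HasDerivAt (fun ε : ℝ ↦ c t + ε • ψ t • w) (ψ t • w) ε := by
      simpa using ((hasDerivAt_id ε).smul_const (ψ t • w)).const_add (c t)
    have h2 : HasDerivAt (fun ε : ℝ ↦ c' t + ε • ψ' t • w) (ψ' t • w) ε := by
      simpa using ((hasDerivAt_id ε).smul_const (ψ' t • w)).const_add (c' t)
    have h3 := ((hG.contDiffAt (hO.mem_nhds hmem)).differentiableAt
      one_ne_zero).hasFDerivAt.comp_hasDerivAt ε h1
    have h4 := (h3.clm_apply h2).clm_apply h2
    simpa [D] using h4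

end Calculus

end

/-! ### Metric tensors and the geodesic spray in coordinates -/

section

section MetricTensor

variable {E : Type*} [NormedAddCommGroup E] [NormedSpace ℝ E]

/-- A smooth Riemannian metric on an open subset of a vector space. -/
structure IsMetricTensor (G : E → E →L[ℝ] E →L[ℝ] ℝ) (O : Set E) : Prop where
  isOpen : IsOpen O
  contDiffOn : ContDiffOn ℝ ∞ G O
  symm : ∀ u ∈ O, ∀ a b, G u a b = G u b a
  pos : ∀ u ∈ O, ∀ a, a ≠ 0 → 0 < G u a a

/-- The Christoffel form `Γ_u(a, a; ·)` of a metric tensor. -/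
noncomputable def christoffelForm (G : E → E →L[ℝ] E →L[ℝ] ℝ) (u a : E) : E →L[ℝ] ℝ :=
  fderiv ℝ G u a a - (1 / 2 : ℝ) • ((fderiv ℝ G u).flip a).flip a

lemma christoffelForm_apply (G : E → E →L[ℝ] E →L[ℝ] ℝ) (u a w : E) :
    christoffelForm G u a w = fderiv ℝ G u a a w - 1 / 2 * fderiv ℝ G u w a a := by
  simp [christoffelForm]

/-- The geodesic spray: geodesics are the solutions of `c'' = spray G c c'`. -/
noncomputable def spray (G : E → E →L[ℝ] E →L[ℝ] ℝ) (u a : E) : E :=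
  -(G u).inverse (christoffelForm G u a)

lemma spray_neg (G : E → E →L[ℝ] E →L[ℝ] ℝ) (u a : E) : spray G u (-a) = spray G u a := by
  have : christoffelForm G u (-a) = christoffelForm G u a := by
    ext w; simp [christoffelForm_apply]
  rw [spray, this, spray]

variable {G : E → E →L[ℝ] E →L[ℝ] ℝ} {O : Set E}

namespace IsMetricTensor

lemma isInvertible [FiniteDimensional ℝ E] (hG : IsMetricTensor G O) {u : E} (hu : u ∈ O) :
    (G u).IsInvertible := by
  have hinj : Function.Injective (G u) := by
    rw [injective_iff_map_eq_zero]
    intro a ha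
    by_contra hne
    have := hG.pos u hu a hne
    simp [ha] at this
  have hfin : Module.finrank ℝ E = Module.finrank ℝ (E →L[ℝ] ℝ) := by
    rw [← (LinearMap.toContinuousLinearMap (𝕜 := ℝ) (E := E) (F' := ℝ)).finrank_eq]
    exact (Subspace.dual_finrank_eq (K := ℝ) (V := E)).symm
  let e := (LinearMap.linearEquivOfInjective (G u : E →ₗ[ℝ] E →L[ℝ] ℝ) hinj hfin)
  exact ⟨e.toContinuousLinearEquiv, by ext a b; rfl⟩

lemma eq_of_forall_apply_eq (hG : IsMetricTensor G O) {u : E} (hu : u ∈ O) {a b : E}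
    (h : ∀ w, G u a w = G u b w) : a = b := by
  by_contra hne
  have h1 := hG.pos u hu _ (sub_ne_zero.2 hne)
  have h2 := h (a - b)
  rw [map_sub (G u), sub_apply] at h1
  linarith

lemma apply_spray [FiniteDimensional ℝ E] (hG : IsMetricTensor G O) {u : E} (hu : u ∈ O) (a : E) :
    G u (spray G u a) = -christoffelForm G u a := by
  rw [spray, map_neg, (hG.isInvertible hu).self_apply_inverse]

lemma contDiffOn_spray [FiniteDimensional ℝ E] (hG : IsMetricTensor G O) :
    ContDiffOn ℝ ∞ (fun z : E × E ↦ spray G z.1 z.2) (O ×ˢ Set.univ) := by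
  have hO : IsOpen (O ×ˢ (Set.univ : Set E)) := hG.isOpen.prod isOpen_univ
  have hfst : ContDiffOn ℝ ∞ (Prod.fst : E × E → E) (O ×ˢ Set.univ) := contDiff_fst.contDiffOn
  have hsnd : ContDiffOn ℝ ∞ (Prod.snd : E × E → E) (O ×ˢ Set.univ) := contDiff_snd.contDiffOn
  have hmaps : Set.MapsTo (Prod.fst : E × E → E) (O ×ˢ Set.univ) O := fun z hz ↦ hz.1
  have hG1 : ContDiffOn ℝ ∞ (fun z : E × E ↦ G z.1) (O ×ˢ Set.univ) :=
    hG.contDiffOn.comp hfst hmaps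
  have hG2 : ContDiffOn ℝ ∞ (fun z : E × E ↦ fderiv ℝ G z.1) (O ×ˢ Set.univ) :=
    (hG.contDiffOn.fderiv_of_isOpen hG.isOpen (by simp)).comp hfst hmaps
  have hinv : ContDiffOn ℝ ∞ (fun z : E × E ↦ (G z.1).inverse) (O ×ˢ Set.univ) := by
    intro z hz
    exact ((hG.isInvertible hz.1).contDiffAt_map_inverse).comp_contDiffWithinAt z (hG1 z hz)
  have hΓ : ContDiffOn ℝ ∞ (fun z : E × E ↦ christoffelForm G z.1 z.2) (O ×ˢ Set.univ) := by
    rw [contDiffOn_clm_apply]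
    intro w
    simp only [christoffelForm_apply]
    have h1 := ((hG2.clm_apply hsnd).clm_apply hsnd).clm_apply (contDiffOn_const (c := w))
    have h2 := ((hG2.clm_apply (contDiffOn_const (c := w))).clm_apply hsnd).clm_apply hsnd
    exact h1.sub (contDiffOn_const.mul h2)
  exact (hinv.clm_apply hΓ).neg

/-- The speed of a solution of the geodesic equation is constant. -/
lemma hasDerivAt_apply_apply [FiniteDimensional ℝ E] (hG : IsMetricTensor G O) {c c' : ℝ → E}
    {t : ℝ} (ht : c t ∈ O)
    (hc : HasDerivAt c (c' t) t) (hc' : HasDerivAt c' (spray G (c t) (c' t)) t) :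
    HasDerivAt (fun s ↦ G (c s) (c' s) (c' s)) 0 t := by
  have h1 := ((hG.contDiffOn.contDiffAt (hG.isOpen.mem_nhds ht)).differentiableAt
    (by simp)).hasFDerivAt.comp_hasDerivAt t hc
  have h2 := (h1.clm_apply hc').clm_apply hc'
  convert! h2 using 1
  have h3 := congrArg (fun f ↦ f (c' t)) (hG.apply_spray ht (c' t))
  have h4 := hG.symm (c t) ht (c' t) (spray G (c t) (c' t))
  simp only [neg_apply, christoffelForm_apply] at h3
  simp only [Function.comp_apply, add_apply]
  linarith

/-- Solutions of the geodesic equation are mapped to such by isometric changes of coordinates. -/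
lemma hasDerivAt_fderiv_comp [FiniteDimensional ℝ E] (hG : IsMetricTensor G O)
    {G' : E → E →L[ℝ] E →L[ℝ] ℝ} {O' : Set E}
    (hG' : IsMetricTensor G' O') {ψ : E → E} (hψ : ContDiffOn ℝ ∞ ψ O') (hmaps : Set.MapsTo ψ O' O)
    (hpull : ∀ u ∈ O', ∀ a b, G' u a b = G (ψ u) (fderiv ℝ ψ u a) (fderiv ℝ ψ u b))
    {c c' : ℝ → E} {t : ℝ} (ht : c t ∈ O') (hsurj : Function.Surjective (fderiv ℝ ψ (c t)))
    (hc : HasDerivAt c (c' t) t) (hc' : HasDerivAt c' (spray G' (c t) (c' t)) t) :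
    HasDerivAt (fun s ↦ fderiv ℝ ψ (c s) (c' s))
      (spray G (ψ (c t)) (fderiv ℝ ψ (c t) (c' t))) t := by
  set u := c t
  set a := c' t
  have hψu : ContDiffAt ℝ ∞ ψ u := hψ.contDiffAt (hG'.isOpen.mem_nhds ht)
  have hψ1 : HasFDerivAt ψ (fderiv ℝ ψ u) u := (hψu.differentiableAt (by simp)).hasFDerivAt
  have hdψ : HasFDerivAt (fderiv ℝ ψ) (fderiv ℝ (fderiv ℝ ψ) u) u :=
    ((hψu.fderiv_right (m := 1) (by
      rw [one_add_one_eq_two]; exact ENat.LEInfty.out)).differentiableAt (by simp)).hasFDerivAt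
  have hsymm2 : ∀ v w, fderiv ℝ (fderiv ℝ ψ) u v w = fderiv ℝ (fderiv ℝ ψ) u w v :=
    fun v w ↦ (hψu.isSymmSndFDerivAt (by simpa using ENat.LEInfty.out)).eq v w
  have hGu : HasFDerivAt G (fderiv ℝ G (ψ u)) (ψ u) :=
    ((hG.contDiffOn.contDiffAt (hG.isOpen.mem_nhds (hmaps ht))).differentiableAt
      (by simp)).hasFDerivAt
  have hG'u : HasFDerivAt G' (fderiv ℝ G' u) u :=
    ((hG'.contDiffOn.contDiffAt (hG'.isOpen.mem_nhds ht)).differentiableAt (by simp)).hasFDerivAt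
  -- Differentiating the pull-back identity produces second derivatives of `ψ`. In the Christoffel
  -- form they combine, by symmetry, into the term `ψ''(a, a)` which also arises from
  -- differentiating `fderiv ℝ ψ (c s) (c' s)`.
  have hder : ∀ v b w, fderiv ℝ G' u v b w =
      fderiv ℝ G (ψ u) (fderiv ℝ ψ u v) (fderiv ℝ ψ u b) (fderiv ℝ ψ u w) +
      G (ψ u) (fderiv ℝ (fderiv ℝ ψ) u v b) (fderiv ℝ ψ u w) +
      G (ψ u) (fderiv ℝ ψ u b) (fderiv ℝ (fderiv ℝ ψ) u v w) := by
    intro v b w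
    have h1 : HasFDerivAt (fun z ↦ G' z b w)
        ((ContinuousLinearMap.apply ℝ ℝ w).comp
          ((ContinuousLinearMap.apply ℝ (E →L[ℝ] ℝ) b).comp (fderiv ℝ G' u))) u :=
      (ContinuousLinearMap.apply ℝ ℝ w).hasFDerivAt.comp u
        ((ContinuousLinearMap.apply ℝ (E →L[ℝ] ℝ) b).hasFDerivAt.comp u hG'u)
    have hb : HasFDerivAt (fun z ↦ fderiv ℝ ψ z b) _ u :=
      (ContinuousLinearMap.apply ℝ E b).hasFDerivAt.comp u hdψ
    have hw : HasFDerivAt (fun z ↦ fderiv ℝ ψ z w) _ u :=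
      (ContinuousLinearMap.apply ℝ E w).hasFDerivAt.comp u hdψ
    have h2 := ((hGu.comp u hψ1).clm_apply hb).clm_apply hw
    have h3 : (fun z ↦ G' z b w) =ᶠ[𝓝 u]
        fun z ↦ G (ψ z) (fderiv ℝ ψ z b) (fderiv ℝ ψ z w) := by
      filter_upwards [hG'.isOpen.mem_nhds ht] with z hz using hpull z hz b w
    have h4 := congrArg (fun f ↦ f v) ((h1.congr_of_eventuallyEq h3.symm).unique h2)
    simp at h4
    linarith
  have h1 := (hdψ.comp_hasDerivAt t hc).clm_apply hc'
  convert! h1 using 1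
  refine hG.eq_of_forall_apply_eq (hmaps ht) fun w' ↦ ?_
  obtain ⟨w, rfl⟩ := hsurj w'
  rw [hG.apply_spray (hmaps ht)]
  have h2 := congrArg (fun f ↦ f w) (hG'.apply_spray ht a)
  simp only [neg_apply, christoffelForm_apply] at h2 ⊢
  rw [hpull u ht, hder, hder, hsymm2 w a] at h2
  have h3 := hG.symm (ψ u) (hmaps ht) (fderiv ℝ (fderiv ℝ ψ) u a w) (fderiv ℝ ψ u a)
  simp only [Function.comp_apply, map_add, add_apply]
  linarith

end IsMetricTensor

end MetricTensor

end

/-! ### Energy minimisers, local existence and uniqueness of geodesics -/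

section

namespace IsMetricTensor

variable {E : Type*} [NormedAddCommGroup E] [NormedSpace ℝ E] [FiniteDimensional ℝ E]
  {G : E → E →L[ℝ] E →L[ℝ] ℝ} {O : Set E}

/-- Minimisers of the energy satisfy the geodesic equation. -/
lemma hasDerivAt_spray_of_minimizer (hG : IsMetricTensor G O) {c c' : ℝ → E} {α β : ℝ}
    (hαβ : α < β) (hc' : Continuous c') (hc : ∀ t, HasDerivAt c (c' t) t)
    (hcO : ∀ t ∈ Set.Icc α β, c t ∈ O)
    (hmin : ∀ ψ ψ' : ℝ → ℝ, Continuous ψ' → (∀ t, HasDerivAt ψ (ψ' t) t) → ψ α = 0 → ψ β = 0 →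
      ∀ w : E, ∀ᶠ ε : ℝ in 𝓝 0, ∫ t in α..β, G (c t) (c' t) (c' t) ≤
        ∫ t in α..β, G (c t + ε • ψ t • w) (c' t + ε • ψ' t • w) (c' t + ε • ψ' t • w)) :
    ∀ t ∈ Set.Ioo α β, HasDerivAt c' (spray G (c t) (c' t)) t := by
  have hcc : Continuous c := continuous_iff_continuousAt.2 fun t ↦ (hc t).continuousAt
  have hGc : ContinuousOn (fun t ↦ G (c t)) (Set.Icc α β) :=
    hG.contDiffOn.continuousOn.comp hcc.continuousOn hcO
  have hdGc : ContinuousOn (fun t ↦ fderiv ℝ G (c t)) (Set.Icc α β) :=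
    (hG.contDiffOn.continuousOn_fderiv_of_isOpen hG.isOpen (by simp)).comp hcc.continuousOn hcO
  let P : ℝ → E →L[ℝ] ℝ := fun t ↦ G (c t) (c' t)
  let Q : ℝ → E →L[ℝ] ℝ := fun t ↦ (1 / 2 : ℝ) • ((fderiv ℝ G (c t)).flip (c' t)).flip (c' t)
  have hP : ContinuousOn P (Set.Icc α β) := hGc.clm_apply hc'.continuousOn
  have hQ : ContinuousOn Q (Set.Icc α β) := by
    have h1 : ContinuousOn (fun t ↦ ((fderiv ℝ G (c t)).flip (c' t)).flip (c' t))
        (Set.Icc α β) := by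
      have h2 : ContinuousOn (fun t ↦ (fderiv ℝ G (c t)).flip) (Set.Icc α β) :=
        (ContinuousLinearMap.flipₗᵢ ℝ E E (E →L[ℝ] ℝ)).continuous.comp_continuousOn hdGc
      have h3 : ContinuousOn (fun t ↦ ((fderiv ℝ G (c t)).flip (c' t)).flip) (Set.Icc α β) :=
        (ContinuousLinearMap.flipₗᵢ ℝ E E ℝ).continuous.comp_continuousOn
          (h2.clm_apply hc'.continuousOn)
      exact h3.clm_apply hc'.continuousOn
    exact h1.const_smul (1 / 2 : ℝ)
  -- The Euler–Lagrange equation in integrated form, valid although `c'` is only continuous so far.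
  -- It is tested against one direction `w` at a time.
  have hPQ : ∀ t ∈ Set.Icc α β, P t = P α + ∫ s in α..t, Q s := by
    intro t ht
    ext w
    have hQt : IntervalIntegrable Q MeasureTheory.volume α t :=
      (hQ.mono
        (by rw [Set.uIcc_of_le ht.1]; exact Set.Icc_subset_Icc_right ht.2)).intervalIntegrable
    rw [add_apply, ContinuousLinearMap.intervalIntegral_apply hQt]
    refine eq_add_integral_of_forall_integral_eq_zero (p := fun t ↦ P t w) (q := fun t ↦ Q t w)
      hαβ (hP.clm_apply continuousOn_const) (hQ.clm_apply continuousOn_const) ?_ t ht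
    intro ψ ψ' hψ' hψ hψα hψβ
    have hψc : Continuous ψ := continuous_iff_continuousAt.2 fun t ↦ (hψ t).continuousAt
    have h1 := hasDerivAt_energy hG.isOpen (hG.contDiffOn.of_le (by simp)) hcc hc' hαβ.le hcO
      hψc hψ' w
    have h2 : IsLocalMin (fun ε : ℝ ↦ ∫ t in α..β,
        G (c t + ε • ψ t • w) (c' t + ε • ψ' t • w) (c' t + ε • ψ' t • w)) 0 := by
      filter_upwards [hmin ψ ψ' hψ' hψ hψα hψβ w] with ε hε
      simpa using hε
    have h3 := h2.hasDerivAt_eq_zero h1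
    have h4 : ∫ t in α..β, 2 * (P t w * ψ' t + Q t w * ψ t) = 0 := by
      rw [← h3]
      refine intervalIntegral.integral_congr fun t ht ↦ ?_
      rw [Set.uIcc_of_le hαβ.le] at ht
      have := hG.symm (c t) (hcO t ht) w (c' t)
      simp only [P, Q, map_smul, smul_apply, ContinuousLinearMap.flip_apply,
        smul_eq_mul]
      rw [this]
      ring
    rw [intervalIntegral.integral_const_mul] at h4
    linarith
  intro t ht
  have htO := hcO t (Set.Ioo_subset_Icc_self ht)
  have hnhds : Set.Icc α β ∈ 𝓝 t := Icc_mem_nhds ht.1 ht.2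
  have hP' : HasDerivAt P (Q t) t := by
    have h1 : HasDerivAt (fun t ↦ ∫ s in α..t, Q s) (Q t) t := by
      refine intervalIntegral.integral_hasDerivAt_right ?_ ?_ (hQ.continuousAt hnhds)
      · refine (hQ.mono ?_).intervalIntegrable
        rw [Set.uIcc_of_le ht.1.le]
        exact Set.Icc_subset_Icc_right ht.2.le
      · exact (hQ.mono Set.Ioo_subset_Icc_self).stronglyMeasurableAtFilter isOpen_Ioo t ht
    refine (h1.const_add (P α)).congr_of_eventuallyEq ?_
    filter_upwards [hnhds] with s hs using hPQ s hs
  have hGt : HasDerivAt (fun s ↦ G (c s)) (fderiv ℝ G (c t) (c' t)) t :=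
    ((hG.contDiffOn.contDiffAt (hG.isOpen.mem_nhds htO)).differentiableAt
      (by simp)).hasFDerivAt.comp_hasDerivAt t (hc t)
  -- Regularity is gained by inverting the Legendre transformation: `c' = (G c)⁻¹ P`, and both
  -- factors are differentiable.
  obtain ⟨d, hd⟩ : ∃ d, HasDerivAt c' d t := by
    have h1 : DifferentiableAt ℝ (fun s ↦ (G (c s)).inverse) t :=
      DifferentiableAt.comp t (g := ContinuousLinearMap.inverse)
        (((hG.isInvertible htO).contDiffAt_map_inverse (n := 1)).differentiableAt one_ne_zero)
        hGt.differentiableAt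
    have h2 := h1.hasDerivAt.clm_apply hP'
    refine ⟨_, h2.congr_of_eventuallyEq ?_⟩
    filter_upwards [hnhds] with s hs
    exact ((hG.isInvertible (hcO s hs)).inverse_apply_self _).symm
  convert hd using 1
  refine hG.eq_of_forall_apply_eq htO fun w ↦ ?_
  rw [hG.apply_spray htO]
  have h1 := congrArg (fun f ↦ f w) ((hGt.clm_apply hd).unique hP')
  simp only [add_apply, Q, smul_apply, ContinuousLinearMap.flip_apply, smul_eq_mul] at h1
  rw [neg_apply, christoffelForm_apply]
  linarith

/-- The geodesic equation has local solutions, on a time interval which is locally uniform in the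
initial conditions. -/
lemma exists_local_solution (hG : IsMetricTensor G O) {u₀ : E} (hu₀ : u₀ ∈ O) (a₀ : E) :
    ∃ ε > 0, ∀ᶠ z in 𝓝 (u₀, a₀), ∃ c c' : ℝ → E, c 0 = z.1 ∧ c' 0 = z.2 ∧
      ∀ t ∈ Set.Ioo (-ε) ε, c t ∈ O ∧ HasDerivAt c (c' t) t ∧
        HasDerivAt c' (spray G (c t) (c' t)) t := by
  let f : E × E → E × E := fun z ↦ (z.2, spray G z.1 z.2)
  have hf : ContDiffAt ℝ 1 f (u₀, a₀) :=
    contDiffAt_snd.prodMk (((hG.contDiffOn_spray).contDiffAt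
      ((hG.isOpen.prod isOpen_univ).mem_nhds ⟨hu₀, trivial⟩)).of_le (by simp))
  obtain ⟨ε₀, hε₀, _, r, _, _, hr, hpl⟩ := IsPicardLindelof.of_contDiffAt_one hf
  obtain ⟨α, hα, hcont⟩ :=
    (hpl 0).exists_forall_mem_closedBall_eq_hasDerivWithinAt_continuousOn
  have hnhds : Metric.closedBall (u₀, a₀) (r : ℝ) ×ˢ Set.Icc (0 - ε₀) (0 + ε₀) ∈
      𝓝 ((u₀, a₀), (0 : ℝ)) :=
    prod_mem_nhds (Metric.closedBall_mem_nhds _ (by exact_mod_cast hr))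
      (Icc_mem_nhds (by linarith) (by linarith))
  have h0 : α ((u₀, a₀), 0) = (u₀, a₀) := (hα _ (Metric.mem_closedBall_self r.2)).1
  have hO : ∀ᶠ z in 𝓝 ((u₀, a₀), (0 : ℝ)), (α z).1 ∈ O := by
    have h1 := (hcont.continuousAt hnhds).fst
    exact h1 (hG.isOpen.mem_nhds (by simpa [h0] using hu₀))
  rw [nhds_prod_eq] at hO
  obtain ⟨p, hp, q, hq, hpq⟩ := eventually_prod_iff.1 hO
  obtain ⟨ε₁, hε₁, hε₁q⟩ := Metric.eventually_nhds_iff_ball.1 hq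
  refine ⟨min ε₀ ε₁, lt_min hε₀ hε₁, ?_⟩
  filter_upwards [hp, Metric.closedBall_mem_nhds (u₀, a₀) (show (0 : ℝ) < r by exact_mod_cast hr)]
    with z hz hzr
  obtain ⟨hz0, hzd⟩ := hα z hzr
  refine ⟨fun t ↦ (α (z, t)).1, fun t ↦ (α (z, t)).2, congrArg Prod.fst hz0,
    congrArg Prod.snd hz0, fun t ht ↦ ?_⟩
  have ht0 : -ε₀ < t ∧ t < ε₀ := ⟨(neg_le_neg (min_le_left _ _)).trans_lt ht.1,
    ht.2.trans_le (min_le_left _ _)⟩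
  have ht1 : -ε₁ < t ∧ t < ε₁ := ⟨(neg_le_neg (min_le_right _ _)).trans_lt ht.1,
    ht.2.trans_le (min_le_right _ _)⟩
  have h2 : HasDerivAt (fun t ↦ α (z, t)) (f (α (z, t))) t :=
    (hzd t ⟨by linarith [ht0.1], by linarith [ht0.2]⟩).hasDerivAt
      (Icc_mem_nhds (by linarith [ht0.1]) (by linarith [ht0.2]))
  refine ⟨hpq hz (hε₁q t (by rw [Real.ball_eq_Ioo]; simpa using ht1)), ?_, ?_⟩
  · exact h2.fst
  · exact h2.snd

lemma eventuallyEq_of_solution (hG : IsMetricTensor G O) {c₁ c₁' c₂ c₂' : ℝ → E} {t₀ : ℝ}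
    (hO : c₁ t₀ ∈ O)
    (h₁ : ∀ᶠ t in 𝓝 t₀, HasDerivAt c₁ (c₁' t) t ∧ HasDerivAt c₁' (spray G (c₁ t) (c₁' t)) t)
    (h₂ : ∀ᶠ t in 𝓝 t₀, HasDerivAt c₂ (c₂' t) t ∧ HasDerivAt c₂' (spray G (c₂ t) (c₂' t)) t)
    (h : c₁ t₀ = c₂ t₀) (h' : c₁' t₀ = c₂' t₀) :
    c₁ =ᶠ[𝓝 t₀] c₂ := by
  let f : E × E → E × E := fun z ↦ (z.2, spray G z.1 z.2)
  have hf : ContDiffAt ℝ 1 f (c₁ t₀, c₁' t₀) :=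
    contDiffAt_snd.prodMk (((hG.contDiffOn_spray).contDiffAt
      ((hG.isOpen.prod isOpen_univ).mem_nhds ⟨hO, trivial⟩)).of_le (by simp))
  obtain ⟨K, s, hs, hlip⟩ := hf.exists_lipschitzOnWith
  have aux : ∀ {c c' : ℝ → E}, (∀ᶠ t in 𝓝 t₀, HasDerivAt c (c' t) t ∧
      HasDerivAt c' (spray G (c t) (c' t)) t) → c t₀ = c₁ t₀ → c' t₀ = c₁' t₀ →
      ∀ᶠ t in 𝓝 t₀, HasDerivAt (fun t ↦ (c t, c' t)) (f (c t, c' t)) t ∧ (c t, c' t) ∈ s := by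
    intro c c' hc h0 h1
    have h2 := hc.self_of_nhds
    have hcont : ContinuousAt (fun t ↦ (c t, c' t)) t₀ := h2.1.continuousAt.prodMk h2.2.continuousAt
    have h3 := hcont.preimage_mem_nhds (t := s) (by rw [h0, h1]; exact hs)
    filter_upwards [hc, h3] with t ht hts
    exact ⟨ht.1.prodMk ht.2, hts⟩
  have := ODE_solution_unique_of_eventually (v := fun _ ↦ f) (s := fun _ ↦ s)
    (Eventually.of_forall fun _ ↦ hlip) (aux h₁ rfl rfl) (aux h₂ h.symm h'.symm) (by simp [h, h'])
  filter_upwards [this] with t ht using congrArg Prod.fst ht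

end IsMetricTensor

end

/-! ### The Riemannian metric in the charts of the manifold -/

section

section Charts

variable {n : ℕ} {M : Type*} [TopologicalSpace M] [ChartedSpace (EuclideanSpace ℝ (Fin n)) M]

/-- The derivative of the inverse of the chart at `x`. -/
noncomputable def chartSymmDeriv (x : M) (u : EuclideanSpace ℝ (Fin n)) :
    EuclideanSpace ℝ (Fin n) →L[ℝ] EuclideanSpace ℝ (Fin n) :=
  mfderiv 𝓘(ℝ, EuclideanSpace ℝ (Fin n)) (𝓡 n) (extChartAt (𝓡 n) x).symm u

variable [IsManifold (𝓡 n) ∞ M]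

lemma mdifferentiableAt_chart_symm (x : M) {u : EuclideanSpace ℝ (Fin n)}
    (hu : u ∈ (extChartAt (𝓡 n) x).target) :
    MDifferentiableAt 𝓘(ℝ, EuclideanSpace ℝ (Fin n)) (𝓡 n) (extChartAt (𝓡 n) x).symm u :=
  ((contMDiffOn_extChartAt_symm (I := 𝓡 n) (n := ∞) x).contMDiffAt
    ((isOpen_extChartAt_target x).mem_nhds hu)).mdifferentiableAt (by simp)

lemma mdifferentiableAt_chart (x : M) {p : M} (hp : p ∈ (extChartAt (𝓡 n) x).source) :
    MDifferentiableAt (𝓡 n) 𝓘(ℝ, EuclideanSpace ℝ (Fin n)) (extChartAt (𝓡 n) x) p :=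
  (contMDiffAt_extChartAt' (n := ∞) (by rwa [extChartAt_source] at hp)).mdifferentiableAt (by simp)

lemma chartSymmDeriv_injective (x : M) {u : EuclideanSpace ℝ (Fin n)}
    (hu : u ∈ (extChartAt (𝓡 n) x).target) : Function.Injective (chartSymmDeriv x u) := by
  have : IsManifold (𝓡 n) 1 M := IsManifold.of_le (n := ∞) (by simp)
  have h := isInvertible_mfderivWithin_extChartAt_symm (I := 𝓡 n) hu
  rw [ModelWithCorners.range_eq_univ, mfderivWithin_univ] at h
  exact h.injective

lemma contMDiffOn_chartSymmDeriv (x : M) (a : EuclideanSpace ℝ (Fin n)) :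
    ContMDiffOn 𝓘(ℝ, EuclideanSpace ℝ (Fin n)) (𝓡 n).tangent ∞
      (fun u ↦ (⟨(extChartAt (𝓡 n) x).symm u, chartSymmDeriv x u a⟩ : TangentBundle (𝓡 n) M))
      (extChartAt (𝓡 n) x).target := by
  have h1 := (contMDiffOn_extChartAt_symm (I := 𝓡 n) (n := ∞) x).contMDiffOn_tangentMapWithin
    (m := ∞) (by simp) (isOpen_extChartAt_target x).uniqueMDiffOn
  have h2 : ContMDiffOn 𝓘(ℝ, EuclideanSpace ℝ (Fin n)) 𝓘(ℝ, EuclideanSpace ℝ (Fin n)).tangent ∞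
      (fun u ↦ (⟨u, a⟩ : TangentBundle 𝓘(ℝ, EuclideanSpace ℝ (Fin n))
        (EuclideanSpace ℝ (Fin n)))) (extChartAt (𝓡 n) x).target := by
    exact contMDiffOn_vectorSpace_iff_contDiffOn.2 contDiffOn_const
  refine (h1.comp h2 fun u hu ↦ hu).congr fun u hu ↦ ?_
  simp only [Function.comp_apply, tangentMapWithin]
  rw [mfderivWithin_of_isOpen (isOpen_extChartAt_target x) hu]
  rfl

end Charts

variable {n : ℕ} {M : Type*} [TopologicalSpace M] [ChartedSpace (EuclideanSpace ℝ (Fin n)) M]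
  [Bundle.RiemannianBundle (fun x : M ↦ TangentSpace (𝓡 n) x)]

/-- The Riemannian metric at the point `p`, as a function of vectors of the model space. -/
noncomputable def metricAt (p : M) (v w : EuclideanSpace ℝ (Fin n)) : ℝ :=
  inner ℝ (show TangentSpace (𝓡 n) p from v) (show TangentSpace (𝓡 n) p from w)

lemma metricAt_comm (p : M) (v w : EuclideanSpace ℝ (Fin n)) : metricAt p v w = metricAt p w v :=
  real_inner_comm (F := TangentSpace (𝓡 n) p) _ _

lemma metricAt_self_pos (p : M) {v : EuclideanSpace ℝ (Fin n)} (hv : v ≠ 0) :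
    0 < metricAt p v v :=
  real_inner_self_pos (F := TangentSpace (𝓡 n) p).2 hv

/-- The Riemannian metric in the chart at `x`, as a bilinear form. -/
noncomputable def metricTensor (x : M) (u : EuclideanSpace ℝ (Fin n)) :
    EuclideanSpace ℝ (Fin n) →L[ℝ] EuclideanSpace ℝ (Fin n) →L[ℝ] ℝ :=
  ((innerSL ℝ (E := TangentSpace (𝓡 n) ((extChartAt (𝓡 n) x).symm u))).bilinearComp
    (mfderiv 𝓘(ℝ, EuclideanSpace ℝ (Fin n)) (𝓡 n) (extChartAt (𝓡 n) x).symm u)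
    (mfderiv 𝓘(ℝ, EuclideanSpace ℝ (Fin n)) (𝓡 n) (extChartAt (𝓡 n) x).symm u) :)

lemma metricTensor_apply (x : M) (u a b : EuclideanSpace ℝ (Fin n)) :
    metricTensor x u a b = chartMetric x u a b := rfl

lemma metricTensor_eq_metricAt (x : M) (u a b : EuclideanSpace ℝ (Fin n)) :
    metricTensor x u a b =
      metricAt ((extChartAt (𝓡 n) x).symm u) (chartSymmDeriv x u a) (chartSymmDeriv x u b) := rfl

variable [IsManifold (𝓡 n) ∞ M]
  [IsContMDiffRiemannianBundle (𝓡 n) ∞ (EuclideanSpace ℝ (Fin n))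
      (fun x : M ↦ TangentSpace (𝓡 n) x)]

lemma isMetricTensor (x : M) : IsMetricTensor (metricTensor x) (extChartAt (𝓡 n) x).target where
  isOpen := isOpen_extChartAt_target x
  contDiffOn := by
    rw [contDiffOn_clm_apply]
    intro a
    rw [contDiffOn_clm_apply]
    intro b
    rw [← contMDiffOn_iff_contDiffOn]
    exact ContMDiffOn.inner_bundle (contMDiffOn_chartSymmDeriv x a) (contMDiffOn_chartSymmDeriv x b)
  symm u hu a b := metricAt_comm _ _ _
  pos u hu a ha := by
    refine metricAt_self_pos _ fun h ↦ ha (chartSymmDeriv_injective x hu ?_)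
    exact Eq.trans h (map_zero (chartSymmDeriv x u)).symm

end

/-! ### The geodesic equation near a time, and its invariance under changes of charts -/

section

lemma IsMetricTensor.mono {E : Type*} [NormedAddCommGroup E] [NormedSpace ℝ E]
    {G : E → E →L[ℝ] E →L[ℝ] ℝ} {O O' : Set E} (h : IsMetricTensor G O) (hO : IsOpen O')
    (hsub : O' ⊆ O) : IsMetricTensor G O' :=
  ⟨hO, h.contDiffOn.mono hsub, fun u hu ↦ h.symm u (hsub hu), fun u hu ↦ h.pos u (hsub hu)⟩

section Charts

variable {n : ℕ} {M : Type*} [TopologicalSpace M] [ChartedSpace (EuclideanSpace ℝ (Fin n)) M]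

/-- The change of coordinates from the chart at `x` to the chart at `y`. -/
noncomputable def chartChange (x y : M) (u : EuclideanSpace ℝ (Fin n)) :
    EuclideanSpace ℝ (Fin n) :=
  extChartAt (𝓡 n) y ((extChartAt (𝓡 n) x).symm u)

variable (n) in
/-- The domain of the change of coordinates from the chart at `x` to the chart at `y`. -/
def chartChangeSource (x y : M) : Set (EuclideanSpace ℝ (Fin n)) :=
  (extChartAt (𝓡 n) x).target ∩ (extChartAt (𝓡 n) x).symm ⁻¹' (extChartAt (𝓡 n) y).source

lemma isOpen_chartChangeSource (x y : M) : IsOpen (chartChangeSource n x y) :=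
  (continuousOn_extChartAt_symm x).isOpen_inter_preimage (isOpen_extChartAt_target x)
    (isOpen_extChartAt_source y)

variable [IsManifold (𝓡 n) ∞ M]

lemma contDiffOn_chartChange (x y : M) :
    ContDiffOn ℝ ∞ (chartChange x y) (chartChangeSource n x y) := by
  rw [← contMDiffOn_iff_contDiffOn]
  exact (contMDiffOn_extChartAt (n := ∞) (x := y)).comp
    ((contMDiffOn_extChartAt_symm x).mono Set.inter_subset_left)
    (fun u hu ↦ by simpa using hu.2)

lemma chartSymmDeriv_chartChange (x y : M) {u : EuclideanSpace ℝ (Fin n)}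
    (hu : u ∈ chartChangeSource n x y) (a : EuclideanSpace ℝ (Fin n)) :
    chartSymmDeriv x u a =
      chartSymmDeriv y (chartChange x y u) (fderiv ℝ (chartChange x y) u a) := by
  have h1 : MDifferentiableAt 𝓘(ℝ, EuclideanSpace ℝ (Fin n)) 𝓘(ℝ, EuclideanSpace ℝ (Fin n))
      (chartChange x y) u :=
    (((contDiffOn_chartChange x y).contDiffAt ((isOpen_chartChangeSource x y).mem_nhds
      hu)).differentiableAt (by simp)).mdifferentiableAt
  have h2 := mdifferentiableAt_chart_symm y ((extChartAt (𝓡 n) y).map_source hu.2)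
  have h3 := mfderiv_comp u h2 h1
  have h4 : (extChartAt (𝓡 n) x).symm =ᶠ[𝓝 u] (extChartAt (𝓡 n) y).symm ∘ chartChange x y := by
    filter_upwards [(isOpen_chartChangeSource x y).mem_nhds hu] with z hz
    exact ((extChartAt (𝓡 n) y).left_inv hz.2).symm
  rw [mfderiv_eq_fderiv] at h3
  have h5 : chartSymmDeriv x u =
      (chartSymmDeriv y (chartChange x y u)).comp (fderiv ℝ (chartChange x y) u) := by
    refine Eq.trans ?_ h3
    exact h4.mfderiv_eq
  rw [h5]; rfl

/-- In the trivialization of the tangent bundle at `x`, the velocity of a curve is the derivative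
of its coordinate expression. -/
lemma trivializationAt_velocity (x : M) {γ : ℝ → M} {t : ℝ}
    (hγ : MDifferentiableAt 𝓘(ℝ, ℝ) (𝓡 n) γ t) (ht : γ t ∈ (extChartAt (𝓡 n) x).source) :
    trivializationAt (EuclideanSpace ℝ (Fin n)) (TangentSpace (𝓡 n)) x (velocity n γ t) =
      (γ t, deriv (extChartAt (𝓡 n) x ∘ γ) t) := by
  have : IsManifold (𝓡 n) 1 M := IsManifold.of_le (n := ∞) (by simp)
  have ht' : γ t ∈ (chartAt (EuclideanSpace ℝ (Fin n)) x).source := by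
    rwa [extChartAt_source] at ht
  have h1 := mfderiv_comp t (mdifferentiableAt_chart x ht) hγ
  rw [mfderiv_eq_fderiv] at h1
  have h2 := TangentBundle.continuousLinearMapAt_trivializationAt (I := 𝓡 n) ht'
  have h3 : (trivializationAt (EuclideanSpace ℝ (Fin n)) (TangentSpace (𝓡 n))
    x).continuousLinearMapAt
      ℝ (γ t) (velocity n γ t).2 = deriv (extChartAt (𝓡 n) x ∘ γ) t := by
    rw [h2, ← fderiv_apply_one_eq_deriv, h1]
    rfl
  refine Prod.ext (by simp [velocity]) (Eq.trans ?_ h3)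
  exact (Bundle.Trivialization.continuousLinearMapAt_apply_of_mem (R := ℝ)
    (trivializationAt (EuclideanSpace ℝ (Fin n)) (TangentSpace (𝓡 n)) x)
    (by simpa using ht') _).symm

lemma mdifferentiableAt_of_chart (x : M) {γ : ℝ → M} {t : ℝ} (hγ : ContinuousAt γ t)
    (ht : γ t ∈ (extChartAt (𝓡 n) x).source)
    (hd : DifferentiableAt ℝ (extChartAt (𝓡 n) x ∘ γ) t) :
    MDifferentiableAt 𝓘(ℝ, ℝ) (𝓡 n) γ t := by
  have h1 := (mdifferentiableAt_chart_symm x ((extChartAt (𝓡 n) x).map_source ht)).comp t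
    hd.mdifferentiableAt
  refine h1.congr_of_eventuallyEq ?_
  filter_upwards [hγ.preimage_mem_nhds (extChartAt_source_mem_nhds' ht)] with s hs
  exact ((extChartAt (𝓡 n) x).left_inv hs).symm

end Charts

variable {n : ℕ} {M : Type*} [TopologicalSpace M] [ChartedSpace (EuclideanSpace ℝ (Fin n)) M]
  [Bundle.RiemannianBundle (fun x : M ↦ TangentSpace (𝓡 n) x)]

variable (n) in
/-- The curve `γ` satisfies the geodesic equation near the time `t`, in the chart at `x`. -/
def IsGeodesicAt (x : M) (γ : ℝ → M) (t : ℝ) : Prop :=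
  γ t ∈ (extChartAt (𝓡 n) x).source ∧ ∀ᶠ s in 𝓝 t, ContinuousAt γ s ∧
    DifferentiableAt ℝ (extChartAt (𝓡 n) x ∘ γ) s ∧
    HasDerivAt (deriv (extChartAt (𝓡 n) x ∘ γ))
      (spray (metricTensor x) (extChartAt (𝓡 n) x (γ s)) (deriv (extChartAt (𝓡 n) x ∘ γ) s)) s

lemma IsGeodesicAt.of_hasDerivAt {x : M} {γ : ℝ → M} {t : ℝ}
    (ht : γ t ∈ (extChartAt (𝓡 n) x).source) (hγ : ∀ᶠ s in 𝓝 t, ContinuousAt γ s)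
    {c' : ℝ → EuclideanSpace ℝ (Fin n)}
    (h : ∀ᶠ s in 𝓝 t, HasDerivAt (extChartAt (𝓡 n) x ∘ γ) (c' s) s ∧
      HasDerivAt c' (spray (metricTensor x) (extChartAt (𝓡 n) x (γ s)) (c' s)) s) :
    IsGeodesicAt n x γ t := by
  refine ⟨ht, ?_⟩
  filter_upwards [hγ, h, h.eventually_nhds] with s h1 h2 h3
  have h4 : deriv (extChartAt (𝓡 n) x ∘ γ) =ᶠ[𝓝 s] c' := by
    filter_upwards [h3] with r hr using hr.1.deriv
  refine ⟨h1, h2.1.differentiableAt, ?_⟩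
  rw [h4.self_of_nhds]
  exact h2.2.congr_of_eventuallyEq h4

lemma IsGeodesicAt.congr {x : M} {γ γ' : ℝ → M} {t : ℝ} (h : IsGeodesicAt n x γ t)
    (hγ : γ' =ᶠ[𝓝 t] γ) : IsGeodesicAt n x γ' t := by
  refine IsGeodesicAt.of_hasDerivAt (c' := deriv (extChartAt (𝓡 n) x ∘ γ))
    (by rw [hγ.self_of_nhds]; exact h.1) ?_ ?_
  · filter_upwards [hγ.eventuallyEq_nhds, h.2] with s h1 h2
    exact h2.1.congr h1.symm
  · filter_upwards [hγ.eventuallyEq_nhds, h.2] with s h1 h2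
    have h3 : extChartAt (𝓡 n) x ∘ γ' =ᶠ[𝓝 s] extChartAt (𝓡 n) x ∘ γ := h1.fun_comp _
    refine ⟨h2.2.1.hasDerivAt.congr_of_eventuallyEq h3, ?_⟩
    rw [h1.self_of_nhds]
    exact h2.2.2

lemma IsGeodesicAt.comp_add {x : M} {γ : ℝ → M} {t σ : ℝ} (h : IsGeodesicAt n x γ (t + σ)) :
    IsGeodesicAt n x (fun s ↦ γ (s + σ)) t := by
  have hs : Tendsto (fun s ↦ s + σ) (𝓝 t) (𝓝 (t + σ)) := (continuous_add_const σ).tendsto t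
  refine IsGeodesicAt.of_hasDerivAt (c' := fun s ↦ deriv (extChartAt (𝓡 n) x ∘ γ) (s + σ))
    h.1 ?_ ?_
  · filter_upwards [hs.eventually h.2] with s h2
    exact ContinuousAt.comp (f := fun s ↦ s + σ) h2.1 (continuous_add_const σ).continuousAt
  · filter_upwards [hs.eventually h.2] with s h2
    exact ⟨h2.2.1.hasDerivAt.comp_add_const s σ, h2.2.2.comp_add_const s σ⟩

lemma IsGeodesicAt.comp_neg {x : M} {γ : ℝ → M} {t : ℝ} (h : IsGeodesicAt n x γ (-t)) :
    IsGeodesicAt n x (fun s ↦ γ (-s)) t := by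
  have hs : Tendsto (fun s : ℝ ↦ -s) (𝓝 t) (𝓝 (-t)) := continuous_neg.tendsto t
  refine IsGeodesicAt.of_hasDerivAt (c' := fun s ↦ -deriv (extChartAt (𝓡 n) x ∘ γ) (-s))
    h.1 ?_ ?_
  · filter_upwards [hs.eventually h.2] with s h2
    exact ContinuousAt.comp (f := fun s : ℝ ↦ -s) h2.1 continuous_neg.continuousAt
  · filter_upwards [hs.eventually h.2] with s h2
    have h3 := HasDerivAt.scomp s h2.2.1.hasDerivAt (hasDerivAt_neg s)
    have h4 := (HasDerivAt.scomp s h2.2.2 (hasDerivAt_neg s)).neg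
    rw [spray_neg]
    rw [neg_one_smul] at h3 h4
    rw [neg_neg] at h4
    exact ⟨h3, h4⟩

variable [IsManifold (𝓡 n) ∞ M]

lemma metricTensor_chartChange (x y : M) {u : EuclideanSpace ℝ (Fin n)}
    (hu : u ∈ chartChangeSource n x y) (a b : EuclideanSpace ℝ (Fin n)) :
    metricTensor x u a b = metricTensor y (chartChange x y u)
      (fderiv ℝ (chartChange x y) u a) (fderiv ℝ (chartChange x y) u b) := by
  rw [metricTensor_eq_metricAt, metricTensor_eq_metricAt, ← chartSymmDeriv_chartChange x y hu,
    ← chartSymmDeriv_chartChange x y hu]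
  congr 1
  exact ((extChartAt (𝓡 n) y).left_inv hu.2).symm

variable [IsContMDiffRiemannianBundle (𝓡 n) ∞ (EuclideanSpace ℝ (Fin n))
      (fun x : M ↦ TangentSpace (𝓡 n) x)]

/-- The change of coordinates pulls one metric tensor back to the other, so it maps solutions to
solutions. This allows `IsGeodesicAt n (γ t) γ t` to serve as the chart-free condition. -/
lemma IsGeodesicAt.change_chart {x : M} {γ : ℝ → M} {t : ℝ} (h : IsGeodesicAt n x γ t) (y : M)
    (hy : γ t ∈ (extChartAt (𝓡 n) y).source) : IsGeodesicAt n y γ t := by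
  have hO : IsOpen (chartChangeSource n x y) := isOpen_chartChangeSource x y
  set c := extChartAt (𝓡 n) x ∘ γ with hc
  have hcont : ContinuousAt γ t := h.2.self_of_nhds.1
  have hmem : ∀ᶠ s in 𝓝 t, γ s ∈ (extChartAt (𝓡 n) x).source ∩ (extChartAt (𝓡 n) y).source :=
    hcont (inter_mem (extChartAt_source_mem_nhds' h.1) (extChartAt_source_mem_nhds' hy))
  have hcO : ∀ s, γ s ∈ (extChartAt (𝓡 n) x).source ∩ (extChartAt (𝓡 n) y).source →
      c s ∈ chartChangeSource n x y := by
    intro s hs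
    refine ⟨(extChartAt (𝓡 n) x).map_source hs.1, ?_⟩
    simp only [hc, Set.mem_preimage, Function.comp_apply]
    rw [(extChartAt (𝓡 n) x).left_inv hs.1]
    exact hs.2
  have hψ : ∀ s, γ s ∈ (extChartAt (𝓡 n) x).source →
      chartChange x y (c s) = extChartAt (𝓡 n) y (γ s) := by
    intro s hs
    simp only [chartChange, hc, Function.comp_apply]
    rw [(extChartAt (𝓡 n) x).left_inv hs]
  refine IsGeodesicAt.of_hasDerivAt (c' := fun s ↦ fderiv ℝ (chartChange x y) (c s) (deriv c s))
    hy (h.2.mono fun s hs ↦ hs.1) ?_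
  filter_upwards [h.2, hmem, hmem.eventually_nhds] with s h1 h2 h3
  have hs := hcO s h2
  have hdψ : HasFDerivAt (chartChange x y) (fderiv ℝ (chartChange x y) (c s)) (c s) :=
    (((contDiffOn_chartChange x y).contDiffAt (hO.mem_nhds hs)).differentiableAt
      (by simp)).hasFDerivAt
  -- A kernel vector would have length zero for the pulled-back metric; surjectivity then follows by
  -- dimension.
  have hinj : Function.Injective (fderiv ℝ (chartChange x y) (c s)) := by
    rw [injective_iff_map_eq_zero]
    intro a ha
    by_contra hne
    have h5 := (isMetricTensor x).pos (c s) hs.1 a hne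
    rw [metricTensor_chartChange x y hs, ha] at h5
    simp at h5
  have hsurj : Function.Surjective (fderiv ℝ (chartChange x y) (c s)) :=
    LinearMap.injective_iff_surjective (f := (fderiv ℝ (chartChange x y) (c s)).toLinearMap).1 hinj
  refine ⟨?_, ?_⟩
  · refine (hdψ.comp_hasDerivAt s h1.2.1.hasDerivAt).congr_of_eventuallyEq ?_
    filter_upwards [h3] with r hr using (hψ r hr.1).symm
  · have h4 := (isMetricTensor y).hasDerivAt_fderiv_comp ((isMetricTensor x).mono hO
      Set.inter_subset_left) (contDiffOn_chartChange x y)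
      (fun u hu ↦ (extChartAt (𝓡 n) y).map_source hu.2)
      (fun u hu a b ↦ metricTensor_chartChange x y hu a b) hs hsurj h1.2.1.hasDerivAt h1.2.2
    rwa [hψ s h2.1] at h4

end

/-! ### Coordinates of tangent vectors, uniqueness of geodesics, constancy of speed -/

section

/-- The minimum over the unit sphere works at `u₀`; half of it absorbs the variation of `G` nearby.
-/
lemma IsMetricTensor.exists_pos_mul_sq_le {E : Type*} [NormedAddCommGroup E] [NormedSpace ℝ E]
    [FiniteDimensional ℝ E] {G : E → E →L[ℝ] E →L[ℝ] ℝ} {O : Set E} (hG : IsMetricTensor G O)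
    {u₀ : E} (hu₀ : u₀ ∈ O) :
    ∃ m > 0, ∀ᶠ u in 𝓝 u₀, ∀ a, m * ‖a‖ ^ 2 ≤ G u a a := by
  have hproper : ProperSpace E := FiniteDimensional.proper ℝ E
  obtain ⟨m, hm, hmle⟩ : ∃ m > 0, ∀ a, m * ‖a‖ ^ 2 ≤ G u₀ a a := by
    rcases subsingleton_or_nontrivial E with h | h
    · exact ⟨1, one_pos, fun a ↦ by simp [Subsingleton.elim a 0]⟩
    · have hcont : Continuous fun a ↦ G u₀ a a := (G u₀).continuous.clm_apply continuous_id
      obtain ⟨b, hb, hbmin⟩ := (isCompact_sphere (0 : E) 1).exists_isMinOn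
        (NormedSpace.sphere_nonempty.2 zero_le_one) hcont.continuousOn
      refine ⟨G u₀ b b, hG.pos u₀ hu₀ b (ne_zero_of_mem_unit_sphere ⟨b, hb⟩), fun a ↦ ?_⟩
      rcases eq_or_ne a 0 with rfl | ha
      · simp
      · have h1 : G u₀ b b ≤ G u₀ (‖a‖⁻¹ • a) (‖a‖⁻¹ • a) :=
          hbmin (show ‖a‖⁻¹ • a ∈ Metric.sphere (0 : E) 1 by simp [norm_smul, ha])
        have h2 : 0 < ‖a‖ := norm_pos_iff.2 ha
        simp only [map_smul, smul_apply, smul_eq_mul] at h1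
        have h3 : ‖a‖ ^ 2 * (‖a‖⁻¹ * (‖a‖⁻¹ * G u₀ a a)) = G u₀ a a := by field_simp
        rw [← h3, mul_comm]
        exact mul_le_mul_of_nonneg_left h1 (sq_nonneg _)
  refine ⟨m / 2, half_pos hm, ?_⟩
  have hcont : ContinuousAt G u₀ := (hG.contDiffOn.contDiffAt (hG.isOpen.mem_nhds hu₀)).continuousAt
  filter_upwards [Metric.continuousAt_iff'.1 hcont (m / 2) (half_pos hm)] with u hu a
  have h1 : ‖(G u - G u₀) a a‖ ≤ m / 2 * ‖a‖ * ‖a‖ := by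
    refine ((G u - G u₀).le_opNorm₂ a a).trans ?_
    rw [← dist_eq_norm]
    gcongr
  have h2 := (abs_le.1 h1).1
  have h3 := hmle a
  simp only [sub_apply] at h2
  nlinarith

section Charts

variable {n : ℕ} {M : Type*} [TopologicalSpace M] [ChartedSpace (EuclideanSpace ℝ (Fin n)) M]
  [IsManifold (𝓡 n) ∞ M]

/-- The components of a tangent vector in the chart at `x`. -/
noncomputable def tangentCoord (x : M) (v : TangentBundle (𝓡 n) M) : EuclideanSpace ℝ (Fin n) :=
  (trivializationAt (EuclideanSpace ℝ (Fin n)) (TangentSpace (𝓡 n)) x v).2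

lemma mem_trivializationAt_source {x : M} {v : TangentBundle (𝓡 n) M}
    (hv : v.proj ∈ (extChartAt (𝓡 n) x).source) :
    v ∈ (trivializationAt (EuclideanSpace ℝ (Fin n)) (TangentSpace (𝓡 n)) x).source := by
  rw [Bundle.Trivialization.mem_source]
  simpa using hv

lemma tangentCoord_velocity (x : M) {γ : ℝ → M} {t : ℝ}
    (hγ : MDifferentiableAt 𝓘(ℝ, ℝ) (𝓡 n) γ t) (ht : γ t ∈ (extChartAt (𝓡 n) x).source) :
    tangentCoord x (velocity n γ t) = deriv (extChartAt (𝓡 n) x ∘ γ) t := by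
  rw [tangentCoord, trivializationAt_velocity x hγ ht]

lemma eq_of_tangentCoord_eq {x : M} {v w : TangentBundle (𝓡 n) M}
    (hv : v.proj ∈ (extChartAt (𝓡 n) x).source) (hp : v.proj = w.proj)
    (h : tangentCoord x v = tangentCoord x w) : v = w := by
  set e := trivializationAt (EuclideanSpace ℝ (Fin n)) (TangentSpace (𝓡 n)) x with he
  have hv' : v ∈ e.source := mem_trivializationAt_source hv
  have hw' : w ∈ e.source := mem_trivializationAt_source (hp ▸ hv)
  refine e.injOn hv' hw' (Prod.ext ?_ h)
  exact (e.coe_fst hv').trans (hp.trans (e.coe_fst hw').symm)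

lemma continuousAt_tangentCoord {x : M} {v : TangentBundle (𝓡 n) M}
    (hv : v.proj ∈ (extChartAt (𝓡 n) x).source) : ContinuousAt (tangentCoord x) v :=
  ((trivializationAt (EuclideanSpace ℝ (Fin n)) (TangentSpace (𝓡 n)) x).continuousAt
    (mem_trivializationAt_source hv)).snd

lemma chartSymmDeriv_tangentCoord {x : M} {v : TangentBundle (𝓡 n) M}
    (hv : v.proj ∈ (extChartAt (𝓡 n) x).source) :
    chartSymmDeriv x (extChartAt (𝓡 n) x v.proj) (tangentCoord x v) = v.2 := by
  set e := trivializationAt (EuclideanSpace ℝ (Fin n)) (TangentSpace (𝓡 n)) x with he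
  have hv' : v.proj ∈ e.baseSet := e.mem_source.1 (mem_trivializationAt_source hv)
  have h1 := e.symmL_continuousLinearMapAt (R := ℝ) hv' v.2
  rw [e.continuousLinearMapAt_apply_of_mem (R := ℝ) hv',
    TangentBundle.symmL_trivializationAt (by simpa using hv), ModelWithCorners.range_eq_univ,
    mfderivWithin_univ] at h1
  exact h1

end Charts

variable {n : ℕ} {M : Type*} [TopologicalSpace M] [ChartedSpace (EuclideanSpace ℝ (Fin n)) M]

lemma velocity_congr {γ₁ γ₂ : ℝ → M} {t : ℝ} (h : γ₁ =ᶠ[𝓝 t] γ₂) :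
    velocity n γ₁ t = velocity n γ₂ t := by
  have h1 : γ₁ t = γ₂ t := h.self_of_nhds
  rw [velocity, velocity, h.mfderiv_eq, h1]

variable [Bundle.RiemannianBundle (fun x : M ↦ TangentSpace (𝓡 n) x)]

lemma IsGeodesicAt.continuousAt {x : M} {γ : ℝ → M} {t : ℝ} (h : IsGeodesicAt n x γ t) :
    ContinuousAt γ t := h.2.self_of_nhds.1

lemma IsGeodesicAt.eventually {x : M} {γ : ℝ → M} {t : ℝ} (h : IsGeodesicAt n x γ t) :
    ∀ᶠ s in 𝓝 t, IsGeodesicAt n x γ s := by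
  filter_upwards [h.2.eventually_nhds,
    h.continuousAt (extChartAt_source_mem_nhds' h.1)] with s h1 h2
    using ⟨h2, h1⟩

variable [IsManifold (𝓡 n) ∞ M]

lemma norm_sq_eq_metricTensor {x : M} {v : TangentBundle (𝓡 n) M}
    (hv : v.proj ∈ (extChartAt (𝓡 n) x).source) :
    ‖v.2‖ ^ 2 = metricTensor x (extChartAt (𝓡 n) x v.proj) (tangentCoord x v)
      (tangentCoord x v) := by
  rw [metricTensor_eq_metricAt, (extChartAt (𝓡 n) x).left_inv hv, chartSymmDeriv_tangentCoord hv]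
  exact (real_inner_self_eq_norm_sq (F := TangentSpace (𝓡 n) v.proj) v.2).symm

lemma IsGeodesicAt.mdifferentiableAt {x : M} {γ : ℝ → M} {t : ℝ} (h : IsGeodesicAt n x γ t) :
    MDifferentiableAt 𝓘(ℝ, ℝ) (𝓡 n) γ t :=
  mdifferentiableAt_of_chart x h.continuousAt h.1 h.2.self_of_nhds.2.1

variable [IsContMDiffRiemannianBundle (𝓡 n) ∞ (EuclideanSpace ℝ (Fin n))
      (fun x : M ↦ TangentSpace (𝓡 n) x)]

lemma IsGeodesicAt.eventuallyEq {x y : M} {γ₁ γ₂ : ℝ → M} {t : ℝ} (h₁ : IsGeodesicAt n x γ₁ t)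
    (h₂ : IsGeodesicAt n y γ₂ t) (h : velocity n γ₁ t = velocity n γ₂ t) : γ₁ =ᶠ[𝓝 t] γ₂ := by
  have h0 : γ₁ t = γ₂ t := congrArg Bundle.TotalSpace.proj h
  have h₂' := h₂.change_chart x (h0 ▸ h₁.1)
  have h3 := (isMetricTensor x).eventuallyEq_of_solution ((extChartAt (𝓡 n) x).map_source h₁.1)
    (h₁.2.mono fun s hs ↦ ⟨hs.2.1.hasDerivAt, hs.2.2⟩)
    (h₂'.2.mono fun s hs ↦ ⟨hs.2.1.hasDerivAt, hs.2.2⟩) (congrArg (extChartAt (𝓡 n) x) h0) (by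
      rw [← tangentCoord_velocity x h₁.mdifferentiableAt h₁.1,
        ← tangentCoord_velocity x h₂'.mdifferentiableAt h₂'.1, h])
  filter_upwards [h3, h₁.continuousAt (extChartAt_source_mem_nhds' h₁.1),
    h₂'.continuousAt (extChartAt_source_mem_nhds' h₂'.1)] with s hs hs1 hs2
  exact (extChartAt (𝓡 n) x).injOn hs1 hs2 hs

/-- Two geodesics on an interval with a common velocity agree. -/
lemma eqOn_of_isGeodesicAt [T2Space M] {γ₁ γ₂ : ℝ → M} {α β t₀ : ℝ} (ht₀ : t₀ ∈ Set.Ioo α β)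
    (h₁ : ∀ t ∈ Set.Ioo α β, IsGeodesicAt n (γ₁ t) γ₁ t)
    (h₂ : ∀ t ∈ Set.Ioo α β, IsGeodesicAt n (γ₂ t) γ₂ t)
    (h : velocity n γ₁ t₀ = velocity n γ₂ t₀) : Set.EqOn γ₁ γ₂ (Set.Ioo α β) := by
  have hpc : IsPreconnected (Set.Ioo α β) := isPreconnected_Ioo
  have hU : IsOpen {t | γ₁ =ᶠ[𝓝 t] γ₂} := isOpen_setOfPred_eventually_nhds
  -- The open set of times near which the curves agree is also closed in the interval: positions and
  -- coordinate velocities are continuous, so they agree at limit times, and local uniqueness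
  -- applies.
  have hsub : Set.Ioo α β ⊆ {t | γ₁ =ᶠ[𝓝 t] γ₂} := by
    refine hpc.subset_of_closure_inter_subset hU
      ⟨t₀, ht₀, (h₁ t₀ ht₀).eventuallyEq (h₂ t₀ ht₀) h⟩ ?_
    rintro t ⟨htc, ht⟩
    have hfreq : ∃ᶠ s in 𝓝 t, γ₁ =ᶠ[𝓝 s] γ₂ := mem_closure_iff_frequently.1 htc
    have h0 : γ₁ t = γ₂ t := tendsto_nhds_unique_of_frequently_eq (h₁ t ht).continuousAt
      (h₂ t ht).continuousAt (hfreq.mono fun s hs ↦ hs.self_of_nhds)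
    have h₂' := (h₂ t ht).change_chart (γ₁ t) (h0 ▸ (h₁ t ht).1)
    refine (h₁ t ht).eventuallyEq h₂' (eq_of_tangentCoord_eq (h₁ t ht).1 h0 ?_)
    rw [tangentCoord_velocity _ (h₁ t ht).mdifferentiableAt (h₁ t ht).1,
      tangentCoord_velocity _ h₂'.mdifferentiableAt h₂'.1]
    exact tendsto_nhds_unique_of_frequently_eq (h₁ t ht).2.self_of_nhds.2.2.continuousAt
      h₂'.2.self_of_nhds.2.2.continuousAt
      (hfreq.mono fun s hs ↦ (hs.fun_comp (extChartAt (𝓡 n) (γ₁ t))).deriv_eq)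
  intro t ht
  exact (hsub ht).self_of_nhds

/-- What matters is that one `ε` serves a whole neighbourhood of `v`; compactness of the unit
tangent bundle then makes it global. -/
lemma exists_isGeodesicAt_of_nhds (v : TangentBundle (𝓡 n) M) :
    ∃ ε > 0, ∀ᶠ w in 𝓝 v, ∃ γ : ℝ → M, velocity n γ 0 = w ∧
      ∀ t ∈ Set.Ioo (-ε) ε, IsGeodesicAt n (γ t) γ t := by
  set x := v.proj with hx
  obtain ⟨ε, hε, hev⟩ := (isMetricTensor x).exists_local_solution (mem_extChartAt_target x)
    (tangentCoord x v)
  have hvx : v.proj ∈ (extChartAt (𝓡 n) x).source := mem_extChartAt_source x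
  have hproj : ContinuousAt (Bundle.TotalSpace.proj : TangentBundle (𝓡 n) M → M) v :=
    (FiberBundle.continuous_proj _ _).continuousAt
  have hcont : ContinuousAt (fun w : TangentBundle (𝓡 n) M ↦
      (extChartAt (𝓡 n) x w.proj, tangentCoord x w)) v :=
    ((continuousAt_extChartAt (I := 𝓡 n) x).comp_of_eq hproj rfl).prodMk
      (continuousAt_tangentCoord hvx)
  refine ⟨ε, hε, ?_⟩
  filter_upwards [hcont.eventually hev,
    hproj (extChartAt_source_mem_nhds (I := 𝓡 n) x)] with w hw hwx
  obtain ⟨c, c', h0, h0', hc⟩ := hw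
  have hgeod : ∀ t ∈ Set.Ioo (-ε) ε, IsGeodesicAt n x ((extChartAt (𝓡 n) x).symm ∘ c) t := by
    intro t ht
    have hnhds : Set.Ioo (-ε) ε ∈ 𝓝 t := isOpen_Ioo.mem_nhds ht
    have heq : ∀ s ∈ Set.Ioo (-ε) ε,
        extChartAt (𝓡 n) x ((extChartAt (𝓡 n) x).symm (c s)) = c s :=
      fun s hs ↦ (extChartAt (𝓡 n) x).right_inv (hc s hs).1
    refine IsGeodesicAt.of_hasDerivAt (c' := c') ((extChartAt (𝓡 n) x).map_target (hc t ht).1) ?_ ?_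
    · filter_upwards [hnhds] with s hs
      exact (continuousAt_extChartAt_symm'' (hc s hs).1).comp (hc s hs).2.1.continuousAt
    · filter_upwards [hnhds, eventually_mem_nhds_iff.2 hnhds] with s hs hs'
      refine ⟨(hc s hs).2.1.congr_of_eventuallyEq ?_, ?_⟩
      · filter_upwards [hs'] with r hr using heq r hr
      · simp only [Function.comp_apply]
        rw [heq s hs]
        exact (hc s hs).2.2
  refine ⟨(extChartAt (𝓡 n) x).symm ∘ c, ?_, fun t ht ↦ (hgeod t ht).change_chart _
    (mem_extChartAt_source _)⟩
  have h00 : (0 : ℝ) ∈ Set.Ioo (-ε) ε := ⟨by linarith, hε⟩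
  have hbase : (extChartAt (𝓡 n) x).symm (c 0) = w.proj := by
    rw [h0]
    exact (extChartAt (𝓡 n) x).left_inv hwx
  refine eq_of_tangentCoord_eq (x := x) (hgeod 0 h00).1 hbase ?_
  rw [tangentCoord_velocity x (hgeod 0 h00).mdifferentiableAt (hgeod 0 h00).1, ← h0']
  refine ((hc 0 h00).2.1.congr_of_eventuallyEq ?_).deriv
  filter_upwards [isOpen_Ioo.mem_nhds h00] with r hr
  exact (extChartAt (𝓡 n) x).right_inv (hc r hr).1

lemma IsGeodesicAt.eventually_norm_velocity_eq {γ : ℝ → M} {x : M} {t : ℝ}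
    (h : IsGeodesicAt n x γ t) :
    ∀ᶠ s in 𝓝 t, ‖(velocity n γ s).2‖ = ‖(velocity n γ t).2‖ := by
  obtain ⟨ε, hε, hball⟩ := Metric.eventually_nhds_iff_ball.1 (h.eventually.and h.2)
  set c := extChartAt (𝓡 n) x ∘ γ with hc
  have hder : ∀ s ∈ Metric.ball t ε,
      HasDerivAt (fun r ↦ metricTensor x (c r) (deriv c r) (deriv c r)) 0 s := fun s hs ↦
    (isMetricTensor x).hasDerivAt_apply_apply ((extChartAt (𝓡 n) x).map_source (hball s hs).1.1)
      (hball s hs).2.2.1.hasDerivAt (hball s hs).2.2.2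
  have hsq : ∀ s ∈ Metric.ball t ε,
      ‖(velocity n γ s).2‖ ^ 2 = metricTensor x (c s) (deriv c s) (deriv c s) := by
    intro s hs
    rw [norm_sq_eq_metricTensor (x := x) (v := velocity n γ s) (hball s hs).1.1,
      tangentCoord_velocity x (hball s hs).1.mdifferentiableAt (hball s hs).1.1]
    rfl
  filter_upwards [Metric.ball_mem_nhds t hε] with s hs
  have h1 := (convex_ball t ε).is_const_of_fderivWithin_eq_zero (𝕜 := ℝ)
    (f := fun r ↦ metricTensor x (c r) (deriv c r) (deriv c r))
    (fun r hr ↦ (hder r hr).differentiableAt.differentiableWithinAt) (fun r hr ↦ by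
      rw [fderivWithin_of_isOpen Metric.isOpen_ball hr]
      ext; simp [(hder r hr).deriv]) hs (Metric.mem_ball_self hε)
  have h2 : ‖(velocity n γ s).2‖ ^ 2 = ‖(velocity n γ t).2‖ ^ 2 := by
    rw [hsq s hs, hsq t (Metric.mem_ball_self hε)]
    exact h1
  exact (sq_eq_sq₀ (norm_nonneg _) (norm_nonneg _)).1 h2

end

/-! ### Compactness of the unit tangent bundle and geodesic completeness -/

section

/-- Agreement near `s`, and not just at `s`, makes the glued curve locally equal to one of the two
at every time, so that local conditions are inherited. -/
lemma exists_glue {M : Type*} {γ δ : ℝ → M} {s : ℝ} (h : γ =ᶠ[𝓝 s] δ) :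
    ∃ η : ℝ → M, (∀ t ≤ s, η =ᶠ[𝓝 t] γ) ∧ ∀ t ≥ s, η =ᶠ[𝓝 t] δ := by
  refine ⟨fun t ↦ if t < s then γ t else δ t, ?_, ?_⟩
  · intro t ht
    rcases ht.lt_or_eq with ht | rfl
    · filter_upwards [eventually_lt_nhds ht] with r hr using if_pos hr
    · filter_upwards [h] with r hr
      split_ifs with h1
      · rfl
      · exact hr.symm
  · intro t ht
    rcases ht.lt_or_eq with ht | rfl
    · filter_upwards [eventually_gt_nhds ht] with r hr using if_neg (not_lt.2 hr.le)
    · filter_upwards [h] with r hr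
      split_ifs with h1
      · exact hr
      · rfl

lemma exists_tendsto_of_isCompact {X Y : Type*} [TopologicalSpace Y] {f : Ultrafilter X} {g : X → Y}
    {K : Set Y} (hK : IsCompact K) (h : ∀ᶠ x in (f : Filter X), g x ∈ K) :
    ∃ y ∈ K, Tendsto g f (𝓝 y) :=
  isCompact_iff_ultrafilter_le_nhds.1 hK (f.map g) (le_principal_iff.2 h)

section Charts

variable {n : ℕ} {M : Type*} [TopologicalSpace M] [ChartedSpace (EuclideanSpace ℝ (Fin n)) M]
  [IsManifold (𝓡 n) ∞ M]

lemma tangentCoord_neg {x : M} {v : TangentBundle (𝓡 n) M}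
    (hv : v.proj ∈ (extChartAt (𝓡 n) x).source) :
    tangentCoord x ⟨v.proj, -v.2⟩ = -tangentCoord x v := by
  set e := trivializationAt (EuclideanSpace ℝ (Fin n)) (TangentSpace (𝓡 n)) x with he
  have hv' : v.proj ∈ e.baseSet := e.mem_source.1 (mem_trivializationAt_source hv)
  exact (e.linear ℝ hv').mk' _ |>.map_neg v.2

lemma velocity_comp_add {γ : ℝ → M} {t σ : ℝ}
    (hγ : MDifferentiableAt 𝓘(ℝ, ℝ) (𝓡 n) γ (t + σ)) :
    velocity n (fun s ↦ γ (s + σ)) t = velocity n γ (t + σ) := by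
  have h1 : MDifferentiableAt 𝓘(ℝ, ℝ) (𝓡 n) (fun s ↦ γ (s + σ)) t :=
    MDifferentiableAt.comp (f := fun s ↦ s + σ) t hγ
      (differentiableAt_id.add_const σ).mdifferentiableAt
  refine eq_of_tangentCoord_eq (x := γ (t + σ)) (mem_extChartAt_source _) rfl ?_
  rw [tangentCoord_velocity _ h1 (mem_extChartAt_source _),
    tangentCoord_velocity _ hγ (mem_extChartAt_source _)]
  exact deriv_comp_add_const (extChartAt (𝓡 n) (γ (t + σ)) ∘ γ) σ t

lemma velocity_comp_neg {γ : ℝ → M} {t : ℝ} (hγ : MDifferentiableAt 𝓘(ℝ, ℝ) (𝓡 n) γ (-t)) :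
    velocity n (fun s ↦ γ (-s)) t = ⟨γ (-t), -(velocity n γ (-t)).2⟩ := by
  have h1 : MDifferentiableAt 𝓘(ℝ, ℝ) (𝓡 n) (fun s ↦ γ (-s)) t :=
    MDifferentiableAt.comp (f := fun s : ℝ ↦ -s) t hγ differentiableAt_id.neg.mdifferentiableAt
  refine eq_of_tangentCoord_eq (x := γ (-t)) (mem_extChartAt_source _) rfl ?_
  rw [tangentCoord_velocity _ h1 (mem_extChartAt_source _)]
  refine Eq.trans ?_ (tangentCoord_neg (v := velocity n γ (-t)) (mem_extChartAt_source _)).symm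
  refine Eq.trans ?_ (congrArg Neg.neg (tangentCoord_velocity _ hγ (mem_extChartAt_source _))).symm
  exact deriv_comp_neg (extChartAt (𝓡 n) (γ (-t)) ∘ γ) t

end Charts

variable {n : ℕ} {M : Type*} [TopologicalSpace M] [ChartedSpace (EuclideanSpace ℝ (Fin n)) M]
  [Bundle.RiemannianBundle (fun x : M ↦ TangentSpace (𝓡 n) x)]

/-- The map `v ↦ -v` of the unit tangent bundle. -/
noncomputable def unitNeg (v : UnitTangentBundle n M) : UnitTangentBundle n M :=
  ⟨⟨v.1.proj, -v.1.2⟩, by rw [norm_neg]; exact v.2⟩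

lemma IsGeodesicAt.congr_self {γ γ' : ℝ → M} {t : ℝ} (h : IsGeodesicAt n (γ t) γ t)
    (hγ : γ' =ᶠ[𝓝 t] γ) : IsGeodesicAt n (γ' t) γ' t := by
  rw [hγ.self_of_nhds]
  exact h.congr hγ

variable [IsManifold (𝓡 n) ∞ M]

lemma continuous_unitNeg :
    Continuous (unitNeg : UnitTangentBundle n M → UnitTangentBundle n M) := by
  refine Continuous.subtype_mk (continuous_iff_continuousAt.2 fun v ↦ ?_) _
  have hproj : Continuous fun v : UnitTangentBundle n M ↦ v.1.proj :=
    (FiberBundle.continuous_proj _ _).comp continuous_subtype_val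
  rw [FiberBundle.continuousAt_totalSpace]
  refine ⟨hproj.continuousAt, ?_⟩
  have hx : v.1.proj ∈ (extChartAt (𝓡 n) v.1.proj).source := mem_extChartAt_source _
  have h1 : ContinuousAt (fun w : UnitTangentBundle n M ↦ -tangentCoord v.1.proj w.1) v :=
    (ContinuousAt.comp (f := (Subtype.val : UnitTangentBundle n M → _))
      (continuousAt_tangentCoord hx)
      continuous_subtype_val.continuousAt).neg
  refine h1.congr ?_
  filter_upwards [hproj.continuousAt (extChartAt_source_mem_nhds (I := 𝓡 n) v.1.proj)] with w hw
  exact (tangentCoord_neg hw).symm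

variable [IsContMDiffRiemannianBundle (𝓡 n) ∞ (EuclideanSpace ℝ (Fin n))
      (fun x : M ↦ TangentSpace (𝓡 n) x)]

/-- Along an ultrafilter the base points converge, and the components of the unit vectors in a chart
at the limit are bounded because the metric tensor is uniformly positive there. Continuity of the
metric tensor shows that the limit is a unit vector. -/
instance compactSpace_unitTangentBundle [CompactSpace M] :
    CompactSpace (UnitTangentBundle n M) := by
  refine ⟨isCompact_iff_ultrafilter_le_nhds.2 fun f _ ↦ ?_⟩
  obtain ⟨x, -, hproj⟩ := exists_tendsto_of_isCompact (isCompact_univ (X := M))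
    (f := f) (g := fun v ↦ v.1.proj) (Eventually.of_forall fun _ ↦ trivial)
  set e := trivializationAt (EuclideanSpace ℝ (Fin n)) (TangentSpace (𝓡 n)) x with he
  have hsrc : ∀ᶠ v in (f : Filter (UnitTangentBundle n M)),
      v.1.proj ∈ (extChartAt (𝓡 n) x).source := hproj (extChartAt_source_mem_nhds x)
  have hφ : Tendsto (fun v : UnitTangentBundle n M ↦ extChartAt (𝓡 n) x v.1.proj) f
      (𝓝 (extChartAt (𝓡 n) x x)) := (continuousAt_extChartAt x).tendsto.comp hproj
  obtain ⟨m, hm, hGm⟩ := (isMetricTensor x).exists_pos_mul_sq_le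
    (mem_extChartAt_target (I := 𝓡 n) x)
  have hbd : ∀ᶠ v in (f : Filter (UnitTangentBundle n M)),
      tangentCoord x v.1 ∈ Metric.closedBall (0 : EuclideanSpace ℝ (Fin n)) (√(1 / m)) := by
    filter_upwards [hsrc, hφ.eventually hGm] with v hv h1
    have h2 := h1 (tangentCoord x v.1)
    rw [← norm_sq_eq_metricTensor hv, v.2, one_pow] at h2
    rw [mem_closedBall_zero_iff]
    exact Real.le_sqrt_of_sq_le (by rw [le_div_iff₀ hm]; linarith)
  obtain ⟨a, -, ha'⟩ := exists_tendsto_of_isCompact (isCompact_closedBall _ _) hbd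
  have hmem : (x, a) ∈ e.target := by
    rw [e.mem_target]
    exact FiberBundle.mem_baseSet_trivializationAt' x
  set w := e.toOpenPartialHomeomorph.symm (x, a) with hw
  have hew : e w = (x, a) := e.toOpenPartialHomeomorph.right_inv hmem
  have hwsrc : w ∈ e.source := e.toOpenPartialHomeomorph.map_target hmem
  have hwx : w.proj = x := by rw [← e.coe_fst hwsrc, hew]
  have hlim : Tendsto (fun v : UnitTangentBundle n M ↦ v.1) f (𝓝 w) := by
    have h1 : Tendsto (fun v : UnitTangentBundle n M ↦ (v.1.proj, tangentCoord x v.1)) f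
        (𝓝 (x, a)) := hproj.prodMk_nhds ha'
    refine ((e.toOpenPartialHomeomorph.continuousAt_symm hmem).tendsto.comp h1).congr' ?_
    filter_upwards [hsrc] with v hv
    have h2 := mem_trivializationAt_source hv
    have h3 : (v.1.proj, tangentCoord x v.1) = e v.1 := Prod.ext (e.coe_fst h2).symm rfl
    rw [Function.comp_apply, h3]
    exact e.toOpenPartialHomeomorph.left_inv h2
  have hnorm : ‖w.2‖ = 1 := by
    have hG : ContinuousAt (metricTensor x) (extChartAt (𝓡 n) x x) :=
      ((isMetricTensor x).contDiffOn.contDiffAt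
        ((isMetricTensor x).isOpen.mem_nhds (mem_extChartAt_target x))).continuousAt
    have h0 : Tendsto (fun v : UnitTangentBundle n M ↦
        metricTensor x (extChartAt (𝓡 n) x v.1.proj)) f
        (𝓝 (metricTensor x (extChartAt (𝓡 n) x x))) := hG.tendsto.comp hφ
    have h1 := (((by fun_prop : Continuous fun p : (EuclideanSpace ℝ (Fin n) →L[ℝ]
      EuclideanSpace ℝ (Fin n) →L[ℝ] ℝ) × EuclideanSpace ℝ (Fin n) ↦ p.1 p.2 p.2)).tendsto _).comp
      (h0.prodMk_nhds ha')
    have h2 : ∀ᶠ v in (f : Filter (UnitTangentBundle n M)),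
        metricTensor x (extChartAt (𝓡 n) x v.1.proj) (tangentCoord x v.1)
          (tangentCoord x v.1) = 1 := by
      filter_upwards [hsrc] with v hv
      rw [← norm_sq_eq_metricTensor hv, v.2, one_pow]
    have h3 := tendsto_nhds_unique (h1.congr' h2) tendsto_const_nhds
    have hwa : tangentCoord x w = a := congrArg Prod.snd hew
    have h4 := norm_sq_eq_metricTensor (x := x) (v := w)
      (by rw [hwx]; exact mem_extChartAt_source x)
    rw [hwx, hwa, h3] at h4
    exact (pow_eq_one_iff_of_nonneg (norm_nonneg _) two_ne_zero).1 h4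
  refine ⟨⟨w, hnorm⟩, trivial, ?_⟩
  rw [nhds_subtype_eq_comap]
  exact map_le_iff_le_comap.1 hlim

lemma norm_velocity_eq_of_isGeodesicAt {γ : ℝ → M} {α β s t : ℝ}
    (h : ∀ t ∈ Set.Ioo α β, IsGeodesicAt n (γ t) γ t) (hs : s ∈ Set.Ioo α β)
    (ht : t ∈ Set.Ioo α β) : ‖(velocity n γ t).2‖ = ‖(velocity n γ s).2‖ := by
  have hpc : IsPreconnected (Set.Ioo α β) := isPreconnected_Ioo
  have hU : IsOpen {r | ∀ᶠ q in 𝓝 r, ‖(velocity n γ q).2‖ = ‖(velocity n γ s).2‖} :=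
    isOpen_setOfPred_eventually_nhds
  have hsub := hpc.subset_of_closure_inter_subset hU
    ⟨s, hs, (h s hs).eventually_norm_velocity_eq⟩ (by
      rintro r ⟨hrc, hr⟩
      have h1 := (h r hr).eventually_norm_velocity_eq
      obtain ⟨q, hq1, hq2⟩ := ((mem_closure_iff_frequently.1 hrc).and_eventually h1).exists
      filter_upwards [h1] with p hp
      rw [hp, ← hq2]
      exact hq1.self_of_nhds)
  exact (hsub ht).self_of_nhds

variable [CompactSpace M]

/-- With a uniform time of existence `ε`, a geodesic can be prolonged by `ε / 2` as often as needed;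
constant speed keeps the restarting velocity in the unit tangent bundle. -/
lemma exists_isGeodesicAt_forward : ∃ ε > 0, ∀ (R : ℝ) (v : UnitTangentBundle n M),
    ∃ γ : ℝ → M, velocity n γ 0 = v ∧ ∀ t ∈ Set.Ioo (-ε) R, IsGeodesicAt n (γ t) γ t := by
  obtain ⟨ε, hε, hloc⟩ : ∃ ε > 0, ∀ v : UnitTangentBundle n M, ∃ γ : ℝ → M, velocity n γ 0 = v ∧
      ∀ t ∈ Set.Ioo (-ε) ε, IsGeodesicAt n (γ t) γ t := by
    have h1 := isCompact_univ.induction_on (X := UnitTangentBundle n M)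
      (p := fun s ↦ ∃ ε > 0, ∀ v ∈ s, ∃ γ : ℝ → M, velocity n γ 0 = v ∧
        ∀ t ∈ Set.Ioo (-ε) ε, IsGeodesicAt n (γ t) γ t) ⟨1, one_pos, by simp⟩
      (fun s t hst ⟨ε, hε, h⟩ ↦ ⟨ε, hε, fun v hv ↦ h v (hst hv)⟩) ?_ ?_
    · obtain ⟨ε, hε, h⟩ := h1
      exact ⟨ε, hε, fun v ↦ h v trivial⟩
    · rintro s t ⟨ε, hε, h⟩ ⟨ε', hε', h'⟩
      refine ⟨min ε ε', lt_min hε hε', fun v hv ↦ ?_⟩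
      have key : Set.Ioo (-min ε ε') (min ε ε') ⊆ Set.Ioo (-ε) ε ∩ Set.Ioo (-ε') ε' := fun t ht ↦
        ⟨⟨(neg_le_neg (min_le_left _ _)).trans_lt ht.1, ht.2.trans_le (min_le_left _ _)⟩,
          ⟨(neg_le_neg (min_le_right _ _)).trans_lt ht.1, ht.2.trans_le (min_le_right _ _)⟩⟩
      rcases hv with hv | hv
      · obtain ⟨γ, h0, hγ⟩ := h v hv
        exact ⟨γ, h0, fun t ht ↦ hγ t (key ht).1⟩
      · obtain ⟨γ, h0, hγ⟩ := h' v hv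
        exact ⟨γ, h0, fun t ht ↦ hγ t (key ht).2⟩
    · intro v _
      obtain ⟨ε, hε, h⟩ := exists_isGeodesicAt_of_nhds v.1
      exact ⟨_, mem_nhdsWithin_of_mem_nhds (continuous_subtype_val.continuousAt h), ε, hε,
        fun w hw ↦ hw⟩
  refine ⟨ε, hε, fun R v ↦ ?_⟩
  have hstep : ∀ (k : ℕ) (v : UnitTangentBundle n M), ∃ γ : ℝ → M, velocity n γ 0 = v ∧
      ∀ t ∈ Set.Ioo (-ε) (ε + k * (ε / 2)), IsGeodesicAt n (γ t) γ t := by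
    intro k
    induction k with
    | zero => simpa using hloc
    | succ k ih =>
      intro v
      obtain ⟨γ, h0, hγ⟩ := ih v
      -- The restart takes place `ε / 2` before the end of the interval already covered, so that the
      -- two geodesics overlap.
      set s : ℝ := (k + 1) * (ε / 2) with hs
      have hkε : 0 ≤ (k : ℝ) * (ε / 2) := by positivity
      have hs0 : 0 < s := by positivity
      have hsmem : s ∈ Set.Ioo (-ε) (ε + k * (ε / 2)) := ⟨by linarith, by linarith⟩
      have h0mem : (0 : ℝ) ∈ Set.Ioo (-ε) (ε + k * (ε / 2)) := ⟨by linarith, by linarith⟩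
      obtain ⟨δ, hδ0, hδ⟩ := hloc ⟨velocity n γ s, by
        rw [norm_velocity_eq_of_isGeodesicAt hγ h0mem hsmem, h0]; exact v.2⟩
      have hδ' : ∀ t ∈ Set.Ioo (s - ε) (s + ε),
          IsGeodesicAt n (δ (t + -s)) (fun r ↦ δ (r + -s)) t := fun t ht ↦
        (hδ (t + -s) ⟨by linarith [ht.1], by linarith [ht.2]⟩).comp_add
      have hsδ : s ∈ Set.Ioo (s - ε) (s + ε) := ⟨by linarith, by linarith⟩
      have hvel : velocity n γ s = velocity n (fun r ↦ δ (r + -s)) s := by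
        rw [velocity_comp_add (γ := δ)]
        · rw [add_neg_cancel, hδ0]
        · rw [add_neg_cancel]
          exact (hδ 0 ⟨by linarith, hε⟩).mdifferentiableAt
      obtain ⟨η, h1, h2⟩ := exists_glue ((hγ s hsmem).eventuallyEq (hδ' s hsδ) hvel)
      refine ⟨η, by rw [velocity_congr (h1 0 hs0.le), h0], fun t ht ↦ ?_⟩
      rcases le_total t s with hts | hts
      · exact (hγ t ⟨ht.1, by linarith⟩).congr_self (h1 t hts)
      · refine (hδ' t ⟨by linarith, ?_⟩).congr_self (h2 t hts)
        have := ht.2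
        push_cast at this
        linarith
  obtain ⟨k, hk⟩ := exists_nat_ge (R / (ε / 2))
  obtain ⟨γ, h0, hγ⟩ := hstep k v
  refine ⟨γ, h0, fun t ht ↦ hγ t ⟨ht.1, ht.2.trans_le ?_⟩⟩
  rw [div_le_iff₀ (by positivity)] at hk
  linarith

variable [T2Space M]

/-- Geodesic completeness of compact Riemannian manifolds. -/
lemma exists_forall_isGeodesicAt (v : UnitTangentBundle n M) :
    ∃ γ : ℝ → M, velocity n γ 0 = v ∧ ∀ t, IsGeodesicAt n (γ t) γ t := by
  obtain ⟨ε, hε, hfwd⟩ := exists_isGeodesicAt_forward (n := n) (M := M)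
  -- The past of `v` is the reversed future of `-v`.
  have hsymm : ∀ R > 0, ∃ γ : ℝ → M, velocity n γ 0 = v ∧
      ∀ t ∈ Set.Ioo (-R) R, IsGeodesicAt n (γ t) γ t := by
    intro R hR
    obtain ⟨γ, h0, hγ⟩ := hfwd R v
    obtain ⟨δ, hδ0, hδ⟩ := hfwd R (unitNeg v)
    have h0γ := hγ 0 ⟨by linarith, hR⟩
    have hδ' : ∀ t ∈ Set.Ioo (-R) ε, IsGeodesicAt n (δ (-t)) (fun r ↦ δ (-r)) t := fun t ht ↦
      (hδ (-t) ⟨by linarith [ht.2], by linarith [ht.1]⟩).comp_neg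
    have h0δ := hδ' 0 ⟨by linarith, hε⟩
    have hvel : velocity n (fun r ↦ δ (-r)) 0 = v := by
      have h1 : MDifferentiableAt 𝓘(ℝ, ℝ) (𝓡 n) δ (-0) := by
        rw [neg_zero]
        exact (hδ 0 ⟨by linarith, hR⟩).mdifferentiableAt
      have h2 : velocity n δ (-0) = unitNeg v := by rw [neg_zero, hδ0]
      rw [velocity_comp_neg h1]
      have h3 : (⟨(velocity n δ (-0)).proj, -(velocity n δ (-0)).2⟩ : TangentBundle (𝓡 n) M) =
          v := by
        rw [h2]
        exact congrArg (Bundle.TotalSpace.mk _) (neg_neg _)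
      exact h3
    obtain ⟨η, h1, h2⟩ := exists_glue (h0δ.eventuallyEq h0γ (hvel.trans h0.symm))
    refine ⟨η, by rw [velocity_congr (h2 0 le_rfl), h0], fun t ht ↦ ?_⟩
    rcases le_total t 0 with hts | hts
    · exact (hδ' t ⟨ht.1, by linarith⟩).congr_self (h1 t hts)
    · exact (hγ t ⟨by linarith, ht.2⟩).congr_self (h2 t hts)
  have hpos : ∀ t : ℝ, 0 < |t| + 1 := fun t ↦ by positivity
  have : Nonempty M := ⟨v.1.proj⟩
  choose! Γ hΓ0 hΓ using hsymm
  -- The geodesics on the intervals `(-R, R)` are compatible, so `t ↦ Γ (|t| + 1) t` locally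
  -- coincides with one of them.
  have huniq : ∀ R > 0, ∀ t ∈ Set.Ioo (-R) R, Γ (|t| + 1) t = Γ R t := by
    intro R hR t ht
    have h1 := abs_lt.2 ht
    have hsub1 : Set.Ioo (-min R (|t| + 1)) (min R (|t| + 1)) ⊆ Set.Ioo (-R) R :=
      Set.Ioo_subset_Ioo (neg_le_neg (min_le_left _ _)) (min_le_left _ _)
    have hsub2 : Set.Ioo (-min R (|t| + 1)) (min R (|t| + 1)) ⊆ Set.Ioo (-(|t| + 1)) (|t| + 1) :=
      Set.Ioo_subset_Ioo (neg_le_neg (min_le_right _ _)) (min_le_right _ _)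
    have hmem : t ∈ Set.Ioo (-min R (|t| + 1)) (min R (|t| + 1)) :=
      abs_lt.1 (lt_min h1 (lt_add_one _))
    have h0mem : (0 : ℝ) ∈ Set.Ioo (-min R (|t| + 1)) (min R (|t| + 1)) :=
      ⟨by simpa using ⟨hR, hpos t⟩, lt_min hR (hpos t)⟩
    exact eqOn_of_isGeodesicAt h0mem (fun s hs ↦ hΓ _ (hpos t) s (hsub2 hs))
      (fun s hs ↦ hΓ _ hR s (hsub1 hs)) ((hΓ0 _ (hpos t)).trans (hΓ0 R hR).symm) hmem
  have hev : ∀ t, (fun s ↦ Γ (|s| + 1) s) =ᶠ[𝓝 t] Γ (|t| + 1) := by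
    intro t
    filter_upwards [isOpen_Ioo.mem_nhds (abs_lt.1 (lt_add_one |t|))] with s hs
    exact huniq _ (hpos t) s hs
  refine ⟨fun t ↦ Γ (|t| + 1) t, ?_, fun t ↦ ?_⟩
  · rw [velocity_congr (hev 0), hΓ0 _ (hpos 0)]
  · exact (hΓ _ (hpos t) t (abs_lt.1 (lt_add_one |t|))).congr_self (hev t)

end

/-! ### The geodesic flow: fibres, group law, reversibility -/

section

variable {n : ℕ} {M : Type*} [TopologicalSpace M] [ChartedSpace (EuclideanSpace ℝ (Fin n)) M]
  [Bundle.RiemannianBundle (fun x : M ↦ TangentSpace (𝓡 n) x)]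

variable [IsManifold (𝓡 n) ∞ M]

/-- The set is the whole fibre, a unit sphere, which is connected because the tangent space has
dimension at least two. -/
lemma exists_isPreconnected_fibre (hn : 2 ≤ n) (v : UnitTangentBundle n M) :
    ∃ C : Set (UnitTangentBundle n M), IsPreconnected C ∧ v ∈ C ∧ unitNeg v ∈ C ∧
      ∀ w ∈ C, w.1.proj = v.1.proj := by
  set p := v.1.proj with hp
  have hrank : 1 < Module.rank ℝ (TangentSpace (𝓡 n) p) := by
    have h1 : Module.rank ℝ (TangentSpace (𝓡 n) p) = n :=
      (Module.finrank_eq_rank ℝ (EuclideanSpace ℝ (Fin n))).symm.trans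
        (congrArg Nat.cast finrank_euclideanSpace_fin)
    rw [h1]
    exact_mod_cast hn
  have hsphere : IsPreconnected (Metric.sphere (0 : TangentSpace (𝓡 n) p) 1) :=
    isPreconnected_sphere hrank 0 1
  let f : Metric.sphere (0 : TangentSpace (𝓡 n) p) 1 → UnitTangentBundle n M :=
    fun a ↦ ⟨⟨p, a.1⟩, mem_sphere_zero_iff_norm.1 a.2⟩
  have hf : Continuous f := by
    refine Continuous.subtype_mk ?_ _
    exact (FiberBundle.continuous_totalSpaceMk (EuclideanSpace ℝ (Fin n)) (TangentSpace (𝓡 n))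
      p).comp continuous_subtype_val
  have hpc := isPreconnected_iff_preconnectedSpace.1 hsphere
  refine ⟨Set.range f, isPreconnected_range hf,
    ⟨⟨v.1.2, mem_sphere_zero_iff_norm.2 v.2⟩, rfl⟩,
    ⟨⟨-v.1.2, mem_sphere_zero_iff_norm.2 (unitNeg v).2⟩, rfl⟩, ?_⟩
  rintro _ ⟨a, rfl⟩
  rfl

variable [IsContMDiffRiemannianBundle (𝓡 n) ∞ (EuclideanSpace ℝ (Fin n))
      (fun x : M ↦ TangentSpace (𝓡 n) x)]

lemma christoffel_eq_christoffelForm {x : M} {u : EuclideanSpace ℝ (Fin n)}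
    (hu : u ∈ (extChartAt (𝓡 n) x).target) (a w : EuclideanSpace ℝ (Fin n)) :
    christoffel x u a a w = christoffelForm (metricTensor x) u a w := by
  have hG : HasFDerivAt (metricTensor x) (fderiv ℝ (metricTensor x) u) u :=
    (((isMetricTensor x).contDiffOn.contDiffAt
      ((isMetricTensor x).isOpen.mem_nhds hu)).differentiableAt (by simp)).hasFDerivAt
  have h1 : ∀ a b c : EuclideanSpace ℝ (Fin n), fderiv ℝ (fun z ↦ chartMetric x z a b) u c =
      fderiv ℝ (metricTensor x) u c a b := by
    intro a b c
    have h2 := ((hG.clm_apply (hasFDerivAt_const a u)).clm_apply (hasFDerivAt_const b u)).fderiv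
    have h3 := congrArg (fun f ↦ f c) h2
    refine Eq.trans h3 ?_
    simp
  rw [christoffel, christoffelForm_apply, h1, h1]
  ring

lemma IsGeodesic.isGeodesicAt {γ : ℝ → M} (h : IsGeodesic n γ) (t : ℝ) :
    IsGeodesicAt n (γ t) γ t := by
  set x := γ t with hx
  set c := extChartAt (𝓡 n) x ∘ γ with hc
  have hcont : Continuous γ := h.contMDiff.continuous
  refine ⟨mem_extChartAt_source _, ?_⟩
  filter_upwards [hcont.continuousAt (extChartAt_source_mem_nhds (I := 𝓡 n) x)] with s hs
  have hs' : γ s ∈ (extChartAt (𝓡 n) x).source := hs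
  have hc2 : ContDiffAt ℝ 2 c s := by
    rw [← contMDiffAt_iff_contDiffAt]
    have h1 : ContMDiffAt (𝓡 n) 𝓘(ℝ, EuclideanSpace ℝ (Fin n)) 2 (extChartAt (𝓡 n) x) (γ s) :=
      (contMDiffAt_extChartAt' (n := ∞) (by rwa [extChartAt_source] at hs')).of_le ENat.LEInfty.out
    exact h1.comp s (h.contMDiff s)
  refine ⟨hcont.continuousAt, hc2.differentiableAt (by simp), ?_⟩
  have hd : DifferentiableAt ℝ (deriv c) s := by
    have h1 : ContDiffAt ℝ 1 (fderiv ℝ c) s := hc2.fderiv_right (by norm_num)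
    exact ((h1.differentiableAt (by simp)).clm_apply (differentiableAt_const 1))
  have hu : c s ∈ (extChartAt (𝓡 n) x).target := (extChartAt (𝓡 n) x).map_source hs'
  have h2 : deriv (deriv c) s = spray (metricTensor x) (c s) (deriv c s) := by
    refine (isMetricTensor x).eq_of_forall_apply_eq hu fun w ↦ ?_
    have h3 := h.geodesic_equation x s hs' w
    have h4 := congrArg (fun f ↦ f w) ((isMetricTensor x).apply_spray hu (deriv c s))
    simp only [neg_apply] at h4
    rw [← christoffel_eq_christoffelForm hu] at h4
    have h5 : chartMetric x (c s) (deriv (deriv c) s) w +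
      christoffel x (c s) (deriv c s) (deriv c s) w = 0 := h3
    rw [metricTensor_apply]
    linarith
  exact hd.hasDerivAt.congr_deriv h2

lemma isGeodesic_of_isGeodesicAt {γ : ℝ → M} (h : ∀ t, IsGeodesicAt n (γ t) γ t) :
    IsGeodesic n γ where
  contMDiff := by
    intro t
    set x := γ t with hx
    set c := extChartAt (𝓡 n) x ∘ γ with hc
    have hev : ∀ᶠ s in 𝓝 t, γ s ∈ (extChartAt (𝓡 n) x).source :=
      (h t).continuousAt (extChartAt_source_mem_nhds x)
    obtain ⟨ε, hε, hball⟩ := Metric.eventually_nhds_iff_ball.1 ((h t).2.and hev)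
    have hc2 : ContDiffOn ℝ 2 c (Metric.ball t ε) := by
      rw [show (2 : WithTop ℕ∞) = 1 + 1 by norm_num,
        contDiffOn_succ_iff_deriv_of_isOpen Metric.isOpen_ball]
      refine ⟨fun s hs ↦ (hball s hs).1.2.1.differentiableWithinAt, by simp, ?_⟩
      rw [show (1 : WithTop ℕ∞) = 0 + 1 by norm_num,
        contDiffOn_succ_iff_deriv_of_isOpen Metric.isOpen_ball]
      refine ⟨fun s hs ↦ (hball s hs).1.2.2.differentiableAt.differentiableWithinAt, by simp, ?_⟩
      rw [contDiffOn_zero]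
      intro s hs
      have hu : c s ∈ (extChartAt (𝓡 n) x).target := (extChartAt (𝓡 n) x).map_source (hball s hs).2
      have h1 : ContinuousAt (fun z : EuclideanSpace ℝ (Fin n) × EuclideanSpace ℝ (Fin n) ↦
          spray (metricTensor x) z.1 z.2) (c s, deriv c s) :=
        ((isMetricTensor x).contDiffOn_spray.contDiffAt
          (((isMetricTensor x).isOpen.prod isOpen_univ).mem_nhds ⟨hu, trivial⟩)).continuousAt
      have h2 : ContinuousAt (fun r ↦ (c r, deriv c r)) s :=
        (hball s hs).1.2.1.continuousAt.prodMk (hball s hs).1.2.2.continuousAt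
      have h3 := ContinuousAt.comp (f := fun r ↦ (c r, deriv c r)) h1 h2
      refine (h3.congr ?_).continuousWithinAt
      filter_upwards [Metric.isOpen_ball.mem_nhds hs] with r hr
      exact (hball r hr).1.2.2.deriv.symm
    have h1 : ContMDiffAt 𝓘(ℝ, ℝ) 𝓘(ℝ, EuclideanSpace ℝ (Fin n)) 2 c t :=
      (hc2.contDiffAt (Metric.ball_mem_nhds t hε)).contMDiffAt
    have h2 : ContMDiffAt 𝓘(ℝ, EuclideanSpace ℝ (Fin n)) (𝓡 n) 2 (extChartAt (𝓡 n) x).symm (c t) :=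
      ((contMDiffOn_extChartAt_symm (n := ∞) x).contMDiffAt
        ((isOpen_extChartAt_target x).mem_nhds (mem_extChartAt_target x))).of_le ENat.LEInfty.out
    refine (h2.comp t h1).congr_of_eventuallyEq ?_
    filter_upwards [hev] with s hs
    exact ((extChartAt (𝓡 n) x).left_inv hs).symm
  geodesic_equation := by
    intro x t ht w c
    have h1 := (h t).change_chart x ht
    have hu : c t ∈ (extChartAt (𝓡 n) x).target := (extChartAt (𝓡 n) x).map_source ht
    have h2 : deriv (deriv c) t = spray (metricTensor x) (c t) (deriv c t) :=
      h1.2.self_of_nhds.2.2.deriv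
    have h4 := congrArg (fun f ↦ f w) ((isMetricTensor x).apply_spray hu (deriv c t))
    simp only [neg_apply] at h4
    rw [h2, christoffel_eq_christoffelForm hu, ← metricTensor_apply, h4]
    ring

variable [T2Space M]

lemma eq_of_velocity_eq {γ₁ γ₂ : ℝ → M} (h₁ : ∀ t, IsGeodesicAt n (γ₁ t) γ₁ t)
    (h₂ : ∀ t, IsGeodesicAt n (γ₂ t) γ₂ t) {t₀ : ℝ} (h : velocity n γ₁ t₀ = velocity n γ₂ t₀) :
    γ₁ = γ₂ := by
  funext t
  have hmem : ∀ s, |s| ≤ |t| + |t₀| → s ∈ Set.Ioo (-(|t| + |t₀| + 1)) (|t| + |t₀| + 1) :=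
    fun s hs ↦ abs_lt.1 (hs.trans_lt (lt_add_one _))
  exact eqOn_of_isGeodesicAt (hmem t₀ (by simp)) (fun s _ ↦ h₁ s) (fun s _ ↦ h₂ s) h
    (hmem t (by simp))

/-- Uniqueness of geodesics removes the choice of an orbit from the definition of the flow. -/
lemma geodesicFlow_eq_velocity {γ : ℝ → M} (h : ∀ t, IsGeodesicAt n (γ t) γ t)
    {v : UnitTangentBundle n M} (hv : velocity n γ 0 = v) (t : ℝ) :
    (geodesicFlow n M t v : TangentBundle (𝓡 n) M) = velocity n γ t := by
  have hunit : ∀ t, ‖(velocity n γ t).2‖ = 1 := by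
    intro t
    have hmem : ∀ s, |s| ≤ |t| → s ∈ Set.Ioo (-(|t| + 1)) (|t| + 1) :=
      fun s hs ↦ abs_lt.1 (hs.trans_lt (lt_add_one _))
    rw [norm_velocity_eq_of_isGeodesicAt (fun s _ ↦ h s) (hmem 0 (by simp)) (hmem t le_rfl), hv]
    exact v.2
  have hex : ∃ w : ℝ → UnitTangentBundle n M, IsGeodesicOrbit w ∧ w 0 = v :=
    ⟨fun t ↦ ⟨velocity n γ t, hunit t⟩, ⟨γ, isGeodesic_of_isGeodesicAt h, fun t ↦ rfl⟩,
      Subtype.ext hv⟩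
  rw [geodesicFlow, dif_pos hex]
  obtain ⟨⟨δ, hδ, hδw⟩, hδ0⟩ := hex.choose_spec
  rw [hδw t]
  have h0 : velocity n δ 0 = velocity n γ 0 := by rw [← hδw 0, hδ0, hv]
  rw [eq_of_velocity_eq hδ.isGeodesicAt h h0]

variable [CompactSpace M]

lemma exists_geodesic_of_unit (v : UnitTangentBundle n M) :
    ∃ γ : ℝ → M, (∀ t, IsGeodesicAt n (γ t) γ t) ∧ velocity n γ 0 = v ∧
      ∀ t, (geodesicFlow n M t v : TangentBundle (𝓡 n) M) = velocity n γ t := by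
  obtain ⟨γ, h0, hγ⟩ := exists_forall_isGeodesicAt v
  exact ⟨γ, hγ, h0, geodesicFlow_eq_velocity hγ h0⟩

lemma geodesicFlow_zero (v : UnitTangentBundle n M) : geodesicFlow n M 0 v = v := by
  obtain ⟨γ, -, h0, h⟩ := exists_geodesic_of_unit v
  exact Subtype.ext ((h 0).trans h0)

lemma geodesicFlow_add (s t : ℝ) (v : UnitTangentBundle n M) :
    geodesicFlow n M (s + t) v = geodesicFlow n M s (geodesicFlow n M t v) := by
  obtain ⟨γ, hγ, h0, h⟩ := exists_geodesic_of_unit v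
  have h1 : ∀ r, velocity n (fun s ↦ γ (s + t)) r = velocity n γ (r + t) := fun r ↦
    velocity_comp_add (hγ (r + t)).mdifferentiableAt
  refine Subtype.ext ?_
  rw [h, geodesicFlow_eq_velocity (γ := fun s ↦ γ (s + t)) (fun r ↦ (hγ (r + t)).comp_add)
    (by rw [h1, zero_add, h]), h1]

/-- The geodesic starting at the opposite of `γ'(t)` is `s ↦ γ (t - s)`; at time `t` it has velocity
`-γ'(0)`. -/
lemma geodesicFlow_unitNeg (t : ℝ) (v : UnitTangentBundle n M) :
    geodesicFlow n M t (unitNeg (geodesicFlow n M t v)) = unitNeg v := by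
  obtain ⟨γ, hγ, h0, h⟩ := exists_geodesic_of_unit v
  have hneg : ∀ (w : UnitTangentBundle n M) (r : ℝ), (w : TangentBundle (𝓡 n) M) = velocity n γ r →
      (unitNeg w : TangentBundle (𝓡 n) M) = ⟨γ r, -(velocity n γ r).2⟩ := by
    rintro ⟨w, hw⟩ r rfl
    rfl
  set δ : ℝ → M := fun s ↦ γ (-(s + -t)) with hδ
  have hγ' : ∀ r, IsGeodesicAt n (γ (-r)) (fun s ↦ γ (-s)) r := fun r ↦ (hγ (-r)).comp_neg
  have h1 : ∀ r, velocity n δ r = ⟨γ (-(r + -t)), -(velocity n γ (-(r + -t))).2⟩ := fun r ↦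
    (velocity_comp_add (γ := fun s ↦ γ (-s)) (hγ' (r + -t)).mdifferentiableAt).trans
      (velocity_comp_neg (hγ (-(r + -t))).mdifferentiableAt)
  have h2 : ∀ r s, -(r + -t) = s → velocity n δ r = ⟨γ s, -(velocity n γ s).2⟩ := by
    rintro r _ rfl
    exact h1 r
  refine Subtype.ext ?_
  rw [geodesicFlow_eq_velocity (γ := δ)
    (fun r ↦ IsGeodesicAt.comp_add (γ := fun s ↦ γ (-s)) (hγ' (r + -t))) ?_ t]
  · rw [h2 t 0 (by ring), hneg v 0 h0.symm]
  · rw [h2 0 t (by ring), hneg _ t (h t)]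

end

/-! ### Isometric curves solve the geodesic equation in coordinates -/

section

/-- Division by `h ^ 2` turns the cubic error into `C * h`, while the difference quotients tend to
`v`. -/
lemma apply_deriv_eq_one {E : Type*} [NormedAddCommGroup E] [NormedSpace ℝ E]
    {G : E → E →L[ℝ] E →L[ℝ] ℝ} {C : ℝ} {e : ℝ → E} {t : ℝ} {v : E}
    (hv : HasDerivAt e v t)
    (hD : ∀ᶠ h in 𝓝[>] (0 : ℝ),
      |h ^ 2 - G (e t) (e (t + h) - e t) (e (t + h) - e t)| ≤ C * h ^ 3) :
    G (e t) v v = 1 := by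
  have h1 : Tendsto (fun h : ℝ ↦ h⁻¹ • (e (t + h) - e t)) (𝓝[>] 0) (𝓝 v) :=
    hv.tendsto_slope_zero_right
  have h2 : Tendsto (fun h : ℝ ↦ G (e t) (h⁻¹ • (e (t + h) - e t)) (h⁻¹ • (e (t + h) - e t)))
      (𝓝[>] 0) (𝓝 (G (e t) v v)) :=
    ((by fun_prop : Continuous fun a ↦ G (e t) a a).tendsto v).comp h1
  have h3 : Tendsto (fun h : ℝ ↦ G (e t) (h⁻¹ • (e (t + h) - e t)) (h⁻¹ • (e (t + h) - e t)))
      (𝓝[>] 0) (𝓝 1) := by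
    rw [tendsto_iff_dist_tendsto_zero]
    have h4 : Tendsto (fun h : ℝ ↦ C * h) (𝓝[>] 0) (𝓝 0) := by
      have : Tendsto (fun h : ℝ ↦ C * h) (𝓝 0) (𝓝 (C * 0)) := (continuous_const_mul C).tendsto 0
      rw [mul_zero] at this
      exact this.mono_left nhdsWithin_le_nhds
    refine squeeze_zero' (Eventually.of_forall fun _ ↦ dist_nonneg) ?_ h4
    filter_upwards [hD, self_mem_nhdsWithin] with h hh hpos
    have hpos' : 0 < h := hpos
    rw [dist_comm, Real.dist_eq]
    simp only [map_smul, smul_apply, smul_eq_mul]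
    have h5 : 1 - h⁻¹ * (h⁻¹ * G (e t) (e (t + h) - e t) (e (t + h) - e t)) =
        (h ^ 2 - G (e t) (e (t + h) - e t) (e (t + h) - e t)) / h ^ 2 := by field_simp
    rw [h5, abs_div, abs_of_pos (by positivity : 0 < h ^ 2), div_le_iff₀ (by positivity)]
    linarith
  exact tendsto_nhds_unique h2 h3

namespace IsMetricTensor

variable {E : Type*} [NormedAddCommGroup E] [NormedSpace ℝ E]
  {G : E → E →L[ℝ] E →L[ℝ] ℝ} {O : Set E}

lemma parallelogram (hG : IsMetricTensor G O) {u : E} (hu : u ∈ O) (a b : E) :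
    G u (a + b) (a + b) = 2 * G u a a + 2 * G u b b - G u (b - a) (b - a) := by
  have := hG.symm u hu a b
  simp only [map_add, map_sub, add_apply, sub_apply]
  linarith

/-- A curve which is isometric for a distance that is given by the metric tensor to second order
has second differences of order `h ^ (3 / 2)`. -/
lemma norm_second_difference_le (hG : IsMetricTensor G O) {D : E → E → ℝ} {B : Set E} (hBO : B ⊆ O)
    {m C K : ℝ} (hm : 0 < m) (hC : 0 ≤ C) (hK : 0 ≤ K)
    (hlow : ∀ u ∈ B, ∀ a, m * ‖a‖ ^ 2 ≤ G u a a)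
    (hlip : ∀ u ∈ B, ∀ u' ∈ B, ∀ a, |G u a a - G u' a a| ≤ K * ‖u - u'‖ * ‖a‖ ^ 2)
    (hDlow : ∀ u ∈ B, ∀ u' ∈ B, m * ‖u' - u‖ ^ 2 ≤ D u u' ^ 2)
    (hD : ∀ u ∈ B, ∀ u' ∈ B, |D u u' ^ 2 - G u (u' - u) (u' - u)| ≤ C * ‖u' - u‖ ^ 3)
    {p q r : E} (hp : p ∈ B) (hq : q ∈ B) (hr : r ∈ B) {h : ℝ} (hh : 0 < h)
    (hqp : D q p = h) (hqr : D q r = h) (hpr : D p r = 2 * h) :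
    ‖r - (2 : ℝ) • q + p‖ ≤ √((12 * C + 4 * K) * √(1 / m) ^ 3 / m) * (h * √h) := by
  set A := √(1 / m) with hA
  have hA0 : 0 ≤ A := Real.sqrt_nonneg _
  have hA2 : A ^ 2 = 1 / m := Real.sq_sqrt (by positivity)
  have hnorm : ∀ u ∈ B, ∀ u' ∈ B, ∀ d, 0 ≤ d → D u u' = d → ‖u' - u‖ ≤ A * d := by
    intro u hu u' hu' d hd0 hd
    refine abs_le_of_sq_le_sq' ?_ (by positivity) |>.2
    rw [mul_pow, hA2, one_div, inv_mul_eq_div, le_div_iff₀ hm, ← hd, mul_comm]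
    exact hDlow u hu u' hu'
  set a := p - q with ha
  set b := r - q with hb
  have hna : ‖a‖ ≤ A * h := hnorm q hq p hp h hh.le hqp
  have hnb : ‖b‖ ≤ A * h := hnorm q hq r hr h hh.le hqr
  have hba : b - a = r - p := by rw [ha, hb]; abel
  have hnba : ‖b - a‖ ≤ A * (2 * h) := by
    rw [hba]; exact hnorm p hp r hr _ (by positivity) hpr
  have h1 := (abs_le.1 (hD q hq p hp)).1
  have h2 := (abs_le.1 (hD q hq r hr)).1
  have h3 := (abs_le.1 (hD p hp r hr)).2
  have h4 := (abs_le.1 (hlip p hp q hq (b - a))).2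
  rw [hqp] at h1
  rw [hqr] at h2
  rw [hpr, ← hba] at h3
  rw [← ha] at h1 h4
  rw [← hb] at h2
  have e1 : C * ‖a‖ ^ 3 ≤ C * (A * h) ^ 3 := by gcongr
  have e2 : C * ‖b‖ ^ 3 ≤ C * (A * h) ^ 3 := by gcongr
  have e3 : C * ‖b - a‖ ^ 3 ≤ C * (A * (2 * h)) ^ 3 := by gcongr
  have e4 : K * ‖a‖ * ‖b - a‖ ^ 2 ≤ K * (A * h) * (A * (2 * h)) ^ 2 := by gcongr
  -- In the parallelogram law for `a` and `b` the leading terms `2 * h ^ 2 + 2 * h ^ 2 - (2 * h) ^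
  -- 2` cancel. Errors of order `h ^ 3` remain, from comparing the distance with `G` and from moving
  -- the base point of `b - a` from `p` to `q`.
  have h5 := hlow q hq (a + b)
  rw [hG.parallelogram (hBO hq)] at h5
  have h6 : m * ‖a + b‖ ^ 2 ≤ (12 * C + 4 * K) * A ^ 3 * h ^ 3 := by nlinarith
  have h7 : r - (2 : ℝ) • q + p = a + b := by
    rw [ha, hb, two_smul]; abel
  rw [h7]
  refine abs_le_of_sq_le_sq' ?_ (by positivity) |>.2
  rw [mul_pow, mul_pow, Real.sq_sqrt (by positivity), Real.sq_sqrt hh.le, div_mul_eq_mul_div,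
    le_div_iff₀ hm]
  nlinarith

variable [FiniteDimensional ℝ E]

/-- A curve which is isometric for a distance that is given by the metric tensor to second order
and bounded by the length of curves is a geodesic of unit speed. -/
lemma hasDerivAt_spray_of_isometric (hG : IsMetricTensor G O) {D : E → E → ℝ} {B : Set E}
    (hB : IsOpen B) (hBO : B ⊆ O) {m C K : ℝ} (hm : 0 < m) (hC : 0 ≤ C) (hK : 0 ≤ K)
    (hlow : ∀ u ∈ B, ∀ a, m * ‖a‖ ^ 2 ≤ G u a a)
    (hlip : ∀ u ∈ B, ∀ u' ∈ B, ∀ a, |G u a a - G u' a a| ≤ K * ‖u - u'‖ * ‖a‖ ^ 2)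
    (hDlow : ∀ u ∈ B, ∀ u' ∈ B, m * ‖u' - u‖ ^ 2 ≤ D u u' ^ 2)
    (hD : ∀ u ∈ B, ∀ u' ∈ B, |D u u' ^ 2 - G u (u' - u) (u' - u)| ≤ C * ‖u' - u‖ ^ 3)
    (hlen : ∀ (α β : ℝ) (c c' : ℝ → E) (f : ℝ → ℝ), α < β → Continuous c' →
      (∀ t, HasDerivAt c (c' t) t) → (∀ t ∈ Set.Icc α β, c t ∈ B) → ContinuousOn f (Set.Icc α β) →
      (∀ t ∈ Set.Icc α β, 0 ≤ f t ∧ G (c t) (c' t) (c' t) ≤ f t ^ 2) →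
      D (c α) (c β) ≤ ∫ t in α..β, f t)
    {e : ℝ → E} {t₀ η : ℝ} (hη : 0 < η) (he : ContinuousOn e (Set.Icc (t₀ - η) (t₀ + η)))
    (heB : ∀ t ∈ Set.Icc (t₀ - η) (t₀ + η), e t ∈ B)
    (hiso : ∀ s ∈ Set.Icc (t₀ - η) (t₀ + η), ∀ t ∈ Set.Icc (t₀ - η) (t₀ + η),
      D (e s) (e t) = |s - t|) :
    ∃ e' : ℝ → E, ∀ᶠ t in 𝓝 t₀, HasDerivAt e (e' t) t ∧
      HasDerivAt e' (spray G (e t) (e' t)) t ∧ G (e t) (e' t) (e' t) = 1 := by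
  have hηle : t₀ - η ≤ t₀ + η := by linarith
  set κ : ℝ → E := fun t ↦ e (Set.projIcc (t₀ - η) (t₀ + η) hηle t) with hκ
  have hκe : ∀ t ∈ Set.Icc (t₀ - η) (t₀ + η), κ t = e t := fun t ht ↦ by
    rw [hκ]
    simp only [Set.projIcc_of_mem hηle ht]
  have hκcont : Continuous κ :=
    (continuousOn_iff_continuous_domRestrict.1 he).comp continuous_projIcc
  set A := √(1 / m) with hA
  have hmem : ∀ {t : ℝ}, |t - t₀| ≤ η → t ∈ Set.Icc (t₀ - η) (t₀ + η) := fun h ↦ by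
    rw [abs_le] at h
    exact ⟨by linarith [h.1], by linarith [h.2]⟩
  -- If `|t - t₀| < 2 * ρ` and `|h| < ρ`, then `t + h` is still in the interval on which the curve
  -- is isometric.
  set ρ := η / 3 with hρ
  have hρ0 : 0 < ρ := by positivity
  have htri : ∀ {t h : ℝ}, |t - t₀| < 2 * ρ → |h| < ρ → t + h ∈ Set.Icc (t₀ - η) (t₀ + η) := by
    intro t h ht hh
    refine hmem ?_
    have := abs_add_le (t - t₀) h
    rw [show t + h - t₀ = (t - t₀) + h by ring]
    linarith
  obtain ⟨v, hvcont, hv⟩ := exists_hasDerivAt_of_second_difference (t₀ := t₀)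
    (C := √((12 * C + 4 * K) * A ^ 3 / m)) hκcont hρ0 (by
      intro t h ht hh0 hh
      have m0 := htri ht (h := 0) (by simpa using hρ0)
      have m1 := htri ht (h := h) (by rwa [abs_of_pos hh0])
      have m2 := htri ht (h := -h) (by rwa [abs_neg, abs_of_pos hh0])
      rw [add_zero] at m0
      rw [← sub_eq_add_neg] at m2
      rw [hκe _ m0, hκe _ m1, hκe _ m2]
      refine hG.norm_second_difference_le hBO hm hC hK hlow hlip hDlow hD (heB _ m2) (heB _ m0)
        (heB _ m1) hh0 ?_ ?_ ?_
      · rw [hiso _ m0 _ m2, show t - (t - h) = h by ring, abs_of_pos hh0]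
      · rw [hiso _ m0 _ m1, show t - (t + h) = -h by ring, abs_neg, abs_of_pos hh0]
      · rw [hiso _ m2 _ m1, show t - h - (t + h) = -(2 * h) by ring, abs_neg,
          abs_of_pos (by positivity)])
  have hA0 : 0 ≤ A := Real.sqrt_nonneg _
  have hA2 : A ^ 2 = 1 / m := Real.sq_sqrt (by positivity)
  have hball : ∀ {t}, t ∈ Metric.ball t₀ ρ → |t - t₀| < 2 * ρ := fun {t} ht ↦ by
    rw [Metric.mem_ball, Real.dist_eq] at ht
    linarith
  have hone : ∀ t ∈ Metric.ball t₀ ρ, G (κ t) (v t) (v t) = 1 := by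
    intro t ht
    have m0 : t ∈ Set.Icc (t₀ - η) (t₀ + η) := by
      simpa using htri (hball ht) (h := 0) (by simpa using hρ0)
    refine apply_deriv_eq_one (C := C * A ^ 3) (hv t ht) ?_
    filter_upwards [Ioo_mem_nhdsGT hρ0] with h hh
    have m1 := htri (hball ht) (h := h) (by rw [abs_of_pos hh.1]; exact hh.2)
    rw [hκe _ m0, hκe _ m1]
    have h1 : D (e t) (e (t + h)) = h := by
      rw [hiso _ m0 _ m1, show t - (t + h) = -h by ring, abs_neg, abs_of_pos hh.1]
    have h2 := hD _ (heB _ m0) _ (heB _ m1)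
    have h3 : ‖e (t + h) - e t‖ ≤ A * h := by
      refine abs_le_of_sq_le_sq' ?_ (mul_nonneg hA0 hh.1.le) |>.2
      rw [mul_pow, hA2, one_div, inv_mul_eq_div, le_div_iff₀ hm, mul_comm]
      have := hDlow _ (heB _ m0) _ (heB _ m1)
      rwa [h1] at this
    rw [h1] at h2
    refine h2.trans ?_
    have h4 : C * ‖e (t + h) - e t‖ ^ 3 ≤ C * (A * h) ^ 3 := by gcongr
    linarith [mul_pow A h 3]
  set α := t₀ - ρ / 2 with hα
  set β := t₀ + ρ / 2 with hβ
  have hαβ : α < β := by rw [hα, hβ]; linarith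
  have hsub : Set.Icc α β ⊆ Metric.ball t₀ ρ := by
    intro t ht
    rw [Real.ball_eq_Ioo]
    exact ⟨by linarith [ht.1], by linarith [ht.2]⟩
  have hsubη : Set.Icc α β ⊆ Set.Icc (t₀ - η) (t₀ + η) := fun t ht ↦
    ⟨by linarith [ht.1], by linarith [ht.2]⟩
  -- The variational lemma asks for a `C¹` curve on all of `ℝ`: the velocity is frozen outside `[α,
  -- β]`, and `c` is its primitive.
  set c' : ℝ → E := fun t ↦ v (Set.projIcc α β hαβ.le t) with hc'
  have hc'v : ∀ t ∈ Set.Icc α β, c' t = v t := fun t ht ↦ by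
    rw [hc']
    simp only [Set.projIcc_of_mem hαβ.le ht]
  have hc'cont : Continuous c' :=
    (continuousOn_iff_continuous_domRestrict.1 (hvcont.mono hsub)).comp continuous_projIcc
  set c : ℝ → E := fun t ↦ κ t₀ + ∫ s in t₀..t, c' s with hc
  have hcder : ∀ t, HasDerivAt c (c' t) t := fun t ↦
    (hc'cont.integral_hasStrictDerivAt t₀ t).hasDerivAt.const_add _
  have ht₀ : t₀ ∈ Set.Icc α β := ⟨by rw [hα]; linarith, by rw [hβ]; linarith⟩
  have hcκ : ∀ t ∈ Set.Icc α β, c t = κ t := by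
    intro t ht
    have hsub' : Set.uIcc t₀ t ⊆ Set.Icc α β := Set.uIcc_subset_Icc ht₀ ht
    have h1 : ∫ s in t₀..t, c' s = κ t - κ t₀ :=
      intervalIntegral.integral_eq_sub_of_hasDerivAt
        (fun s hs ↦ by rw [hc'v s (hsub' hs)]; exact hv s (hsub (hsub' hs)))
        (hc'cont.intervalIntegrable _ _)
    rw [hc]
    simp only [h1]
    abel
  have hce : ∀ t ∈ Set.Icc α β, c t = e t := fun t ht ↦ by rw [hcκ t ht, hκe t (hsubη ht)]
  have hcB : ∀ t ∈ Set.Icc α β, c t ∈ B := fun t ht ↦ by rw [hce t ht]; exact heB t (hsubη ht)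
  have hGone : ∀ t ∈ Set.Icc α β, G (c t) (c' t) (c' t) = 1 := fun t ht ↦ by
    rw [hcκ t ht, hc'v t ht, hone t (hsub ht)]
  have hccont : Continuous c := continuous_iff_continuousAt.2 fun t ↦ (hcder t).continuousAt
  have hGcont : ContinuousOn G B := hG.contDiffOn.continuousOn.mono hBO
  have hgeo := hG.hasDerivAt_spray_of_minimizer hαβ hc'cont hcder (fun t ht ↦ hBO (hcB t ht)) (by
    intro ψ ψ' hψ' hψ hψα hψβ w
    have hψcont : Continuous ψ := continuous_iff_continuousAt.2 fun t ↦ (hψ t).continuousAt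
    have hev : ∀ᶠ ε in 𝓝 (0 : ℝ), ∀ t ∈ Set.Icc α β, c t + ε • ψ t • w ∈ B := by
      refine isCompact_Icc.eventually_forall_of_forall_eventually fun t ht ↦ ?_
      have h1 : Continuous fun z : ℝ × ℝ ↦ c z.2 + z.1 • ψ z.2 • w := by fun_prop
      exact h1.continuousAt (hB.mem_nhds (by simpa using hcB t ht))
    filter_upwards [hev] with ε hε
    have hI : ∫ t in α..β, G (c t) (c' t) (c' t) = β - α := by
      rw [intervalIntegral.integral_congr (g := fun _ ↦ (1 : ℝ))
        (fun t ht ↦ hGone t (by rwa [Set.uIcc_of_le hαβ.le] at ht))]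
      simp
    rw [hI]
    set g : ℝ → ℝ := fun t ↦ G (c t + ε • ψ t • w) (c' t + ε • ψ' t • w) (c' t + ε • ψ' t • w)
      with hg
    have hgcont : ContinuousOn g (Set.Icc α β) := by
      have h1 : ContinuousOn (fun t ↦ G (c t + ε • ψ t • w)) (Set.Icc α β) :=
        hGcont.comp (by fun_prop) hε
      have h2 : ContinuousOn (fun t ↦ c' t + ε • ψ' t • w) (Set.Icc α β) := by fun_prop
      exact (h1.clm_apply h2).clm_apply h2
    have hg0 : ∀ t ∈ Set.Icc α β, 0 ≤ g t := fun t ht ↦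
      (by positivity : 0 ≤ m * ‖c' t + ε • ψ' t • w‖ ^ 2).trans (hlow _ (hε t ht) _)
    -- Bounding the speed `√g` by `(g + 1) / 2` turns the minimality of length into that of energy,
    -- since the energy density of `c` itself is `1`.
    have h2 := hlen α β (fun t ↦ c t + ε • ψ t • w) (fun t ↦ c' t + ε • ψ' t • w)
      (fun t ↦ (g t + 1) / 2) hαβ (by fun_prop)
      (fun t ↦ (hcder t).add (((hψ t).smul_const w).const_smul ε)) hε
      ((hgcont.add continuousOn_const).div_const _) (fun t ht ↦
        ⟨by linarith [hg0 t ht], by nlinarith [sq_nonneg (g t - 1)]⟩)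
    have h3 : D (c α) (c β) = β - α := by
      have hαm : α ∈ Set.Icc α β := ⟨le_rfl, hαβ.le⟩
      have hβm : β ∈ Set.Icc α β := ⟨hαβ.le, le_rfl⟩
      rw [hce α hαm, hce β hβm, hiso α (hsubη hαm) β (hsubη hβm), abs_sub_comm,
        abs_of_pos (by linarith)]
    simp only [hψα, hψβ, zero_smul, smul_zero, add_zero, h3] at h2
    have hgint : IntervalIntegrable g MeasureTheory.volume α β :=
      ContinuousOn.intervalIntegrable (by rwa [Set.uIcc_of_le hαβ.le])
    rw [intervalIntegral.integral_div, intervalIntegral.integral_add hgint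
      intervalIntegrable_const, intervalIntegral.integral_const, smul_eq_mul, mul_one] at h2
    linarith)
  refine ⟨c', ?_⟩
  have hnhds : Set.Ioo α β ∈ 𝓝 t₀ := Ioo_mem_nhds (by rw [hα]; linarith) (by rw [hβ]; linarith)
  filter_upwards [hnhds, eventually_mem_nhds_iff.2 hnhds] with t ht ht'
  have htI := Set.Ioo_subset_Icc_self ht
  refine ⟨(hcder t).congr_of_eventuallyEq ?_, ?_, ?_⟩
  · filter_upwards [ht'] with s hs using (hce s (Set.Ioo_subset_Icc_self hs)).symm
  · rw [← hce t htI]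
    exact hgeo t ht
  · rw [← hce t htI]
    exact hGone t htI

end IsMetricTensor

end

/-! ### The Riemannian distance in a chart: upper and lower bounds -/

section

/-- Cauchy–Schwarz, from the nonnegativity of `G u` on `G u b b • a - G u a b • b`. -/
lemma IsMetricTensor.sq_apply_le {E : Type*} [NormedAddCommGroup E] [NormedSpace ℝ E]
    {G : E → E →L[ℝ] E →L[ℝ] ℝ} {O : Set E} (hG : IsMetricTensor G O) {u : E} (hu : u ∈ O)
    (a b : E) : G u a b ^ 2 ≤ G u a a * G u b b := by
  rcases eq_or_ne b 0 with rfl | hb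
  · simp
  have hpos := hG.pos u hu b hb
  have h1 : 0 ≤ G u (G u b b • a - G u a b • b) (G u b b • a - G u a b • b) := by
    rcases eq_or_ne (G u b b • a - G u a b • b) 0 with h | h
    · simp [h]
    · exact (hG.pos u hu _ h).le
  have h2 := hG.symm u hu a b
  simp only [map_sub, map_smul, sub_apply, smul_apply, smul_eq_mul, ← h2] at h1
  have h3 : 0 ≤ G u b b * (G u a a * G u b b - G u a b ^ 2) := by linarith
  linarith [nonneg_of_mul_nonneg_right h3 hpos]

section

variable {n : ℕ} {M : Type*} [TopologicalSpace M] [ChartedSpace (EuclideanSpace ℝ (Fin n)) M]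
  [Bundle.RiemannianBundle (fun x : M ↦ TangentSpace (𝓡 n) x)]

variable (n) in
/-- The Riemannian distance, truncated at `1`. -/
noncomputable def truncDist (x y : M) : ℝ := (min 1 (Manifold.riemannianEDist (𝓡 n) x y)).toReal

lemma truncDist_le {x y : M} {r : ℝ} (hr : 0 ≤ r)
    (h : Manifold.riemannianEDist (𝓡 n) x y ≤ ENNReal.ofReal r) : truncDist n x y ≤ r :=
  ENNReal.toReal_le_of_le_ofReal hr ((min_le_right _ _).trans h)

lemma riemannianEDist_lt_of_truncDist_lt {x y : M} {r : ℝ} (hr : r ≤ 1)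
    (h : truncDist n x y < r) : Manifold.riemannianEDist (𝓡 n) x y < ENNReal.ofReal r := by
  have h1 : min 1 (Manifold.riemannianEDist (𝓡 n) x y) < ENNReal.ofReal r := by
    rw [← ENNReal.ofReal_toReal (a := min 1 (Manifold.riemannianEDist (𝓡 n) x y))
      (ne_top_of_le_ne_top ENNReal.one_ne_top (min_le_left _ _))]
    exact (ENNReal.ofReal_lt_ofReal_iff_of_nonneg ENNReal.toReal_nonneg).2 h
  rcases min_lt_iff.1 h1 with h2 | h2
  · exact absurd h2 (not_lt.2 (by simpa using hr))
  · exact h2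

lemma le_truncDist {x y : M} {r : ℝ} (hr : r ≤ 1)
    (h : ENNReal.ofReal r ≤ Manifold.riemannianEDist (𝓡 n) x y) : r ≤ truncDist n x y := by
  by_contra! hlt
  exact absurd (riemannianEDist_lt_of_truncDist_lt hr hlt) (not_lt.2 h)

variable [IsManifold (𝓡 n) ∞ M]

lemma norm_velocity_sq (x : M) {γ : ℝ → M} {t : ℝ} (hγ : ContinuousAt γ t)
    (ht : γ t ∈ (extChartAt (𝓡 n) x).source) {a : EuclideanSpace ℝ (Fin n)}
    (ha : HasDerivAt (extChartAt (𝓡 n) x ∘ γ) a t) :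
    ‖(velocity n γ t).2‖ ^ 2 = metricTensor x (extChartAt (𝓡 n) x (γ t)) a a := by
  have h1 := mdifferentiableAt_of_chart x hγ ht ha.differentiableAt
  have h2 := norm_sq_eq_metricTensor (x := x) (v := velocity n γ t) ht
  rw [tangentCoord_velocity x h1 ht, ha.deriv] at h2
  exact h2

/-- The Riemannian distance is bounded by the length of curves in a chart. -/
lemma riemannianEDist_le_integral (x : M) {α β : ℝ} (hαβ : α ≤ β)
    {c c' : ℝ → EuclideanSpace ℝ (Fin n)} {f : ℝ → ℝ} (hc' : Continuous c')
    (hc : ∀ t, HasDerivAt c (c' t) t) (hcO : ∀ t ∈ Set.Icc α β, c t ∈ (extChartAt (𝓡 n) x).target)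
    (hf : ContinuousOn f (Set.Icc α β))
    (hcf : ∀ t ∈ Set.Icc α β, 0 ≤ f t ∧ metricTensor x (c t) (c' t) (c' t) ≤ f t ^ 2) :
    Manifold.riemannianEDist (𝓡 n) ((extChartAt (𝓡 n) x).symm (c α))
      ((extChartAt (𝓡 n) x).symm (c β)) ≤ ENNReal.ofReal (∫ t in α..β, f t) := by
  have hcC1 : ContDiff ℝ 1 c := by
    rw [contDiff_one_iff_deriv]
    exact ⟨fun t ↦ (hc t).differentiableAt, by rwa [funext fun t ↦ (hc t).deriv]⟩
  have hccont : Continuous c := hcC1.continuous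
  set γ : ℝ → M := (extChartAt (𝓡 n) x).symm ∘ c with hγ
  have hγC1 : ContMDiffOn 𝓘(ℝ, ℝ) (𝓡 n) 1 γ (Set.Icc α β) :=
    (contMDiffOn_extChartAt_symm x).comp hcC1.contMDiff.contMDiffOn hcO
  refine (Manifold.riemannianEDist_le_pathELength hγC1 rfl rfl hαβ).trans ?_
  rw [Manifold.pathELength_eq_lintegral_mfderiv_Icc]
  have hfi : MeasureTheory.IntegrableOn f (Set.Icc α β) := hf.integrableOn_Icc
  rw [intervalIntegral.integral_of_le hαβ, ← MeasureTheory.integral_Icc_eq_integral_Ioc,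
    MeasureTheory.ofReal_integral_eq_lintegral_ofReal hfi]
  · refine MeasureTheory.setLIntegral_mono' measurableSet_Icc fun t ht ↦ ?_
    have hright : ∀ᶠ s in 𝓝 t, extChartAt (𝓡 n) x (γ s) = c s := by
      filter_upwards [hccont.continuousAt
          ((isOpen_extChartAt_target x).mem_nhds (hcO t ht))] with s hs
      exact (extChartAt (𝓡 n) x).right_inv hs
    have h1 := norm_velocity_sq (n := n) x (γ := γ) (t := t)
      ((continuousAt_extChartAt_symm'' (hcO t ht)).comp hccont.continuousAt)
      ((extChartAt (𝓡 n) x).map_target (hcO t ht)) ((hc t).congr_of_eventuallyEq hright)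
    rw [hright.self_of_nhds] at h1
    have h2 : ‖(velocity n γ t).2‖ ≤ f t := by
      refine abs_le_of_sq_le_sq' ?_ (hcf t ht).1 |>.2
      rw [h1]
      exact (hcf t ht).2
    rw [← ofReal_norm]
    exact ENNReal.ofReal_le_ofReal h2
  · filter_upwards [MeasureTheory.ae_restrict_mem measurableSet_Icc] with t ht using (hcf t ht).1

variable [IsContMDiffRiemannianBundle (𝓡 n) ∞ (EuclideanSpace ℝ (Fin n))
      (fun x : M ↦ TangentSpace (𝓡 n) x)]

/-- A calibration argument: the constant linear form `√lam / √S * G_u(w, ·)` is bounded by the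
speed, by Cauchy–Schwarz at `u` and `hcomp`, and its integral along the curve depends on the
endpoints only. -/
lemma le_pathELength_of_mem_closedBall (x : M) {γ : ℝ → M} (hγ : ContMDiff 𝓘(ℝ, ℝ) (𝓡 n) 1 γ)
    {u : EuclideanSpace ℝ (Fin n)} {R lam τ : ℝ} (hτ : 0 ≤ τ) (hR : 0 ≤ R) (hlam : 0 ≤ lam)
    (hball : Metric.closedBall u R ⊆ (extChartAt (𝓡 n) x).target)
    (hcomp : ∀ z ∈ Metric.closedBall u R, ∀ a, lam * metricTensor x u a a ≤ metricTensor x z a a)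
    (hγ0 : extChartAt (𝓡 n) x (γ 0) = u)
    (hmem : ∀ t ∈ Set.Icc 0 τ, γ t ∈ (extChartAt (𝓡 n) x).source ∧
      extChartAt (𝓡 n) x (γ t) ∈ Metric.closedBall u R) :
    ENNReal.ofReal (√(lam * metricTensor x u (extChartAt (𝓡 n) x (γ τ) - u)
      (extChartAt (𝓡 n) x (γ τ) - u))) ≤ Manifold.pathELength (𝓡 n) γ 0 τ := by
  have hG := isMetricTensor (n := n) x
  have hu : u ∈ (extChartAt (𝓡 n) x).target := hball (Metric.mem_closedBall_self hR)
  set w := extChartAt (𝓡 n) x (γ τ) - u with hw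
  set S := metricTensor x u w w with hS
  rcases eq_or_ne w 0 with hw0 | hw0
  · simp [hS, hw0]
  have hSpos : 0 < S := hG.pos u hu w hw0
  set c := extChartAt (𝓡 n) x ∘ γ with hc
  have hU : IsOpen (γ ⁻¹' (extChartAt (𝓡 n) x).source) :=
    (isOpen_extChartAt_source x).preimage hγ.continuous
  have hcC1 : ContDiffOn ℝ 1 c (γ ⁻¹' (extChartAt (𝓡 n) x).source) := by
    rw [← contMDiffOn_iff_contDiffOn]
    refine (contMDiffOn_extChartAt (n := 1) (x := x)).comp hγ.contMDiffOn fun t ht ↦ ?_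
    simpa using ht
  have hIU : Set.Icc 0 τ ⊆ γ ⁻¹' (extChartAt (𝓡 n) x).source := fun t ht ↦ (hmem t ht).1
  have hder : ∀ t ∈ Set.Icc 0 τ, HasDerivAt c (deriv c t) t := fun t ht ↦
    ((hcC1.differentiableOn one_ne_zero t (hIU ht)).differentiableAt
      (hU.mem_nhds (hIU ht))).hasDerivAt
  have hdcont : ContinuousOn (deriv c) (Set.Icc 0 τ) :=
    (hcC1.continuousOn_deriv_of_isOpen hU le_rfl).mono hIU
  set f : ℝ → ℝ := fun t ↦ √lam / √S * metricTensor x u w (deriv c t) with hf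
  have hfcont : ContinuousOn f (Set.Icc 0 τ) := by
    have : Continuous fun a ↦ √lam / √S * metricTensor x u w a := by fun_prop
    exact this.comp_continuousOn hdcont
  have hfi : ∫ t in Set.Icc 0 τ, f t = √(lam * S) := by
    rw [MeasureTheory.integral_Icc_eq_integral_Ioc, ← intervalIntegral.integral_of_le hτ]
    have h1 : ∀ t ∈ Set.uIcc 0 τ, HasDerivAt (fun s ↦ √lam / √S * metricTensor x u w (c s))
        (f t) t := fun t ht ↦ by
      rw [Set.uIcc_of_le hτ] at ht
      exact ((metricTensor x u w).hasFDerivAt.comp_hasDerivAt t (hder t ht)).const_mul _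
    rw [intervalIntegral.integral_eq_sub_of_hasDerivAt h1
      (ContinuousOn.intervalIntegrable (by rwa [Set.uIcc_of_le hτ])), ← mul_sub, ← map_sub]
    have h2 : c τ - c 0 = w := by rw [hw, ← hγ0]; rfl
    rw [h2, Real.sqrt_mul hlam, ← hS]
    nth_rewrite 2 [← Real.mul_self_sqrt hSpos.le]
    have := Real.sqrt_pos.2 hSpos
    field_simp
  have h0 : ‖∫ t in Set.Icc 0 τ, f t‖ₑ ≤ ∫⁻ t in Set.Icc 0 τ, ‖f t‖ₑ :=
    MeasureTheory.enorm_integral_le_lintegral_enorm _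
  rw [hfi, ← ofReal_norm, Real.norm_of_nonneg (Real.sqrt_nonneg _)] at h0
  refine h0.trans ?_
  rw [Manifold.pathELength_eq_lintegral_mfderiv_Icc]
  refine MeasureTheory.setLIntegral_mono' measurableSet_Icc fun t ht ↦ ?_
  rw [← ofReal_norm, ← ofReal_norm]
  refine ENNReal.ofReal_le_ofReal ?_
  have h1 := norm_velocity_sq (n := n) x hγ.continuous.continuousAt (hmem t ht).1 (hder t ht)
  have h2 := hcomp _ (hmem t ht).2 (deriv c t)
  have h3 := hG.sq_apply_le hu w (deriv c t)
  rw [← h1] at h2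
  refine abs_le_of_sq_le_sq ?_ (norm_nonneg _) |>.trans_eq' (Real.norm_eq_abs _)
  change f t ^ 2 ≤ ‖(velocity n γ t).2‖ ^ 2
  refine le_trans ?_ h2
  rw [hf, mul_pow, div_pow, Real.sq_sqrt hlam, Real.sq_sqrt hSpos.le, div_mul_eq_mul_div,
    div_le_iff₀ hSpos, mul_assoc]
  rw [← hS] at h3
  linarith [mul_le_mul_of_nonneg_left h3 hlam]

variable [T2Space M]

/-- A lower bound for the Riemannian distance in a chart. -/
lemma le_riemannianEDist (x : M) {u u' : EuclideanSpace ℝ (Fin n)} {R lam : ℝ} (hR : 0 < R)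
    (hlam : 0 ≤ lam) (hball : Metric.closedBall u R ⊆ (extChartAt (𝓡 n) x).target)
    (hu' : u' ∈ (extChartAt (𝓡 n) x).target)
    (hcomp : ∀ z ∈ Metric.closedBall u R, ∀ a, lam * metricTensor x u a a ≤ metricTensor x z a a)
    (hsphere : ∀ z, dist z u = R →
      metricTensor x u (u' - u) (u' - u) ≤ metricTensor x u (z - u) (z - u)) :
    ENNReal.ofReal (√(lam * metricTensor x u (u' - u) (u' - u))) ≤
      Manifold.riemannianEDist (𝓡 n) ((extChartAt (𝓡 n) x).symm u)
        ((extChartAt (𝓡 n) x).symm u') := by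
  refine le_of_forall_gt fun r hr ↦ ?_
  obtain ⟨γ, hγ0, hγ1, hγ, hlen, -, -⟩ :=
    Manifold.exists_lt_locally_constant_of_riemannianEDist_lt hr zero_lt_one
  refine lt_of_le_of_lt ?_ hlen
  have hu : u ∈ (extChartAt (𝓡 n) x).target := hball (Metric.mem_closedBall_self hR.le)
  have hφ0 : extChartAt (𝓡 n) x (γ 0) = u := by rw [hγ0, (extChartAt (𝓡 n) x).right_inv hu]
  set U : Set M := (extChartAt (𝓡 n) x).source ∩ extChartAt (𝓡 n) x ⁻¹' Metric.ball u R with hU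
  have hUo : IsOpen U :=
    (continuousOn_extChartAt x).isOpen_inter_preimage (isOpen_extChartAt_source x)
      Metric.isOpen_ball
  by_cases hstay : ∀ t ∈ Set.Icc (0 : ℝ) 1, γ t ∈ U
  · have h1 := le_pathELength_of_mem_closedBall x hγ zero_le_one hR.le hlam hball hcomp hφ0
      fun t ht ↦ ⟨(hstay t ht).1, Metric.ball_subset_closedBall (hstay t ht).2⟩
    rwa [hγ1, (extChartAt (𝓡 n) x).right_inv hu'] at h1
  · push Not at hstay
    obtain ⟨t₁, ht₁, ht₁U⟩ := hstay
    set A : Set ℝ := Set.Icc 0 1 ∩ γ ⁻¹' Uᶜ with hA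
    have hAc : IsClosed A := isClosed_Icc.inter (hUo.isClosed_compl.preimage hγ.continuous)
    have hAb : BddBelow A := ⟨0, fun t ht ↦ ht.1.1⟩
    -- The time of first exit from the ball. Up to then the calibration applies, and by `hsphere`
    -- the exit point is at least as far from `u` as `u'` is.
    set τ := sInf A with hτ
    have hτA : τ ∈ A := hAc.csInf_mem ⟨t₁, ht₁, ht₁U⟩ hAb
    have hlt : ∀ t ∈ Set.Ico 0 τ, γ t ∈ U := by
      intro t ht
      by_contra hn
      exact absurd (csInf_le hAb (⟨⟨ht.1, ht.2.le.trans hτA.1.2⟩, hn⟩ : t ∈ A)) (not_le.2 ht.2)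
    have hτ0 : 0 < τ := by
      refine lt_of_le_of_ne hτA.1.1 fun h ↦ hτA.2 ?_
      rw [← h, hU]
      refine ⟨?_, ?_⟩
      · rw [hγ0]
        exact (extChartAt (𝓡 n) x).map_target hu
      · rw [Set.mem_preimage, hφ0]
        exact Metric.mem_ball_self hR
    -- The image of the closed ball is compact, hence closed as `M` is Hausdorff. This prevents the
    -- curve from leaving the chart domain at time `τ` without meeting the sphere.
    have hK : IsClosed ((extChartAt (𝓡 n) x).symm '' Metric.closedBall u R) :=
      ((isCompact_closedBall u R).image_of_continuousOn
        ((continuousOn_extChartAt_symm x).mono hball)).isClosed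
    have hτK : γ τ ∈ (extChartAt (𝓡 n) x).symm '' Metric.closedBall u R := by
      have h1 : τ ∈ closure (Set.Ico 0 τ) := by
        rw [closure_Ico hτ0.ne]
        exact ⟨hτ0.le, le_rfl⟩
      have h2 : Set.MapsTo γ (Set.Ico 0 τ) ((extChartAt (𝓡 n) x).symm '' Metric.closedBall u R) :=
        fun t ht ↦ ⟨_, Metric.ball_subset_closedBall (hlt t ht).2,
          (extChartAt (𝓡 n) x).left_inv (hlt t ht).1⟩
      have h3 := h2.closure hγ.continuous h1
      rwa [hK.closure_eq] at h3
    obtain ⟨z, hz, hzτ⟩ := hτK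
    have hφτ : extChartAt (𝓡 n) x (γ τ) = z := by
      rw [← hzτ, (extChartAt (𝓡 n) x).right_inv (hball hz)]
    have hsrc : γ τ ∈ (extChartAt (𝓡 n) x).source := by
      rw [← hzτ]
      exact (extChartAt (𝓡 n) x).map_target (hball hz)
    have hzR : dist z u = R := by
      refine le_antisymm hz (not_lt.1 fun h ↦ hτA.2 ⟨hsrc, ?_⟩)
      rw [Set.mem_preimage, hφτ]
      exact h
    have h1 := le_pathELength_of_mem_closedBall x hγ hτ0.le hR.le hlam hball hcomp hφ0 (by
      intro t ht
      rcases ht.2.lt_or_eq with h | rfl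
      · exact ⟨(hlt t ⟨ht.1, h⟩).1, Metric.ball_subset_closedBall (hlt t ⟨ht.1, h⟩).2⟩
      · exact ⟨hsrc, by rwa [hφτ]⟩)
    rw [hφτ] at h1
    refine le_trans (ENNReal.ofReal_le_ofReal (Real.sqrt_le_sqrt ?_))
      (h1.trans (Manifold.pathELength_mono le_rfl hτA.1.2))
    exact mul_le_mul_of_nonneg_left (hsphere z hzR) hlam

end

end

/-! ### The truncated distance, and the curves which realise it locally -/

section

section Metric

variable {n : ℕ} {M : Type*} [TopologicalSpace M] [ChartedSpace (EuclideanSpace ℝ (Fin n)) M]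
  [Bundle.RiemannianBundle (fun x : M ↦ TangentSpace (𝓡 n) x)]

lemma riemannianEDist_eq_ofReal {x y : M} (h : truncDist n x y < 1) :
    Manifold.riemannianEDist (𝓡 n) x y = ENNReal.ofReal (truncDist n x y) := by
  have h1 := riemannianEDist_lt_of_truncDist_lt le_rfl h
  rw [ENNReal.ofReal_one] at h1
  rw [truncDist, min_eq_right h1.le, ENNReal.ofReal_toReal h1.ne_top]

lemma truncDist_comm (x y : M) : truncDist n x y = truncDist n y x := by
  rw [truncDist, truncDist, Manifold.riemannianEDist_comm]

variable [IsManifold (𝓡 n) ∞ M] [IsContMDiffRiemannianBundle (𝓡 n) ∞ (EuclideanSpace ℝ (Fin n))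
      (fun x : M ↦ TangentSpace (𝓡 n) x)]

variable (n M) in
lemma isContinuousRiemannianBundle : IsContinuousRiemannianBundle (EuclideanSpace ℝ (Fin n))
    (fun x : M ↦ TangentSpace (𝓡 n) x) := by
  obtain ⟨g, hg, hg'⟩ := IsContMDiffRiemannianBundle.exists_contMDiff (IB := 𝓡 n) (n := ∞)
    (F := EuclideanSpace ℝ (Fin n)) (E := fun x : M ↦ TangentSpace (𝓡 n) x)
  exact ⟨g, hg.continuous, hg'⟩

variable (n M) in
-- The truncation makes the distance finite between different components of `M`, and it changes
-- neither small distances nor the topology.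
lemma exists_metricSpace_dist_eq_truncDist [T3Space M] : ∃ d : MetricSpace M,
    d.toUniformSpace.toTopologicalSpace = ‹TopologicalSpace M› ∧
      ∀ x y : M, dist x y = truncDist n x y := by
  have hcont := isContinuousRiemannianBundle n M
  let P : PseudoEMetricSpace M := PseudoEMetricSpace.ofEDistOfTopology
    (fun x y : M ↦ min 1 (Manifold.riemannianEDist (𝓡 n) x y))
    (fun _ ↦ by simp [Manifold.riemannianEDist_self])
    (fun _ _ ↦ by rw [Manifold.riemannianEDist_comm])
    (fun x y z ↦ by
      rcases le_total 1 (Manifold.riemannianEDist (𝓡 n) x y) with h1 | h1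
      · rw [min_eq_left h1]
        exact (min_le_left _ _).trans le_self_add
      rcases le_total 1 (Manifold.riemannianEDist (𝓡 n) y z) with h2 | h2
      · rw [min_eq_left h2]
        exact (min_le_left _ _).trans le_add_self
      rw [min_eq_right h1, min_eq_right h2]
      exact (min_le_right _ _).trans Manifold.riemannianEDist_triangle)
    (fun x ↦ (basis_sets (𝓝 x)).to_hasBasis'
      (fun s hs ↦ by
        obtain ⟨c, hc, hcs⟩ := setOfPred_riemannianEDist_lt_subset_nhds' (𝓡 n) hs
        refine ⟨min 1 c, lt_min one_pos hc, fun y hy ↦ hcs ?_⟩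
        rcases min_lt_iff.1 (show min 1 (Manifold.riemannianEDist (𝓡 n) x y) < min 1 c from hy)
          with h | h
        · exact absurd h (not_lt.2 (min_le_left _ _))
        · exact h.trans_le (min_le_right _ _))
      (fun c hc ↦ by
        filter_upwards [eventually_riemannianEDist_lt (𝓡 n) x hc] with y hy
        exact (min_le_right _ _).trans_lt hy))
  have hfin : ∀ x y : M, edist x y ≠ ⊤ := fun x y ↦
    ne_top_of_le_ne_top ENNReal.one_ne_top (min_le_left _ _)
  let Q : PseudoMetricSpace M := PseudoEMetricSpace.toPseudoMetricSpace hfin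
  exact ⟨MetricSpace.ofT0PseudoMetricSpace M, rfl, fun x y ↦ rfl⟩

lemma continuous_norm_velocity {γ : ℝ → M} (hγ : ContMDiff 𝓘(ℝ, ℝ) (𝓡 n) 1 γ) :
    Continuous fun t ↦ ‖(velocity n γ t).2‖ := by
  refine continuous_iff_continuousAt.2 fun t₀ ↦ ?_
  set x := γ t₀ with hx
  set c := extChartAt (𝓡 n) x ∘ γ with hc
  have hU : IsOpen (γ ⁻¹' (extChartAt (𝓡 n) x).source) :=
    (isOpen_extChartAt_source x).preimage hγ.continuous
  have ht₀ : t₀ ∈ γ ⁻¹' (extChartAt (𝓡 n) x).source := mem_extChartAt_source (I := 𝓡 n) x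
  have hcC1 : ContDiffOn ℝ 1 c (γ ⁻¹' (extChartAt (𝓡 n) x).source) := by
    rw [← contMDiffOn_iff_contDiffOn]
    refine (contMDiffOn_extChartAt (n := 1) (x := x)).comp hγ.contMDiffOn fun t ht ↦ ?_
    simpa using ht
  have hdcont : ContinuousOn (deriv c) (γ ⁻¹' (extChartAt (𝓡 n) x).source) :=
    hcC1.continuousOn_deriv_of_isOpen hU le_rfl
  have h1 : ContinuousOn (fun t ↦ metricTensor x (c t)) (γ ⁻¹' (extChartAt (𝓡 n) x).source) :=
    (isMetricTensor x).contDiffOn.continuousOn.comp hcC1.continuousOn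
      fun t ht ↦ (extChartAt (𝓡 n) x).map_source ht
  have h2 := (((h1.clm_apply hdcont).clm_apply hdcont).continuousAt (hU.mem_nhds ht₀)).sqrt
  refine h2.congr ?_
  filter_upwards [hU.mem_nhds ht₀] with t ht
  have h3 := norm_velocity_sq (n := n) x hγ.continuous.continuousAt ht
    ((hcC1.differentiableOn one_ne_zero t ht).differentiableAt (hU.mem_nhds ht)).hasDerivAt
  exact (congrArg Real.sqrt h3).symm.trans (Real.sqrt_sq (norm_nonneg _))

lemma pathELength_eq_ofReal_integral {γ : ℝ → M} (hγ : ContMDiff 𝓘(ℝ, ℝ) (𝓡 n) 1 γ) {a b : ℝ}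
    (hab : a ≤ b) : Manifold.pathELength (𝓡 n) γ a b =
      ENNReal.ofReal (∫ t in a..b, ‖(velocity n γ t).2‖) := by
  rw [Manifold.pathELength_eq_lintegral_mfderiv_Icc, intervalIntegral.integral_of_le hab,
    ← MeasureTheory.integral_Icc_eq_integral_Ioc, MeasureTheory.ofReal_integral_eq_lintegral_ofReal
      (continuous_norm_velocity hγ).integrableOn_Icc (Eventually.of_forall fun t ↦ norm_nonneg _)]
  refine MeasureTheory.setLIntegral_congr_fun measurableSet_Icc fun t _ ↦ ?_
  exact (ofReal_norm _).symm

lemma truncDist_le_integral {γ : ℝ → M} (hγ : ContMDiff 𝓘(ℝ, ℝ) (𝓡 n) 1 γ) {a b : ℝ}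
    (hab : a ≤ b) : truncDist n (γ a) (γ b) ≤ ∫ t in a..b, ‖(velocity n γ t).2‖ := by
  refine truncDist_le (intervalIntegral.integral_nonneg hab fun t _ ↦ norm_nonneg _) ?_
  rw [← pathELength_eq_ofReal_integral hγ hab]
  exact Manifold.riemannianEDist_le_pathELength hγ.contMDiffOn rfl rfl hab

/-- Points at distance less than `δ` are joined by a `1`-Lipschitz curve on `[0, δ]`. -/
lemma exists_lipschitz_curve {x y : M} {δ : ℝ} (hδ : 0 < δ)
    (h : Manifold.riemannianEDist (𝓡 n) x y < ENNReal.ofReal δ) :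
    ∃ c : ℝ → M, (∀ s t, truncDist n (c s) (c t) ≤ |s - t|) ∧ truncDist n (c 0) x ≤ 0 ∧
      truncDist n (c δ) y ≤ 0 := by
  obtain ⟨γ, rfl, rfl, hγ, hlen, -, -⟩ :=
    Manifold.exists_lt_locally_constant_of_riemannianEDist_lt h zero_lt_one
  have hf := continuous_norm_velocity hγ
  have hi : ∀ a b, IntervalIntegrable (fun t ↦ ‖(velocity n γ t).2‖) MeasureTheory.volume a b :=
    fun a b ↦ hf.intervalIntegrable a b
  rw [pathELength_eq_ofReal_integral hγ zero_le_one, ENNReal.ofReal_lt_ofReal_iff hδ] at hlen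
  -- Arc length plus a linear term which spreads the slack, so that `S` runs from `0` to `δ`.
  -- Distances on `γ` are bounded by differences of `S`, hence any right inverse `θ` gives a
  -- `1`-Lipschitz curve. As `θ` is merely chosen, the ends are identified only up to distance zero.
  set S : ℝ → ℝ := fun t ↦ (∫ r in 0..t, ‖(velocity n γ r).2‖) +
    (δ - ∫ r in 0..1, ‖(velocity n γ r).2‖) * t with hS
  have hScont : Continuous S :=
    (intervalIntegral.continuous_primitive hi 0).add (continuous_const_mul _)
  have hS0 : S 0 = 0 := by simp [hS]
  have hS1 : S 1 = δ := by simp [hS]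
  have hle : ∀ s t, s ≤ t → truncDist n (γ s) (γ t) ≤ S t - S s := by
    intro s t hst
    have h1 := truncDist_le_integral hγ hst
    rw [← intervalIntegral.integral_interval_sub_left (hi 0 t) (hi 0 s)] at h1
    have h2 := mul_le_mul_of_nonneg_left hst (sub_nonneg.2 hlen.le)
    simp only [hS]
    linarith
  have habs : ∀ s t, truncDist n (γ s) (γ t) ≤ |S s - S t| := by
    intro s t
    rcases le_total s t with hst | hst
    · rw [abs_sub_comm]
      exact (hle s t hst).trans (le_abs_self _)
    · rw [truncDist_comm]
      exact (hle t s hst).trans (le_abs_self _)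
  have hsurj : ∀ r ∈ Set.Icc 0 δ, ∃ t, S t = r := by
    intro r hr
    obtain ⟨t, -, ht⟩ := intermediate_value_Icc zero_le_one hScont.continuousOn
      (show r ∈ Set.Icc (S 0) (S 1) by rwa [hS0, hS1])
    exact ⟨t, ht⟩
  choose! θ hθ using hsurj
  have hproj : ∀ s, S (θ (Set.projIcc 0 δ hδ.le s)) = Set.projIcc 0 δ hδ.le s := fun s ↦
    hθ _ (Set.projIcc 0 δ hδ.le s).2
  refine ⟨fun s ↦ γ (θ (Set.projIcc 0 δ hδ.le s)), fun s t ↦ (habs _ _).trans ?_, ?_, ?_⟩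
  · rw [hproj, hproj]
    exact Set.abs_projIcc_sub_projIcc hδ.le
  · refine (habs _ _).trans ?_
    rw [hproj, hS0]
    simp
  · refine (habs _ _).trans ?_
    rw [hproj, hS1]
    simp

variable [T2Space M]

/-- Above, the distance is bounded by the length of the coordinate segment, along which the metric
tensor varies by at most `K * ‖w‖`. Below, `le_riemannianEDist` is applied on a ball of radius
proportional to `‖w‖`, where the metric tensor is at least `1 - O(‖w‖)` times its value at the
centre. Both relative errors are linear in `‖w‖`, so the error of the square is cubic. -/
lemma exists_chart_estimate (x : M) : ∃ B : Set (EuclideanSpace ℝ (Fin n)), IsOpen B ∧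
    extChartAt (𝓡 n) x x ∈ B ∧ B ⊆ (extChartAt (𝓡 n) x).target ∧ ∃ m C K : ℝ, 0 < m ∧ 0 ≤ C ∧
    0 ≤ K ∧ (∀ u ∈ B, ∀ a, m * ‖a‖ ^ 2 ≤ metricTensor x u a a) ∧
    (∀ u ∈ B, ∀ u' ∈ B, ∀ a, |metricTensor x u a a - metricTensor x u' a a| ≤
      K * ‖u - u'‖ * ‖a‖ ^ 2) ∧
    (∀ u ∈ B, ∀ u' ∈ B, m * ‖u' - u‖ ^ 2 ≤ truncDist n ((extChartAt (𝓡 n) x).symm u)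
      ((extChartAt (𝓡 n) x).symm u') ^ 2) ∧
    ∀ u ∈ B, ∀ u' ∈ B, |truncDist n ((extChartAt (𝓡 n) x).symm u)
      ((extChartAt (𝓡 n) x).symm u') ^ 2 - metricTensor x u (u' - u) (u' - u)| ≤
        C * ‖u' - u‖ ^ 3 := by
  have hG := isMetricTensor (n := n) x
  set G := metricTensor (n := n) x with hGdef
  set u₀ := extChartAt (𝓡 n) x x with hu₀
  have hu₀t : u₀ ∈ (extChartAt (𝓡 n) x).target := mem_extChartAt_target x
  have hCD : ContDiffAt ℝ ∞ G u₀ := hG.contDiffOn.contDiffAt (hG.isOpen.mem_nhds hu₀t)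
  obtain ⟨m, hm, hlow⟩ := hG.exists_pos_mul_sq_le hu₀t
  obtain ⟨K', s, hs, hlip⟩ := (hCD.of_le (m := 1) (by simp)).exists_lipschitzOnWith
  have hbd : ∀ᶠ u in 𝓝 u₀, ‖G u‖ < ‖G u₀‖ + 1 :=
    hCD.continuousAt.norm.eventually_lt continuousAt_const (lt_add_one _)
  obtain ⟨r₀, hr₀, hball⟩ := Metric.eventually_nhds_iff_ball.1
    (((hlow.and hbd).and hs).and (hG.isOpen.mem_nhds hu₀t))
  set Λ : ℝ := ‖G u₀‖ + 1 + m with hΛ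
  have hΛ0 : 0 < Λ := by positivity
  set K : ℝ := (K' : ℝ) with hK
  have hK0 : 0 ≤ K := K'.coe_nonneg
  have hup : ∀ u ∈ Metric.ball u₀ r₀, ∀ a, G u a a ≤ Λ * ‖a‖ ^ 2 := by
    intro u hu a
    have h1 := (le_abs_self _).trans ((G u).le_opNorm₂ a a)
    have h2 : ‖G u‖ ≤ Λ := by linarith [(hball u hu).1.1.2]
    have h3 := mul_le_mul_of_nonneg_right h2 (sq_nonneg ‖a‖)
    linarith
  have hlipG : ∀ u ∈ Metric.ball u₀ r₀, ∀ u' ∈ Metric.ball u₀ r₀, ∀ a,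
      |G u a a - G u' a a| ≤ K * ‖u - u'‖ * ‖a‖ ^ 2 := by
    intro u hu u' hu' a
    have h1 := hlip.dist_le_mul u (hball u hu).1.2 u' (hball u' hu').1.2
    rw [dist_eq_norm, dist_eq_norm] at h1
    have h2 := ((G u - G u').le_opNorm₂ a a)
    simp only [sub_apply, Real.norm_eq_abs] at h2
    have h3 := mul_le_mul_of_nonneg_right h1 (sq_nonneg ‖a‖)
    linarith
  -- With `m * κ ^ 2 = Λ`, every vector of norm `κ * ‖w‖` is at least as long as `w` for the metric
  -- at `u`.
  set κ : ℝ := √(Λ / m) with hκ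
  have hκ2 : m * κ ^ 2 = Λ := by
    rw [hκ, Real.sq_sqrt (by positivity)]
    field_simp
  have hκ0 : 0 < κ := Real.sqrt_pos.2 (by positivity)
  -- As `‖w‖ < 2 * r`, the conditions keep the ball of radius `κ * ‖w‖` where the bounds hold, make
  -- `lam` at least `1 / 2`, and keep the lower bound below the truncation.
  obtain ⟨r, hr, hr1, hr2, hr3⟩ : ∃ r : ℝ, 0 < r ∧ r + κ * (2 * r) < r₀ ∧
      K * (κ * (2 * r)) < m / 2 ∧ Λ * (2 * r) ^ 2 < 1 := by
    have e1 : ∀ᶠ r : ℝ in 𝓝 0, r + κ * (2 * r) < r₀ :=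
      (by fun_prop : Continuous fun r : ℝ ↦ r + κ * (2 * r)).continuousAt.eventually_lt
        continuousAt_const (by simpa using hr₀)
    have e2 : ∀ᶠ r : ℝ in 𝓝 0, K * (κ * (2 * r)) < m / 2 :=
      (by fun_prop : Continuous fun r : ℝ ↦ K * (κ * (2 * r))).continuousAt.eventually_lt
        continuousAt_const (by simpa using hm)
    have e3 : ∀ᶠ r : ℝ in 𝓝 0, Λ * (2 * r) ^ 2 < 1 :=
      (by fun_prop : Continuous fun r : ℝ ↦ Λ * (2 * r) ^ 2).continuousAt.eventually_lt
        continuousAt_const (by simp)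
    obtain ⟨r, h1, h2⟩ := (((e1.and (e2.and e3)).filter_mono
      (nhdsWithin_le_nhds (s := Set.Ioi 0))).and self_mem_nhdsWithin).exists
    exact ⟨r, h2, h1.1, h1.2.1, h1.2.2⟩
  have hrr₀ : r < r₀ := by linarith [mul_pos hκ0 (mul_pos two_pos hr)]
  have hsub : Metric.ball u₀ r ⊆ Metric.ball u₀ r₀ := Metric.ball_subset_ball hrr₀.le
  have hBt : Metric.ball u₀ r ⊆ (extChartAt (𝓡 n) x).target := fun u hu ↦ (hball u (hsub hu)).2
  have hupper : ∀ u ∈ Metric.ball u₀ r, ∀ u' ∈ Metric.ball u₀ r,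
      truncDist n ((extChartAt (𝓡 n) x).symm u) ((extChartAt (𝓡 n) x).symm u') ^ 2 ≤
        G u (u' - u) (u' - u) + K * ‖u' - u‖ ^ 3 := by
    intro u hu u' hu'
    set w := u' - u with hw
    have hGw : 0 ≤ G u w w :=
      (by positivity : 0 ≤ m * ‖w‖ ^ 2).trans ((hball u (hsub hu)).1.1.1 w)
    set F : ℝ := √(G u w w + K * ‖w‖ ^ 3) with hF
    have hF2 : F ^ 2 = G u w w + K * ‖w‖ ^ 3 := Real.sq_sqrt (by positivity)
    have hseg : ∀ t ∈ Set.Icc (0 : ℝ) 1, u + t • w ∈ Metric.ball u₀ r := by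
      intro t ht
      exact (convex_ball u₀ r).add_smul_sub_mem hu hu' ht
    have h1 := riemannianEDist_le_integral (n := n) x zero_le_one (c := fun t ↦ u + t • w)
      (c' := fun _ ↦ w) (f := fun _ ↦ F) continuous_const
      (fun t ↦ by simpa using ((hasDerivAt_id t).smul_const w).const_add u)
      (fun t ht ↦ hBt (hseg t ht)) continuousOn_const (fun t ht ↦ ⟨Real.sqrt_nonneg _, by
        rw [hF2]
        have h2 := (abs_le.1 (hlipG _ (hsub (hseg t ht)) u (hsub hu) w)).2
        have h3 : ‖u + t • w - u‖ ≤ ‖w‖ := by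
          rw [add_sub_cancel_left, norm_smul, Real.norm_of_nonneg ht.1]
          exact mul_le_of_le_one_left (norm_nonneg _) ht.2
        have h4 : K * ‖u + t • w - u‖ * ‖w‖ ^ 2 ≤ K * ‖w‖ * ‖w‖ ^ 2 := by gcongr
        linarith⟩)
    simp only [zero_smul, add_zero, one_smul, intervalIntegral.integral_const, sub_zero] at h1
    rw [hw, add_sub_cancel] at h1
    rw [← hF2]
    exact pow_le_pow_left₀ ENNReal.toReal_nonneg (truncDist_le (Real.sqrt_nonneg _) h1) 2
  have hlower : ∀ u ∈ Metric.ball u₀ r, ∀ u' ∈ Metric.ball u₀ r,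
      (1 - K * (κ * ‖u' - u‖) / m) * G u (u' - u) (u' - u) ≤
        truncDist n ((extChartAt (𝓡 n) x).symm u) ((extChartAt (𝓡 n) x).symm u') ^ 2 ∧
      1 / 2 ≤ 1 - K * (κ * ‖u' - u‖) / m := by
    intro u hu u' hu'
    set w := u' - u with hw
    have hwr : ‖w‖ < 2 * r := by
      rw [hw, ← dist_eq_norm]
      linarith [dist_triangle_right u' u u₀, Metric.mem_ball.1 hu, Metric.mem_ball.1 hu']
    have hhalf : 1 / 2 ≤ 1 - K * (κ * ‖w‖) / m := by
      have h1 : K * (κ * ‖w‖) ≤ K * (κ * (2 * r)) := by gcongr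
      have h2 : K * (κ * ‖w‖) / m ≤ 1 / 2 := by
        rw [div_le_iff₀ hm]
        linarith
      linarith
    refine ⟨?_, hhalf⟩
    rcases eq_or_ne w 0 with hw0 | hw0
    · rw [hw0]
      simpa using sq_nonneg _
    have hwpos : 0 < ‖w‖ := norm_pos_iff.2 hw0
    set lam := 1 - K * (κ * ‖w‖) / m with hlam
    have hcb : Metric.closedBall u (κ * ‖w‖) ⊆ Metric.ball u₀ r₀ := by
      intro z hz
      rw [Metric.mem_closedBall] at hz
      rw [Metric.mem_ball] at hu ⊢
      have : κ * ‖w‖ ≤ κ * (2 * r) := by gcongr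
      linarith [dist_triangle z u u₀]
    have hGw : 0 ≤ G u w w :=
      (by positivity : 0 ≤ m * ‖w‖ ^ 2).trans ((hball u (hsub hu)).1.1.1 w)
    have h1 := le_riemannianEDist (n := n) x (u := u) (u' := u') (R := κ * ‖w‖) (lam := lam)
      (by positivity) (by linarith) (fun z hz ↦ (hball z (hcb hz)).2) (hBt hu') (by
        intro z hz a
        have h2 := (abs_le.1 (hlipG u (hsub hu) z (hcb hz) a)).2
        have h3 := (hball u (hsub hu)).1.1.1 a
        rw [Metric.mem_closedBall, dist_comm, dist_eq_norm] at hz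
        have h4 : K * ‖u - z‖ * ‖a‖ ^ 2 ≤ K * (κ * ‖w‖) * ‖a‖ ^ 2 := by gcongr
        have h5 : K * (κ * ‖w‖) / m * (m * ‖a‖ ^ 2) ≤ K * (κ * ‖w‖) / m * G u a a := by gcongr
        have h6 : K * (κ * ‖w‖) / m * (m * ‖a‖ ^ 2) = K * (κ * ‖w‖) * ‖a‖ ^ 2 := by field_simp
        rw [hlam, sub_mul, one_mul]
        linarith) (by
        intro z hz
        rw [dist_eq_norm] at hz
        have h2 := (hball u (hsub hu)).1.1.1 (z - u)
        rw [hz, mul_pow, ← mul_assoc, hκ2] at h2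
        exact (hup u (hsub hu) w).trans h2)
    have hle1 : √(lam * G u w w) ≤ 1 := by
      rw [Real.sqrt_le_one]
      have h2 := hup u (hsub hu) w
      have h3 : Λ * ‖w‖ ^ 2 ≤ Λ * (2 * r) ^ 2 := by gcongr
      have h4 : lam ≤ 1 := by
        rw [hlam]
        have : 0 ≤ K * (κ * ‖w‖) / m := by positivity
        linarith
      have h5 : lam * G u w w ≤ 1 * G u w w := by gcongr
      linarith
    have h2 := le_truncDist hle1 h1
    have h3 := pow_le_pow_left₀ (Real.sqrt_nonneg _) h2 2
    rwa [Real.sq_sqrt (mul_nonneg (by linarith) hGw)] at h3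
  -- The factor `lam ≥ 1 / 2` accounts for `m / 2`, and `C` is the sum of the errors of the upper
  -- and the lower bound.
  refine ⟨Metric.ball u₀ r, Metric.isOpen_ball, Metric.mem_ball_self hr, hBt, m / 2,
    K + K * κ * Λ / m, K, by positivity, by positivity, hK0, ?_, ?_, ?_, ?_⟩
  · intro u hu a
    have h1 := (hball u (hsub hu)).1.1.1 a
    nlinarith [sq_nonneg ‖a‖]
  · exact fun u hu u' hu' a ↦ hlipG u (hsub hu) u' (hsub hu') a
  · intro u hu u' hu'
    obtain ⟨h1, h2⟩ := hlower u hu u' hu'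
    have h3 := (hball u (hsub hu)).1.1.1 (u' - u)
    have h4 : 0 ≤ m * ‖u' - u‖ ^ 2 := by positivity
    have h5 : 1 / 2 * (m * ‖u' - u‖ ^ 2) ≤
        (1 - K * (κ * ‖u' - u‖) / m) * G u (u' - u) (u' - u) :=
      mul_le_mul h2 h3 h4 (by linarith)
    linarith
  · intro u hu u' hu'
    obtain ⟨h1, h2⟩ := hlower u hu u' hu'
    have h3 := hupper u hu u' hu'
    have h4 := hup u (hsub hu) (u' - u)
    have h5 : K * (κ * ‖u' - u‖) / m * G u (u' - u) (u' - u) ≤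
      K * (κ * ‖u' - u‖) / m * (Λ * ‖u' - u‖ ^ 2) := by gcongr
    have h6 : K * (κ * ‖u' - u‖) / m * (Λ * ‖u' - u‖ ^ 2) = K * κ * Λ / m * ‖u' - u‖ ^ 3 := by ring
    have h7 : 0 ≤ K * ‖u' - u‖ ^ 3 := by positivity
    have h8 : 0 ≤ K * κ * Λ / m * ‖u' - u‖ ^ 3 := by positivity
    rw [add_mul, abs_le]
    rw [sub_mul, one_mul] at h1
    exact ⟨by linarith, by linarith⟩

/-- Locally distance-realizing curves are geodesics of unit speed. -/
lemma isGeodesicAt_of_isometric {c : ℝ → M} {t₀ σ : ℝ} (hσ : 0 < σ)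
    (hc : ContinuousOn c (Set.Icc (t₀ - σ) (t₀ + σ)))
    (hiso : ∀ s ∈ Set.Icc (t₀ - σ) (t₀ + σ), ∀ t ∈ Set.Icc (t₀ - σ) (t₀ + σ),
      truncDist n (c s) (c t) = |s - t|) :
    IsGeodesicAt n (c t₀) c t₀ ∧ ‖(velocity n c t₀).2‖ = 1 := by
  set x := c t₀ with hx
  obtain ⟨B, hB, hxB, hBt, m, C, K, hm, hC, hK, hlow, hlip, hDlow, hD⟩ :=
    exists_chart_estimate (n := n) x
  have hIcc : Set.Icc (t₀ - σ) (t₀ + σ) ∈ 𝓝 t₀ := Icc_mem_nhds (by linarith) (by linarith)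
  have hct₀ : ContinuousAt c t₀ := hc.continuousAt hIcc
  have hnhds : (extChartAt (𝓡 n) x).source ∩ extChartAt (𝓡 n) x ⁻¹' B ∈ 𝓝 x :=
    inter_mem (extChartAt_source_mem_nhds x) ((continuousAt_extChartAt x) (hB.mem_nhds hxB))
  obtain ⟨η₀, hη₀, hball⟩ := Metric.eventually_nhds_iff_ball.1 (hct₀.eventually hnhds)
  set η := min σ (η₀ / 2) with hη
  have hη0 : 0 < η := lt_min hσ (half_pos hη₀)
  have hsubσ : Set.Icc (t₀ - η) (t₀ + η) ⊆ Set.Icc (t₀ - σ) (t₀ + σ) := fun t ht ↦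
    ⟨by linarith [ht.1, min_le_left σ (η₀ / 2)], by linarith [ht.2, min_le_left σ (η₀ / 2)]⟩
  have hsub : ∀ t ∈ Set.Icc (t₀ - η) (t₀ + η),
      c t ∈ (extChartAt (𝓡 n) x).source ∩ extChartAt (𝓡 n) x ⁻¹' B := fun t ht ↦ hball t (by
    rw [Real.ball_eq_Ioo]
    exact ⟨by linarith [ht.1, min_le_right σ (η₀ / 2)],
      by linarith [ht.2, min_le_right σ (η₀ / 2)]⟩)
  have hinv : ∀ t ∈ Set.Icc (t₀ - η) (t₀ + η),
      (extChartAt (𝓡 n) x).symm (extChartAt (𝓡 n) x (c t)) = c t := fun t ht ↦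
    (extChartAt (𝓡 n) x).left_inv (hsub t ht).1
  obtain ⟨e', he'⟩ := (isMetricTensor (n := n) x).hasDerivAt_spray_of_isometric
    (D := fun u u' ↦ truncDist n ((extChartAt (𝓡 n) x).symm u) ((extChartAt (𝓡 n) x).symm u'))
    (e := extChartAt (𝓡 n) x ∘ c) (t₀ := t₀) hB hBt hm hC hK hlow hlip hDlow hD
    (fun α β c c' f hαβ hc' hc hcB hf hcf ↦
      truncDist_le (intervalIntegral.integral_nonneg hαβ.le fun t ht ↦ (hcf t ht).1)
        (riemannianEDist_le_integral x hαβ.le hc' hc (fun t ht ↦ hBt (hcB t ht)) hf hcf))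
    hη0 ((continuousOn_extChartAt x).comp (hc.mono hsubσ) fun t ht ↦ (hsub t ht).1)
    (fun t ht ↦ (hsub t ht).2) (fun s hs t ht ↦ by
      simp only [Function.comp_apply]
      rw [hinv s hs, hinv t ht]
      exact hiso s (hsubσ hs) t (hsubσ ht))
  have hxs : c t₀ ∈ (extChartAt (𝓡 n) x).source := mem_extChartAt_source x
  have hcev : ∀ᶠ s in 𝓝 t₀, ContinuousAt c s := by
    filter_upwards [eventually_mem_nhds_iff.2 hIcc] with s hs using hc.continuousAt hs
  refine ⟨IsGeodesicAt.of_hasDerivAt hxs hcev (he'.mono fun s hs ↦ ⟨hs.1, hs.2.1⟩), ?_⟩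
  have h1 := norm_velocity_sq (n := n) x hct₀ hxs he'.self_of_nhds.1
  rw [show metricTensor x (extChartAt (𝓡 n) x (c t₀)) (e' t₀) (e' t₀) = 1 from
    he'.self_of_nhds.2.2] at h1
  exact (pow_eq_one_iff_of_nonneg (norm_nonneg _) two_ne_zero).1 h1

variable [CompactSpace M]

lemma truncDist_geodesicFlow_le (v : UnitTangentBundle n M) (s t : ℝ) :
    truncDist n (geodesicFlow n M s v).1.proj (geodesicFlow n M t v).1.proj ≤ |s - t| := by
  obtain ⟨γ, hγ, -, h⟩ := exists_geodesic_of_unit v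
  have hC1 : ContMDiff 𝓘(ℝ, ℝ) (𝓡 n) 1 γ :=
    (isGeodesic_of_isGeodesicAt hγ).contMDiff.of_le one_le_two
  have hunit : ∀ t, ‖(velocity n γ t).2‖ = 1 := fun t ↦ by
    rw [← h t]
    exact (geodesicFlow n M t v).2
  have hproj : ∀ t, (geodesicFlow n M t v).1.proj = γ t := fun t ↦
    congrArg Bundle.TotalSpace.proj (h t)
  have key : ∀ s t, s ≤ t → truncDist n (γ s) (γ t) ≤ t - s := by
    intro s t hst
    have h1 := truncDist_le_integral hC1 hst
    simp only [hunit] at h1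
    simpa using h1
  rw [hproj, hproj]
  rcases le_total s t with hst | hst
  · rw [abs_sub_comm]
    exact (key s t hst).trans (le_abs_self _)
  · rw [truncDist_comm]
    exact (key t s hst).trans (le_abs_self _)

/-- The curve is a unit speed geodesic near each interior time, so by uniqueness it is a single
orbit. The velocity at `L / 2` is flowed back to time `0`, since nothing is known at the ends. -/
lemma exists_eq_proj_geodesicFlow {c : ℝ → M} {L σ : ℝ} (hL : 0 < L) (hσ : 0 < σ)
    (hc : ContinuousOn c (Set.Icc 0 L)) (hiso : ∀ s ∈ Set.Icc 0 L, ∀ t ∈ Set.Icc 0 L,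
      |s - t| < σ → truncDist n (c s) (c t) = |s - t|) :
    ∃ v : UnitTangentBundle n M, ∀ t ∈ Set.Ioo 0 L, c t = (geodesicFlow n M t v).1.proj := by
  have hgeo : ∀ t ∈ Set.Ioo 0 L, IsGeodesicAt n (c t) c t ∧ ‖(velocity n c t).2‖ = 1 := by
    intro t ht
    set τ := min (σ / 3) (min t (L - t)) with hτ
    have hτ0 : 0 < τ := lt_min (by positivity) (lt_min ht.1 (sub_pos.2 ht.2))
    have h1 : τ ≤ σ / 3 := min_le_left _ _
    have h2 : τ ≤ t := (min_le_right _ _).trans (min_le_left _ _)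
    have h3 : τ ≤ L - t := (min_le_right _ _).trans (min_le_right _ _)
    have hsub : Set.Icc (t - τ) (t + τ) ⊆ Set.Icc 0 L :=
      Set.Icc_subset_Icc (by linarith) (by linarith)
    refine isGeodesicAt_of_isometric hτ0 (hc.mono hsub) fun s hs r hr ↦
      hiso s (hsub hs) r (hsub hr) ?_
    rw [abs_lt]
    exact ⟨by linarith [hs.1, hr.2], by linarith [hs.2, hr.1]⟩
  have hmid : L / 2 ∈ Set.Ioo 0 L := ⟨by linarith, by linarith⟩
  set v₁ : UnitTangentBundle n M := ⟨velocity n c (L / 2), (hgeo _ hmid).2⟩ with hv₁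
  obtain ⟨γ, hγ, h0, h⟩ := exists_geodesic_of_unit v₁
  have hshift : ∀ t, IsGeodesicAt n (γ (t + -(L / 2))) (fun s ↦ γ (s + -(L / 2))) t := fun t ↦
    (hγ _).comp_add
  have hvel : velocity n c (L / 2) = velocity n (fun s ↦ γ (s + -(L / 2))) (L / 2) := by
    rw [velocity_comp_add (hγ _).mdifferentiableAt, add_neg_cancel, h0]
  have heq := eqOn_of_isGeodesicAt hmid (fun t ht ↦ (hgeo t ht).1) (fun t _ ↦ hshift t) hvel
  refine ⟨geodesicFlow n M (-(L / 2)) v₁, fun t ht ↦ ?_⟩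
  rw [← geodesicFlow_add, h, heq ht]
  rfl

end Metric

end

/-! ### The local cocycle with values in the fundamental group -/

section

section Homotopy

open Path

lemma quotient_trans_symm {X : Type*} [TopologicalSpace X] {x y z : X} (a : Homotopic.Quotient x y)
    (b : Homotopic.Quotient y z) : (a.trans b).symm = b.symm.trans a.symm := by
  induction a using Homotopic.Quotient.ind with | mk a =>
  induction b using Homotopic.Quotient.ind with | mk b =>
  rw [← Homotopic.Quotient.mk_trans, ← Homotopic.Quotient.mk_symm, Path.trans_symm]
  rfl

lemma quotient_symm_trans_trans {X : Type*} [TopologicalSpace X] {x y z : X}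
    (a : Homotopic.Quotient x y) (b : Homotopic.Quotient y z) : a.symm.trans (a.trans b) = b := by
  rw [← Homotopic.Quotient.trans_assoc, Homotopic.Quotient.symm_trans,
    Homotopic.Quotient.refl_trans]

/-- In a compact, locally path connected metric space, nearby points are joined by small paths. -/
lemma exists_small_path {X : Type*} [MetricSpace X] [CompactSpace X] [LocallyPathConnectedSpace X]
    {ε : ℝ} (hε : 0 < ε) : ∃ δ > 0, ∀ x y : X, dist x y < δ →
      ∃ σ : Path x y, ∀ t, σ t ∈ Metric.ball x ε := by
  have hV : ∀ x : X, ∃ V ∈ 𝓝 x, IsPathConnected V ∧ V ⊆ Metric.ball x (ε / 2) := by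
    intro x
    obtain ⟨V, hV, hVs⟩ := (path_connected_basis x).mem_iff.1
      (Metric.ball_mem_nhds x (half_pos hε))
    exact ⟨V, hV.1, hV.2, hVs⟩
  choose V hVn hVpc hVs using hV
  obtain ⟨δ, hδ, hcov⟩ := lebesgue_number_lemma_of_metric (isCompact_univ (X := X))
    (c := fun x ↦ interior (V x)) (fun x ↦ isOpen_interior)
    (fun x _ ↦ Set.mem_iUnion.2 ⟨x, mem_interior_iff_mem_nhds.2 (hVn x)⟩)
  refine ⟨δ, hδ, fun x y hxy ↦ ?_⟩
  obtain ⟨i, hi⟩ := hcov x trivial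
  have hx : x ∈ V i := interior_subset (hi (Metric.mem_ball_self hδ))
  have hy : y ∈ V i := interior_subset (hi (by rwa [Metric.mem_ball, dist_comm]))
  obtain ⟨σ, hσ⟩ := (hVpc i).joinedIn x hx y hy
  refine ⟨σ, fun t ↦ ?_⟩
  have h1 := hVs i (hσ t)
  have h2 := hVs i hx
  rw [Metric.mem_ball] at h1 h2 ⊢
  linarith [dist_triangle_right (σ t) x i]

/-- In a compact metric space whose balls of a fixed radius contain only one homotopy class of paths
between two points, the holonomy along short paths is a local cocycle with values in the
fundamental group. It reaches every element of the fundamental group if nearby points are joined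
by almost minimizing curves. -/
lemma exists_isLocalCocycle {X : Type*} [MetricSpace X] [CompactSpace X]
    [LocallyPathConnectedSpace X] {R ρ : ℝ} (hR : 0 < R) (hρ : 0 < ρ)
    (hH : ∀ (x y z : X) (σ σ' : Path y z), (∀ t, σ t ∈ Metric.ball x R) →
      (∀ t, σ' t ∈ Metric.ball x R) → σ.Homotopic σ')
    (hseg : ∀ x y : X, dist x y < ρ → ∀ δ > dist x y, ∃ c : ℝ → X,
      (∀ s t, dist (c s) (c t) ≤ |s - t|) ∧ c 0 = x ∧ c δ = y) (p : X) :
    ∃ (r : ℝ) (u : X → X → FundamentalGroup X p), IsLocalCocycle r u ∧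
      ∀ g, ∃ L, Reach r u p 1 p g L := by
  classical
  obtain ⟨r₀, hr₀, hK⟩ := exists_small_path (X := X) (half_pos hR)
  set r := min r₀ (R / 2) with hr
  have hrpos : 0 < r := lt_min hr₀ (half_pos hR)
  have hK' : ∀ x y : X, dist x y < r → ∃ σ : Path x y, ∀ t, σ t ∈ Metric.ball x (R / 2) :=
    fun x y h ↦ hK x y (h.trans_le (min_le_left _ _))
  choose K hKball using hK'
  -- Paths from `p` to all points that it can be joined to; the constant path at `p` itself makes
  -- the lift of a loop start at `1`.
  obtain ⟨T, hT⟩ : ∃ T : ∀ x : X, Joined p x → Path p x, ∀ h, T p h = Path.refl p := by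
    refine ⟨fun x h ↦ if hx : x = p then (Path.refl p).cast rfl hx else h.somePath, fun h ↦ ?_⟩
    simp
  -- The loop passes through `y` before `x` because a product in `FundamentalGroup` concatenates its
  -- right factor first.
  let U : ∀ x y : X, dist y x < r → Joined p x → Joined p y → FundamentalGroup X p :=
    fun x y h hx hy ↦ FundamentalGroup.fromPath ((Homotopic.Quotient.mk (T y hy)).trans
      ((Homotopic.Quotient.mk (K y x h)).trans (Homotopic.Quotient.mk (T x hx)).symm))
  -- Outside the path component of `p` the value is `1`. Close points lie in the same path
  -- component, so the cocycle identity is trivial there.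
  let u : X → X → FundamentalGroup X p := fun x y ↦
    if h : dist y x < r ∧ Joined p x ∧ Joined p y then U x y h.1 h.2.1 h.2.2 else 1
  have hu_eq : ∀ x y (h : dist y x < r) (hx : Joined p x) (hy : Joined p y),
      u x y = U x y h hx hy := fun x y h hx hy ↦ dif_pos ⟨h, hx, hy⟩
  have hsub : ∀ x y : X, dist x y < r → Metric.ball y (R / 2) ⊆ Metric.ball x R := by
    intro x y h
    refine Metric.ball_subset_ball' ?_
    rw [dist_comm]
    linarith [h.trans_le (min_le_right r₀ (R / 2))]
  have hsub' : ∀ x : X, Metric.ball x (R / 2) ⊆ Metric.ball x R := fun x ↦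
    Metric.ball_subset_ball (by linarith)
  have hu : IsLocalCocycle r u := by
    refine ⟨hrpos, fun x y z hxy hyz hxz ↦ ?_⟩
    rw [dist_comm] at hxy hyz hxz
    by_cases hx : Joined p x
    · have hy : Joined p y := hx.trans (Joined.symm ⟨K y x hxy⟩)
      have hz : Joined p z := hx.trans (Joined.symm ⟨K z x hxz⟩)
      rw [hu_eq x y hxy hx hy, hu_eq y z hyz hy hz, hu_eq x z hxz hx hz, FundamentalGroup.mul_def]
      have hKK : Homotopic.Quotient.mk ((K z y hyz).trans (K y x hxy)) =
          Homotopic.Quotient.mk (K z x hxz) := by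
        refine Homotopic.Quotient.eq.2 (hH z z x _ _ (fun t ↦ ?_) fun t ↦
          hsub' z (hKball _ _ _ t))
        have h1 : (K z y hyz).trans (K y x hxy) t ∈ Set.range ((K z y hyz).trans (K y x hxy)) :=
          ⟨t, rfl⟩
        rw [Path.trans_range] at h1
        rcases h1 with ⟨s, hs⟩ | ⟨s, hs⟩
        · rw [← hs]
          exact hsub' z (hKball _ _ _ s)
        · rw [← hs]
          exact hsub z y hyz (hKball _ _ _ s)
      change Homotopic.Quotient.trans (Homotopic.Quotient.trans _ (Homotopic.Quotient.trans _ _))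
        (Homotopic.Quotient.trans _ (Homotopic.Quotient.trans _ _)) =
          Homotopic.Quotient.trans _ (Homotopic.Quotient.trans _ _)
      rw [← hKK, Homotopic.Quotient.mk_trans]
      simp only [Homotopic.Quotient.trans_assoc, quotient_symm_trans_trans]
    · have hy : ¬ Joined p y := fun h ↦ hx (h.trans ⟨K y x hxy⟩)
      simp [u, hx, hy]
  refine ⟨r, u, hu, fun g ↦ ?_⟩
  have hstep : ∀ x y (g : FundamentalGroup X p), dist x y < min r ρ →
      ∃ L, Reach r u x g y (g * u x y) L := by
    intro x y g hxy
    obtain ⟨δ, hδ1, hδ2⟩ := exists_between (hxy.trans_le (min_le_left _ _))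
    obtain ⟨c, hc, h0, h1⟩ := hseg x y (hxy.trans_le (min_le_right _ _)) δ hδ1
    have h2 := Reach.of_dist_lt hu hc g (dist_nonneg.trans hδ1.le) hδ2
    rw [h0, h1] at h2
    exact ⟨δ, h2⟩
  suffices hmain : ∀ γ : Path p p, ∃ L, Reach r u p 1 p
      (FundamentalGroup.fromPath (Homotopic.Quotient.mk γ).symm) L by
    obtain ⟨γ, hγ⟩ := Homotopic.Quotient.mk_surjective (FundamentalGroup.toPath g)
    obtain ⟨L, hL⟩ := hmain γ.symm
    refine ⟨L, ?_⟩
    rw [← Homotopic.Quotient.mk_symm, Path.symm_symm, hγ] at hL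
    exact hL
  intro γ
  have hjoin : ∀ t, Joined p (γ t) := fun t ↦ ⟨(γ.subpath 0 t).cast γ.source.symm rfl⟩
  let e : Homotopic.Quotient p (γ 0) := Homotopic.Quotient.mk ((Path.refl p).cast rfl γ.source)
  -- The lift of `γ`: out along the chosen path to `γ t`, back along `γ`. At time `1` it is the
  -- inverse of the class of `γ`.
  let a : unitInterval → FundamentalGroup X p := fun t ↦ FundamentalGroup.fromPath
    ((Homotopic.Quotient.mk (T (γ t) (hjoin t))).trans
      (e.trans (Homotopic.Quotient.mk (γ.subpath 0 t))).symm)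
  obtain ⟨η, hη, hγη⟩ := Metric.uniformContinuous_iff.1
    (CompactSpace.uniformContinuous_of_continuous γ.continuous) (min r ρ) (lt_min hrpos hρ)
  have hadv : ∀ s t : unitInterval, dist s t < η → (∃ L, Reach r u p 1 (γ s) (a s) L) →
      ∃ L, Reach r u p 1 (γ t) (a t) L := by
    rintro s t hst ⟨L, hL⟩
    have hd := hγη hst
    obtain ⟨L', hL'⟩ := hstep (γ s) (γ t) (a s) hd
    have hd' : dist (γ t) (γ s) < r := by
      rw [dist_comm]; exact hd.trans_le (min_le_left _ _)
    have hmul : a s * u (γ s) (γ t) = a t := by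
      rw [hu_eq _ _ hd' (hjoin s) (hjoin t), FundamentalGroup.mul_def]
      -- The chosen short path and the arc of `γ` lie in a common ball of radius `R`, so `hH`
      -- identifies their classes.
      have hq : Homotopic.Quotient.mk (K (γ t) (γ s) hd') =
          Homotopic.Quotient.mk (γ.subpath t s) := by
        refine Homotopic.Quotient.eq.2 (hH (γ t) _ _ _ _ (fun q ↦ hsub' _ (hKball _ _ _ q))
          fun q ↦ ?_)
        have h1 : γ.subpath t s q ∈ Set.range (γ.subpath t s) := ⟨q, rfl⟩
        rw [Path.range_subpath] at h1
        obtain ⟨q', hq', hqq⟩ := h1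
        rw [← hqq, Metric.mem_ball]
        have h2 : dist q' t < η := by
          refine lt_of_le_of_lt ?_ hst
          have h3 : (q' : ℝ) ∈ Set.uIcc (t : ℝ) s := by
            rcases le_total t s with h | h
            · rw [Set.uIcc_of_le h] at hq'
              rw [Set.uIcc_of_le (Subtype.coe_le_coe.2 h)]
              exact hq'
            · rw [Set.uIcc_of_ge h] at hq'
              rw [Set.uIcc_of_ge (Subtype.coe_le_coe.2 h)]
              exact hq'
          rw [dist_comm s t]
          exact Real.dist_left_le_of_mem_uIcc h3 |>.trans_eq' (dist_comm _ _)
        exact (hγη h2).trans_le (((min_le_left _ _).trans (min_le_right _ _)).trans (by linarith))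
      have hq2 : (Homotopic.Quotient.mk (γ.subpath 0 t)).symm =
          (Homotopic.Quotient.mk (γ.subpath t s)).trans
            (Homotopic.Quotient.mk (γ.subpath 0 s)).symm := by
        rw [← Homotopic.Quotient.mk_symm, ← Homotopic.Quotient.mk_symm, Path.symm_subpath,
          Path.symm_subpath, ← Homotopic.Quotient.mk_trans]
        exact (Homotopic.Quotient.eq.2 ⟨Path.Homotopy.subpathTransSubpath γ t s 0⟩).symm
      change Homotopic.Quotient.trans (Homotopic.Quotient.trans _ (Homotopic.Quotient.trans _ _))
        (Homotopic.Quotient.trans _ _) = Homotopic.Quotient.trans _ _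
      rw [hq, quotient_trans_symm, quotient_trans_symm, hq2]
      simp only [Homotopic.Quotient.trans_assoc, quotient_symm_trans_trans]
    rw [hmul] at hL'
    exact ⟨_, hL.trans hu hL'⟩
  obtain ⟨N, hN⟩ := exists_nat_gt (1 / η)
  have hN0 : (0 : ℝ) < N := (by positivity : (0 : ℝ) < 1 / η).trans hN
  let τ : ℕ → unitInterval := fun k ↦ Set.projIcc 0 1 zero_le_one (k / N : ℝ)
  have hτ : ∀ k, dist (τ k) (τ (k + 1)) < η := by
    intro k
    have h1 : |(τ k : ℝ) - τ (k + 1)| ≤ |(k / N : ℝ) - ((k + 1 : ℕ) / N : ℝ)| :=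
      Set.abs_projIcc_sub_projIcc zero_le_one
    have h2 : (k / N : ℝ) - ((k + 1 : ℕ) / N : ℝ) = -(1 / N) := by
      push_cast
      field_simp
      ring
    rw [h2, abs_neg, abs_of_pos (one_div_pos.2 hN0)] at h1
    rw [Subtype.dist_eq, Real.dist_eq]
    refine h1.trans_lt ?_
    rw [div_lt_iff₀ hη] at hN
    rw [div_lt_iff₀ hN0]
    linarith
  have hτ0 : τ 0 = 0 := by simp [τ]
  have hτN : τ N = 1 := by
    simp [τ, div_self hN0.ne']
  have h0 : a 0 = 1 := by
    have key : ∀ (x : X) (hx : x = p) (h : Joined p x), (Homotopic.Quotient.mk (T x h)).trans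
        ((Homotopic.Quotient.mk ((Path.refl p).cast rfl hx)).trans
          (Homotopic.Quotient.mk (Path.refl x))).symm =
          Homotopic.Quotient.refl p := by
      rintro x rfl h
      rw [hT]
      simp
    have h1 := key (γ 0) γ.source (hjoin 0)
    rw [← Path.subpath_self] at h1
    exact h1
  have h1 : a 1 = FundamentalGroup.fromPath (Homotopic.Quotient.mk γ).symm := by
    have key : ∀ (x y : X) (hx : x = p) (hy : y = p) (h : Joined p y),
        (Homotopic.Quotient.mk (T y h)).trans
          ((Homotopic.Quotient.mk ((Path.refl p).cast rfl hx)).trans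
          (Homotopic.Quotient.mk (γ.cast hx hy))).symm =
          (Homotopic.Quotient.mk γ).symm := by
      rintro x y hx hy h
      subst hx hy
      rw [hT]
      simp [Homotopic.Quotient.refl_trans]
    have h2 := key (γ 0) (γ 1) γ.source γ.target (hjoin 1)
    rw [← Path.subpath_zero_one] at h2
    exact h2
  have hall : ∀ k, ∃ L, Reach r u p 1 (γ (τ k)) (a (τ k)) L := by
    intro k
    induction k with
    | zero =>
      rw [hτ0, h0, γ.source]
      exact ⟨0, Reach.refl hu p 1 le_rfl⟩
    | succ k ih => exact hadv _ _ (hτ k) ih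
  have := hall N
  rwa [hτN, h1, γ.target] at this

end Homotopy

section Charts

/-- Paths in a compact manifold which are contained in a common small ball are homotopic. -/
lemma exists_homotopic_of_mem_ball {E X : Type*} [NormedAddCommGroup E] [NormedSpace ℝ E]
    [MetricSpace X] [CompactSpace X] [ChartedSpace E X] :
    ∃ R > 0, ∀ (x y z : X) (σ σ' : Path y z), (∀ t, σ t ∈ Metric.ball x R) →
      (∀ t, σ' t ∈ Metric.ball x R) → σ.Homotopic σ' := by
  have hW : ∀ x : X, ∃ ε > 0, Metric.ball (chartAt E x x) ε ⊆ (chartAt E x).target := fun x ↦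
    Metric.isOpen_iff.1 (chartAt E x).open_target _ (mem_chart_target E x)
  choose ε hε hball using hW
  set W : X → Set X := fun x ↦
    (chartAt E x).source ∩ chartAt E x ⁻¹' Metric.ball (chartAt E x x) (ε x) with hWdef
  obtain ⟨R, hR, hcov⟩ := lebesgue_number_lemma_of_metric (isCompact_univ (X := X)) (c := W)
    (fun x ↦ (chartAt E x).isOpen_inter_preimage Metric.isOpen_ball)
    (fun x _ ↦ Set.mem_iUnion.2 ⟨x, mem_chart_source E x, Metric.mem_ball_self (hε x)⟩)
  refine ⟨R, hR, fun x y z σ σ' hσ hσ' ↦ ?_⟩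
  obtain ⟨i, hi⟩ := hcov x trivial
  set φ := chartAt E i with hφ
  have hσW : ∀ t, σ t ∈ W i := fun t ↦ hi (hσ t)
  have hσW' : ∀ t, σ' t ∈ W i := fun t ↦ hi (hσ' t)
  have hc : Continuous fun t ↦ φ (σ t) :=
    φ.continuousOn.comp_continuous σ.continuous fun t ↦ (hσW t).1
  have hc' : Continuous fun t ↦ φ (σ' t) :=
    φ.continuousOn.comp_continuous σ'.continuous fun t ↦ (hσW' t).1
  -- The straight-line homotopy in coordinates stays in the convex ball chosen inside the target of
  -- the chart.
  have hmem : ∀ q : unitInterval × unitInterval,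
      AffineMap.lineMap (φ (σ q.2)) (φ (σ' q.2)) (q.1 : ℝ) ∈ φ.target := by
    intro q
    refine hball i ((convex_ball _ _).lineMap_mem (hσW q.2).2 (hσW' q.2).2 q.1.2)
  have hcont : Continuous fun q : unitInterval × unitInterval ↦
      φ.symm (AffineMap.lineMap (φ (σ q.2)) (φ (σ' q.2)) (q.1 : ℝ)) := by
    refine φ.continuousOn_symm.comp_continuous ?_ hmem
    simp only [AffineMap.lineMap_apply_module]
    have h1 := continuous_subtype_val.comp (continuous_fst (X := unitInterval) (Y := unitInterval))
    exact ((continuous_const.sub h1).smul (hc.comp continuous_snd)).add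
      (h1.smul (hc'.comp continuous_snd))
  exact ⟨{
    toFun := fun q ↦ φ.symm (AffineMap.lineMap (φ (σ q.2)) (φ (σ' q.2)) (q.1 : ℝ))
    continuous_toFun := hcont
    map_zero_left := fun t ↦ by simp [φ.left_inv (hσW t).1]
    map_one_left := fun t ↦ by simp [φ.left_inv (hσW' t).1]
    prop' := by
      rintro s t ht
      have h2 : σ t = σ' t := by
        rcases ht with rfl | ht
        · simp
        · rw [Set.mem_singleton_iff.1 ht]
          simp
      have h3 := φ.left_inv (hσW t).1
      simp [← h2, h3] }⟩

end Charts

end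

end Riem

end

/-! ### From the geodesic flow to the fundamental group -/

theorem proposition6p3 {n : ℕ} (hn : 2 ≤ n)
    {M : Type*} [TopologicalSpace M] [T2Space M] [CompactSpace M]
    [ChartedSpace (EuclideanSpace ℝ (Fin n)) M] [IsManifold (𝓡 n) ∞ M]
    [Bundle.RiemannianBundle (fun x : M ↦ TangentSpace (𝓡 n) x)]
    [IsContMDiffRiemannianBundle (𝓡 n) ∞ (EuclideanSpace ℝ (Fin n))
      (fun x : M ↦ TangentSpace (𝓡 n) x)]
    (d : MetricSpace (Riem.UnitTangentBundle n M))
    (hd : d.toPseudoMetricSpace.toUniformSpace.toTopologicalSpace = instTopologicalSpaceSubtype)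
    (hΦ : Riem.IsEquicontinuousFlow d (Riem.geodesicFlow n M)) (p : M) :
    Finite (FundamentalGroup M p) := by
  obtain ⟨dM, hdM, hdist⟩ := Riem.exists_metricSpace_dist_eq_truncDist n M
  subst hdM
  have hpath : LocallyPathConnectedSpace M :=
    ChartedSpace.locallyPathConnectedSpace (EuclideanSpace ℝ (Fin n)) M
  have hseg : ∀ x y : M, dist x y < 1 → ∀ δ > dist x y, ∃ c : ℝ → M,
      (∀ s t, dist (c s) (c t) ≤ |s - t|) ∧ c 0 = x ∧ c δ = y := by
    intro x y hxy δ hδ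
    have hδ0 : 0 < δ := dist_nonneg.trans_lt hδ
    rw [hdist] at hxy hδ
    obtain ⟨c, hc, h0, h1⟩ := Riem.exists_lipschitz_curve hδ0 (x := x) (y := y) <| by
      rw [Riem.riemannianEDist_eq_ofReal hxy]
      exact (ENNReal.ofReal_lt_ofReal_iff hδ0).2 hδ
    simp only [← hdist] at hc h0 h1
    exact ⟨c, hc, dist_le_zero.1 h0, dist_le_zero.1 h1⟩
  obtain ⟨R, hR, hH⟩ := Riem.exists_homotopic_of_mem_ball (E := EuclideanSpace ℝ (Fin n)) (X := M)
  obtain ⟨r, u, hu, hsurj⟩ := Riem.exists_isLocalCocycle hR one_pos hH hseg p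
  -- The topology of `d` equals that of `SM` only propositionally, so the topological facts are
  -- transported along `hd`.
  have hcompact : @CompactSpace _ d.toUniformSpace.toTopologicalSpace := by
    rw [hd]
    infer_instance
  have hproj : @Continuous _ _ d.toUniformSpace.toTopologicalSpace _
      fun v : Riem.UnitTangentBundle n M ↦ v.1.proj := by
    rw [hd]
    exact (FiberBundle.continuous_proj _ _).comp continuous_subtype_val
  have hneg : @Continuous _ _ d.toUniformSpace.toTopologicalSpace
      d.toUniformSpace.toTopologicalSpace (Riem.unitNeg : Riem.UnitTangentBundle n M → _) := by
    rw [hd]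
    exact Riem.continuous_unitNeg
  have hfib : ∀ v : Riem.UnitTangentBundle n M, ∃ C,
      @IsPreconnected _ d.toUniformSpace.toTopologicalSpace C ∧ v ∈ C ∧ Riem.unitNeg v ∈ C ∧
        ∀ w ∈ C, w.1.proj = v.1.proj := by
    rw [hd]
    exact Riem.exists_isPreconnected_fibre hn
  refine @Riem.finite_of_equicontinuous_flow M (FundamentalGroup M p) (Riem.UnitTangentBundle n M)
    _ _ _ d.toPseudoMetricSpace hcompact r 1 u hu one_pos hseg p hsurj (Riem.geodesicFlow n M)
    Riem.geodesicFlow_zero Riem.geodesicFlow_add hΦ (fun v ↦ v.1.proj) hproj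
    (fun v s t ↦ (hdist _ _).trans_le (Riem.truncDist_geodesicFlow_le v s t)) Riem.unitNeg hneg
    Riem.geodesicFlow_unitNeg (fun _ ↦ rfl) hfib fun c L σ hL hσ hc ↦ ?_
  refine Riem.exists_eq_proj_geodesicFlow hL hσ ?_ fun s hs t ht hst ↦
    (hdist _ _).symm.trans (hc s hs t ht hst)
  -- Continuity of `c` comes from the isometry at times closer than `σ`.
  refine Metric.continuousOn_iff.2 fun s hs ε hε ↦ ⟨min ε σ, lt_min hε hσ, fun t ht hts ↦ ?_⟩
  rw [Real.dist_eq] at hts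
  rw [hc t ht s hs (hts.trans_le (min_le_right _ _))]
  exact hts.trans_le (min_le_left _ _)
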